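/- **Theorem (second-order convergence of biased policy gradient).** *Setting.* Consider a Markov decision process with state space $\mathcal S$, action space $\mathcal A$, transition law $\mathcal P(\cdot\mid s,a)$, reward $\mathcal R(s,a)$, initial state distribution $\rho_0$, discount factor $\gamma\in(0,1)$, and policies with (strictly positive) probability mass or density functions $\pi_\theta(a\mid s)$, $\theta\in\mathbb R^M$, $M\ge 1$. Let $$J(\theta)=\mathbb E\Big[\sum_{k\ge 0}\gamma^k\mathcal R(s_k,a_k)\Big],\qquad s_0\sim\rho_0,\ a_k\sim\pi_\theta(\cdot\mid s_k),\ s_{k+1}\sim\mathcal P(\cdot\mid s_k,a_k).$$ The biased policy gradient algorithm with step size $\mu>0$ is $\theta_{t+1}=\theta_t+\mu\,\hat G(\theta_t;z_t,\tau_t)$, where $z_t$ is an auxiliary random input of the gradient estimator (e.g. the critic parameter; absent for Monte-Carlo estimators) and $\tau_t$ is a trajectory of a fixed length $H$ which, conditionally on $\theta_0,\dots,\theta_t$ and $z_t$, is sampled under $\pi_{\theta_t}$ from $s_0\sim\rho_0$. Let $\mathcal F_t=\sigma(\theta_0,\dots,\theta_t)$, let $G(\theta;z)=\mathbb E_\tau[\hat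 G(\theta;z,\tau)]$ be the expectation over a trajectory $\tau$ of length $H$ sampled under $\pi_\theta$ only, and set $\xi_{t+1}=\hat G(\theta_t;z_t,\tau_t)-G(\theta_t;z_t)$ (noise), $d_{t+1}=G(\theta_t;z_t)-\nabla J(\theta_t)$ (bias). Let $\mathcal R_{max},G,B,\beta_R,\sigma,D,\sigma_l,\delta,\omega>0$, $\iota\ge 0$, $0<\nu\le 4$, and put $$L=\frac{\mathcal R_{max}B}{(1-\gamma)^2}+\frac{(1+\gamma)\mathcal R_{max}G^2}{(1-\gamma)^3},\qquad \ell=L\sigma^2-D^2\mu,$$ $$\mathcal G=\{\theta:\|\nabla J(\theta)\|^2\ge\mu\ell(1+\tfrac1\delta)\},\quad \mathcal H=\{\theta\notin\mathcal G:\lambda_{max}(\nabla^2J(\theta))\ge\omega\},\quad \mathcal M=\{\theta\notin\mathcal G:\lambda_{max}(\nabla^2J(\theta))<\omega\}.$$ *Assumptions.* 1. For all $s,a,\theta$: $|\mathcal R(s,a)|\le\mathcal R_{max}$; the score $\nabla\log\pi_\theta(a\mid s)$ exists with norm at most $G$; its Jacobian exists, $\|\nabla^2\log\pi_\theta(a\mid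 s)\|<B$, and $\|\nabla^2\log\pi_{\theta_1}(a\mid s)-\nabla^2\log\pi_{\theta_2}(a\mid s)\|\le\iota\|\theta_1-\theta_2\|$ for all $\theta_1,\theta_2$. 2. There is a matrix-valued function $R_\xi$ on $\mathbb R^M$ with $\mathbb E[\xi_{t+1}\xi_{t+1}^\top\mid\mathcal F_t]=R_\xi(\theta_t)$ for all $t$ and $\|R_\xi(\theta_1)-R_\xi(\theta_2)\|\le\beta_R\|\theta_1-\theta_2\|^\nu$ for all $\theta_1,\theta_2$. 3. (Correlated negative curvature.) Whenever $\theta_t\in\mathcal H$, $\lambda_{min}\big((V^{>0}_{\theta_t})^\top R_\xi(\theta_t)V^{>0}_{\theta_t}\big)\ge\sigma_l^2$, where the columns of $V^{>0}_\theta$ are orthonormal eigenvectors spanning the eigenspaces of $\nabla^2J(\theta)$ with positive eigenvalues. 4. For all $t$, almost surely, $\|\hat G(\theta_t;z_t,\tau_t)\|\le\sigma$, $\ \mathbb E[\|d_{t+1}\|^4\mid\mathcal F_t]\le D^4\mu^4$, and $\mathbb E[\|d_{t+1}\|^2\|\xi_{t+1}\|^2\mid\mathcal F_t]\le\sigma^2\,\mathbb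 E[\|d_{t+1}\|^2\mid\mathcal F_t]$. *Conclusion.* For all sufficiently small step sizes, i.e. for all $0<\mu<\mu_0$ with some $\mu_0>0$ that depends only on $M,\gamma,\mathcal R_{max},G,B,\iota,\beta_R,\nu,\sigma,D,\sigma_l,\delta,\omega$, the following holds with probability at least $1-\delta$: there is an iteration $$T\le\frac{4\mathcal R_{max}}{\mu^2(1-\gamma)(L\sigma^2+D^2\mu)\,\delta}\cdot\frac{\log\!\big(2M\frac{\sigma^2}{\sigma_l^2}+1\big)}{\log(1+2\mu\omega)}$$ with $\theta_T\in\mathcal M$; in particular $\|\nabla J(\theta_T)\|^2\le\mu\ell(1+\frac1\delta)$ and $\lambda_{max}(\nabla^2J(\theta_T))\le\omega$. -/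

import Mathlib

open MeasureTheory ProbabilityTheory
open scoped RealInnerProductSpace

noncomputable section

namespace BiasedPG

/-- The parameter space `ℝ^M` with its Euclidean norm. -/
abbrev Param (M : ℕ) : Type := EuclideanSpace ℝ (Fin M)

/-- A Markov decision process with measurable state and action spaces: transition probabilities
`P(· | s, a)`, a reward function, and an initial state distribution. -/
structure MDP (S A : Type*) [MeasurableSpace S] [MeasurableSpace A] where
  trans : Kernel (S × A) S
  isMarkovKernel_trans : IsMarkovKernel trans
  reward : S → A → ℝ
  measurable_reward : Measurable (Function.uncurry reward)
  init : Measure S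
  isProbabilityMeasure_init : IsProbabilityMeasure init

/-- A family of stochastic policies `π_θ(a | s)`, `θ ∈ ℝ^M`, given by probability densities with
respect to a reference measure on the actions (counting measure for discrete actions, Lebesgue
measure for Gaussian policies). -/
structure Policy (M : ℕ) (S A : Type*) [MeasurableSpace S] [MeasurableSpace A]
    (ref : Measure A) where
  dens : Param M → S → A → ℝ
  measurable_dens : ∀ θ, Measurable (Function.uncurry (dens θ))
  dens_nonneg : ∀ θ s a, 0 ≤ dens θ s a
  lintegral_dens : ∀ θ s, ∫⁻ a, ENNReal.ofReal (dens θ s a) ∂ref = 1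

attribute [instance] MDP.isMarkovKernel_trans MDP.isProbabilityMeasure_init

section Objective

variable {M : ℕ} {S A : Type*} [MeasurableSpace S] [MeasurableSpace A]
  {ref : Measure A} [SFinite ref]

/-- The law of the action drawn from `π_θ(· | s)`. -/
def Policy.kernel (pol : Policy M S A ref) (θ : Param M) : Kernel S A :=
  (Kernel.const S ref).withDensity (fun s a => ENNReal.ofReal (pol.dens θ s a))

instance Policy.isMarkovKernel_kernel (pol : Policy M S A ref) (θ : Param M) :
    IsMarkovKernel (pol.kernel θ) := by
  refine ⟨fun s => ⟨?_⟩⟩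
  have h : Measurable (Function.uncurry fun s a => ENNReal.ofReal (pol.dens θ s a)) :=
    (pol.measurable_dens θ).ennreal_ofReal
  rw [Policy.kernel, Kernel.withDensity_apply' _ h]
  simpa using pol.lintegral_dens θ s

/-- One step of the state-action chain: `s' ∼ P(· | s, a)`, then `a' ∼ π_θ(· | s')`. -/
def stepKernel (mdp : MDP S A) (pol : Policy M S A ref) (θ : Param M) :
    Kernel (S × A) (S × A) :=
  mdp.trans ⊗ₖ (pol.kernel θ).prodMkLeft (S × A)

instance isMarkovKernel_stepKernel (mdp : MDP S A) (pol : Policy M S A ref) (θ : Param M) :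
    IsMarkovKernel (stepKernel mdp pol θ) := by
  unfold stepKernel; infer_instance

/-- The step kernel as a function of the trajectory up to time `k` (it uses the last pair only). -/
def histKernel (mdp : MDP S A) (pol : Policy M S A ref) (θ : Param M) (k : ℕ) :
    Kernel ((i : Finset.Iic k) → (fun _ : ℕ => S × A) i) (S × A) :=
  (stepKernel mdp pol θ).comap (fun h => h ⟨k, Finset.mem_Iic.2 le_rfl⟩) (measurable_pi_apply _)

instance isMarkovKernel_histKernel (mdp : MDP S A) (pol : Policy M S A ref) (θ : Param M)
    (k : ℕ) : IsMarkovKernel (histKernel mdp pol θ k) := by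
  unfold histKernel; infer_instance

/-- The law of the infinite trajectory `(s_0, a_0), (s_1, a_1), …` under `π_θ`, started from the
initial state distribution. -/
def trajLaw (mdp : MDP S A) (pol : Policy M S A ref) (θ : Param M) : Measure (ℕ → S × A) :=
  Kernel.trajMeasure (X := fun _ => S × A) (mdp.init ⊗ₘ pol.kernel θ) (histKernel mdp pol θ)

/-- The law of a trajectory of length `H` under `π_θ`. -/
def truncTrajLaw (mdp : MDP S A) (pol : Policy M S A ref) (H : ℕ) (θ : Param M) :
    Measure (Fin H → S × A) :=
  (trajLaw mdp pol θ).map (fun x i => x i)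

/-- The expected infinite-horizon discounted reward `J(θ)`. -/
def J (mdp : MDP S A) (pol : Policy M S A ref) (γ : ℝ) (θ : Param M) : ℝ :=
  ∫ x, ∑' k : ℕ, γ ^ k * mdp.reward (x k).1 (x k).2 ∂(trajLaw mdp pol θ)

/-- The score function `∇ log π_θ(a | s)`. -/
def score (pol : Policy M S A ref) (s : S) (a : A) (θ : Param M) : Param M :=
  gradient (fun θ' => Real.log (pol.dens θ' s a)) θ

/-- Bounded rewards; bounded score function; bounded and Lipschitz Jacobian of the score. -/
structure BoundedSmooth (mdp : MDP S A) (pol : Policy M S A ref) (Rmax G B ι : ℝ) : Prop where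
  abs_reward_le : ∀ s a, |mdp.reward s a| ≤ Rmax
  dens_pos : ∀ θ s a, 0 < pol.dens θ s a
  differentiable_log : ∀ s a, Differentiable ℝ (fun θ => Real.log (pol.dens θ s a))
  norm_score_le : ∀ s a θ, ‖score pol s a θ‖ ≤ G
  differentiable_score : ∀ s a, Differentiable ℝ (score pol s a)
  norm_jacobian_lt : ∀ s a θ, ‖fderiv ℝ (score pol s a) θ‖ < B
  jacobian_lipschitz : ∀ s a θ₁ θ₂,
    ‖fderiv ℝ (score pol s a) θ₁ - fderiv ℝ (score pol s a) θ₂‖ ≤ ι * ‖θ₁ - θ₂‖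

end Objective

/-- `L = R_max B / (1-γ)² + (1+γ) R_max G² / (1-γ)³`. -/
def smoothConst (Rmax G B γ : ℝ) : ℝ :=
  Rmax * B / (1 - γ) ^ 2 + (1 + γ) * Rmax * G ^ 2 / (1 - γ) ^ 3

section Regions

variable {M : ℕ}

/-- The Hessian of `f` at `θ`, as a linear operator. -/
def hess (f : Param M → ℝ) (θ : Param M) : Param M →L[ℝ] Param M := fderiv ℝ (gradient f) θ

/-- The largest eigenvalue of a symmetric operator on `ℝ^M`. -/
def lamMax (T : Param M →L[ℝ] Param M) : ℝ :=
  sSup {l : ℝ | Module.End.HasEigenvalue (T : Module.End ℝ (Param M)) l}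

/-- The span of the eigenvectors of `T` with positive eigenvalue, i.e. the range of `V^{>0}`. -/
def posEigenspace (T : Param M →L[ℝ] Param M) : Submodule ℝ (Param M) :=
  ⨆ (l : ℝ) (_ : 0 < l), Module.End.eigenspace (T : Module.End ℝ (Param M)) l

/-- Large gradient: `‖∇f(θ)‖² ≥ μ ℓ (1 + 1/δ)`. -/
def largeGrad (f : Param M → ℝ) (μ ℓ δ : ℝ) : Set (Param M) :=
  {θ | μ * ℓ * (1 + 1 / δ) ≤ ‖gradient f θ‖ ^ 2}

/-- Approximate strict saddle points. -/
def strictSaddle (f : Param M → ℝ) (μ ℓ δ ω : ℝ) : Set (Param M) :=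
  {θ | θ ∉ largeGrad f μ ℓ δ ∧ ω ≤ lamMax (hess f θ)}

/-- Approximate second-order stationary points. -/
def secondOrder (f : Param M → ℝ) (μ ℓ δ ω : ℝ) : Set (Param M) :=
  {θ | θ ∉ largeGrad f μ ℓ δ ∧ lamMax (hess f θ) < ω}

end Regions

section Algorithm

variable {M : ℕ} {S A Z Ω : Type*} [MeasurableSpace S] [MeasurableSpace A] [MeasurableSpace Z]
  [MeasurableSpace Ω] {ref : Measure A} [SFinite ref] {H : ℕ}

/-- `ℱ_t`, the σ-algebra generated by `θ_0, …, θ_t`. -/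
@[reducible] def history (θ : ℕ → Ω → Param M) (t : ℕ) : MeasurableSpace Ω :=
  ⨆ s ≤ t, MeasurableSpace.comap (θ s) inferInstance

/-- `θ` are the iterates of biased policy gradient with step size `μ` and gradient estimator
`Ghat`. At step `t` the estimator receives `θ_t`, an auxiliary random input `z_t` (such as the
critic parameter of an actor-critic method; trivial for the Monte-Carlo estimator), and a
trajectory `τ_t` of length `H`, which conditionally on `θ_0, …, θ_t` and `z_t` is drawn
under `π_{θ_t}`. -/
structure IsRun (mdp : MDP S A) (pol : Policy M S A ref) (P : Measure Ω) (μ : ℝ)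
    (Ghat : Param M → Z → (Fin H → S × A) → Param M)
    (θ : ℕ → Ω → Param M) (z : ℕ → Ω → Z) (τ : ℕ → Ω → (Fin H → S × A)) : Prop where
  measurable_estimator : Measurable
    (fun p : Param M × Z × (Fin H → S × A) => Ghat p.1 p.2.1 p.2.2)
  measurable_iterate : ∀ t, Measurable (θ t)
  measurable_aux : ∀ t, Measurable (z t)
  measurable_traj : ∀ t, Measurable (τ t)
  update : ∀ t w, θ (t + 1) w = θ t w + μ • Ghat (θ t w) (z t w) (τ t w)
  sample : ∀ (t : ℕ) (C : Set (Fin H → S × A)), MeasurableSet C →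
    P[(τ t ⁻¹' C).indicator (fun _ => (1 : ℝ)) |
        history θ t ⊔ MeasurableSpace.comap (z t) inferInstance]
      =ᵐ[P] fun w => (truncTrajLaw mdp pol H (θ t w)).real C

/-- `G(θ) = E_τ[Ĝ(θ; τ)]`, the expectation over the sampled trajectory only. -/
def meanEstimator (mdp : MDP S A) (pol : Policy M S A ref)
    (Ghat : Param M → Z → (Fin H → S × A) → Param M) (θ : Param M) (z : Z) : Param M :=
  ∫ x, Ghat θ z x ∂(truncTrajLaw mdp pol H θ)

/-- The noise `ξ_{t+1} = Ĝ(θ_t; τ_t) - G(θ_t)`. -/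
def noise (mdp : MDP S A) (pol : Policy M S A ref)
    (Ghat : Param M → Z → (Fin H → S × A) → Param M)
    (θ : ℕ → Ω → Param M) (z : ℕ → Ω → Z) (τ : ℕ → Ω → (Fin H → S × A)) (t : ℕ) (w : Ω) :
    Param M :=
  Ghat (θ t w) (z t w) (τ t w) - meanEstimator mdp pol Ghat (θ t w) (z t w)

/-- The bias `d_{t+1} = G(θ_t) - ∇J(θ_t)`. -/
def bias (mdp : MDP S A) (pol : Policy M S A ref) (γ : ℝ)
    (Ghat : Param M → Z → (Fin H → S × A) → Param M)
    (θ : ℕ → Ω → Param M) (z : ℕ → Ω → Z) (t : ℕ) (w : Ω) : Param M :=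
  meanEstimator mdp pol Ghat (θ t w) (z t w) - gradient (J mdp pol γ) (θ t w)

/-- `‖Ĝ‖ ≤ σ`, `E[‖d‖⁴ | ℱ_t] ≤ D⁴ μ⁴` and `E[‖d‖² ‖ξ‖² | ℱ_t] ≤ σ² E[‖d‖² | ℱ_t]`. -/
structure MomentBounds (mdp : MDP S A) (pol : Policy M S A ref) (γ : ℝ) (P : Measure Ω)
    (μ σ D : ℝ) (Ghat : Param M → Z → (Fin H → S × A) → Param M)
    (θ : ℕ → Ω → Param M) (z : ℕ → Ω → Z) (τ : ℕ → Ω → (Fin H → S × A)) : Prop where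
  norm_estimator_le : ∀ t, ∀ᵐ w ∂P, ‖Ghat (θ t w) (z t w) (τ t w)‖ ≤ σ
  bias_fourth : ∀ t, P[fun w => ‖bias mdp pol γ Ghat θ z t w‖ ^ 4 | history θ t]
    ≤ᵐ[P] fun _ => D ^ 4 * μ ^ 4
  bias_noise : ∀ t,
    P[fun w => ‖bias mdp pol γ Ghat θ z t w‖ ^ 2 * ‖noise mdp pol Ghat θ z τ t w‖ ^ 2 |
        history θ t]
      ≤ᵐ[P] fun w => σ ^ 2 * (P[fun w' => ‖bias mdp pol γ Ghat θ z t w'‖ ^ 2 | history θ t]) w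

/-- `R_ξ(θ_t) = E[ξ_{t+1} ξ_{t+1}ᵀ | ℱ_t]` for every `t`, and `R_ξ` is Hölder continuous:
`‖R_ξ(θ₁) - R_ξ(θ₂)‖ ≤ β ‖θ₁ - θ₂‖^ν`. -/
structure HolderCovariance (mdp : MDP S A) (pol : Policy M S A ref) (P : Measure Ω) (β ν : ℝ)
    (Ghat : Param M → Z → (Fin H → S × A) → Param M)
    (θ : ℕ → Ω → Param M) (z : ℕ → Ω → Z) (τ : ℕ → Ω → (Fin H → S × A))
    (Rxi : Param M → Param M →L[ℝ] Param M) : Prop where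
  covariance : ∀ (t : ℕ) (u v : Param M),
    P[fun w => ⟪noise mdp pol Ghat θ z τ t w, u⟫ * ⟪noise mdp pol Ghat θ z τ t w, v⟫ |
        history θ t]
      =ᵐ[P] fun w => ⟪Rxi (θ t w) u, v⟫
  holder : ∀ θ₁ θ₂, ‖Rxi θ₁ - Rxi θ₂‖ ≤ β * ‖θ₁ - θ₂‖ ^ ν

/-- Correlated negative curvature: `λ_min((V^{>0})ᵀ R_ξ(θ_t) V^{>0}) ≥ σ_l²` whenever `θ_t` is an
approximate strict saddle point. -/
def CorrelatedCurvature (f : Param M → ℝ) (P : Measure Ω) (μ ℓ δ ω σl : ℝ)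
    (θ : ℕ → Ω → Param M) (Rxi : Param M → Param M →L[ℝ] Param M) : Prop :=
  ∀ t, ∀ᵐ w ∂P, θ t w ∈ strictSaddle f μ ℓ δ ω →
    ∀ u ∈ posEigenspace (hess f (θ t w)), σl ^ 2 * ‖u‖ ^ 2 ≤ ⟪Rxi (θ t w) u, u⟫

end Algorithm

/-- The iteration bound
`4 R_max / (μ² (1-γ) (Lσ² + D²μ) δ) · log(2Mσ²/σ_l² + 1) / log(1 + 2μω)`. -/
def iterBound (M : ℕ) (Rmax γ L σ D σl δ ω μ : ℝ) : ℝ :=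
  4 * Rmax / (μ ^ 2 * (1 - γ) * (L * σ ^ 2 + D ^ 2 * μ) * δ) *
    (Real.log (2 * M * (σ ^ 2 / σl ^ 2) + 1) / Real.log (1 + 2 * μ * ω))

end BiasedPG

end

open MeasureTheory ProbabilityTheory
open scoped RealInnerProductSpace

set_option maxSynthPendingDepth 3

/-! The argument is an expected-ascent argument: outside the set of approximate second-order points
the expected objective rises by at least `a μ²` per step, with `a = Lσ²/(4δ)`. Since `J` is bounded
by `F = R_max/(1-γ)`, a run cannot stay outside for long with probability above `δ`.

Regularity of `J`. The law of a finite trajectory under `π_θ` has density `exp (logLik θ - logLik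
θ₀)` relative to `π_θ₀`, because the initial and transition laws cancel. Differentiating under a
fixed measure bounds the derivatives of the expected reward at time `n` by polynomials in `n`;
discounted summation yields an `L`-Lipschitz gradient with exactly the stated `L`, and a Lipschitz
Hessian with some constant `K` (`smoothObjective_J`). The sampling assumption makes the noise
centred given the past (`ascentProcess_of_isRun`), and from there on only the abstract recursion
`AscentProcess` matters.

Large gradient. The descent lemma gives `E f(θ_{t+1}) ≥ E f(θ_t) + μ/2 E‖∇f‖² - μ²/2 (Lσ² + D²μ)`
(`ascent_step`). The threshold on the gradient makes this a gain of `a μ²` for small `μ`.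

Strict saddle. Cut the event into pieces on which `θ_t` is within `μ` of a fixed point `p`, and let
`v` be a unit eigenvector of the Hessian at `p` with eigenvalue `λ ≥ ω`. For `s` up to order `1/μ`
the fourth moment of `θ_{t+s} - p` is `O(μ²)` (`fourth_moment_le`). Hence the noise along `v` keeps
most of its variance, and `y_s = ⟪v, ∇f(p)⟫ + λ⟪v, θ_{t+s} - p⟫` is a good model of the gradient
component along `v`. Each step adds at least `μ²ω²σ_l²/4` to `E y_s²` (`second_moment_step`); linear
growth suffices. As `‖∇f‖² ≥ y²/2 - K²‖θ - p‖⁴`, summing `ascent_step` produces a gain quadratic in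
`s` against a loss linear in `s`; a block of `s ≈ escapeTime/μ` steps therefore gains `a μ² s`
(`saddle_ascent`, `strict_saddle_ascent`).

Conclusion. Strong induction on the number of steps (`stayEvent_le`) gives `a μ² m P(no second-order
point before time m) ≤ E[F - f(θ_0)] ≤ 2F`. So order `μ⁻²` steps are enough, while the stated
iteration bound is at least of order `μ⁻³` (`le_mul_iterBound`). -/

namespace BiasedPG

/-! ### Likelihood ratios between trajectory laws of two policies. -/

section ChangeOfMeasure

open Preorder

variable {M : ℕ} {S A : Type*} [MeasurableSpace S] [MeasurableSpace A]
  {ref : Measure A}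

/-- The log-likelihood `log π_θ(a | s)` of a state-action pair. -/
noncomputable def logDens (pol : Policy M S A ref) (θ : Param M) (x : S × A) : ℝ :=
  Real.log (pol.dens θ x.1 x.2)

/-- The log-likelihood of the actions of a finite trajectory. -/
noncomputable def logLik (pol : Policy M S A ref) (n : ℕ) (θ : Param M)
    (h : Finset.Iic n → S × A) : ℝ :=
  ∑ i, logDens pol θ (h i)

lemma measurable_logDens (pol : Policy M S A ref) (θ : Param M) :
    Measurable (logDens pol θ) :=
  Real.measurable_log.comp (pol.measurable_dens θ)

lemma measurable_logLik (pol : Policy M S A ref) (n : ℕ) (θ : Param M) :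
    Measurable (logLik pol n θ) := by
  unfold logLik
  have := measurable_logDens pol θ
  fun_prop

lemma measurable_expLogDens (pol : Policy M S A ref) (θ θ₀ : Param M) :
    Measurable fun x : S × A =>
      ENNReal.ofReal (Real.exp (logDens pol θ x - logDens pol θ₀ x)) :=
  ((measurable_logDens pol θ).sub (measurable_logDens pol θ₀)).exp.ennreal_ofReal

/-- Append one element to a finite trajectory. -/
def snocTraj {X : Type*} (n : ℕ) (p : (Finset.Iic n → X) × X) : Finset.Iic (n + 1) → X :=
  fun i => if h : (i : ℕ) ≤ n then p.1 ⟨i, Finset.mem_Iic.2 h⟩ else p.2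

lemma measurable_snocTraj {X : Type*} [MeasurableSpace X] (n : ℕ) :
    Measurable (snocTraj (X := X) n) := by
  refine measurable_pi_lambda _ fun i => ?_
  by_cases h : (i : ℕ) ≤ n
  · simp only [snocTraj, h, dite_true]; fun_prop
  · simp only [snocTraj, h, dite_false]; fun_prop

lemma snocTraj_frestrictLe {X : Type*} (n : ℕ) (x : ℕ → X) :
    snocTraj n (frestrictLe (π := fun _ : ℕ => X) n x, x (n + 1)) =
      frestrictLe (π := fun _ : ℕ => X) (n + 1) x := by
  funext i
  by_cases h : (i : ℕ) ≤ n
  · simp [snocTraj, h]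
  · have : (i : ℕ) = n + 1 := le_antisymm (Finset.mem_Iic.1 i.2) (by omega)
    simp [snocTraj, this]

lemma logLik_snocTraj (pol : Policy M S A ref) (n : ℕ) (θ : Param M)
    (h : Finset.Iic n → S × A) (y : S × A) :
    logLik pol (n + 1) θ (snocTraj n (h, y)) = logLik pol n θ h + logDens pol θ y := by
  have key : ∀ (m : ℕ) (g : Finset.Iic m → S × A) (e : ℕ → ℝ),
      (∀ i : Finset.Iic m, e i = logDens pol θ (g i)) →
      logLik pol m θ g = ∑ i ∈ Finset.range (m + 1), e i := by
    intro m g e he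
    have : Finset.range (m + 1) = Finset.Iic m := by ext; simp
    rw [this, ← Finset.sum_coe_sort, logLik]
    exact Finset.sum_congr rfl fun i _ => (he i).symm
  -- A common extension to all of `ℕ` turns both sums over subtypes into sums over ranges.
  let e : ℕ → ℝ := fun i => if hi : i ≤ n then logDens pol θ (h ⟨i, Finset.mem_Iic.2 hi⟩)
    else logDens pol θ y
  rw [key (n + 1) _ e, key n h e, Finset.sum_range_succ _ (n + 1)]
  · simp [e]
  · intro i
    have := Finset.mem_Iic.1 i.2
    simp [e, this]
  · intro i
    by_cases hi : (i : ℕ) ≤ n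
    · simp [e, snocTraj, hi]
    · simp [e, snocTraj, hi]

variable [SFinite ref]

/-- The law of the first `n + 1` state-action pairs. -/
noncomputable def finLaw (mdp : MDP S A) (pol : Policy M S A ref) (n : ℕ) (θ : Param M) :
    Measure (Finset.Iic n → S × A) :=
  (trajLaw mdp pol θ).map (frestrictLe (π := fun _ : ℕ => S × A) n)

instance isProbabilityMeasure_trajLaw (mdp : MDP S A) (pol : Policy M S A ref) (θ : Param M) :
    IsProbabilityMeasure (trajLaw mdp pol θ) := by
  unfold trajLaw; infer_instance

instance isProbabilityMeasure_finLaw (mdp : MDP S A) (pol : Policy M S A ref) (n : ℕ)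
    (θ : Param M) : IsProbabilityMeasure (finLaw mdp pol n θ) :=
  Measure.isProbabilityMeasure_map (measurable_frestrictLe _).aemeasurable

/-- Positive densities make the ratio an exponential of a difference of logarithms. Working with
`∫⁻` keeps the whole change of measure free of integrability conditions. -/
lemma lintegral_policyKernel (pol : Policy M S A ref) (hpos : ∀ θ s a, 0 < pol.dens θ s a)
    (θ θ₀ : Param M) (s : S) {F : A → ENNReal} (hF : Measurable F) :
    ∫⁻ a, F a ∂(pol.kernel θ s) = ∫⁻ a, F a *
      ENNReal.ofReal (Real.exp (logDens pol θ (s, a) - logDens pol θ₀ (s, a)))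
        ∂(pol.kernel θ₀ s) := by
  have hm : ∀ θ, Measurable (Function.uncurry fun s a => ENNReal.ofReal (pol.dens θ s a)) :=
    fun θ => (pol.measurable_dens θ).ennreal_ofReal
  rw [Policy.kernel, Kernel.lintegral_withDensity _ (hm θ) _ hF, Policy.kernel,
    Kernel.lintegral_withDensity _ (hm θ₀) _
      (hF.fun_mul ((measurable_expLogDens pol θ θ₀).fun_comp measurable_prodMk_left))]
  refine lintegral_congr fun a => ?_
  have h3 := hpos θ s a
  have h4 := hpos θ₀ s a
  have : pol.dens θ s a = pol.dens θ₀ s a *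
      Real.exp (logDens pol θ (s, a) - logDens pol θ₀ (s, a)) := by
    simp only [logDens]
    rw [Real.exp_sub, Real.exp_log h3, Real.exp_log h4]
    field_simp
  rw [this, ENNReal.ofReal_mul h4.le]
  ring

lemma lintegral_stepKernel (mdp : MDP S A) (pol : Policy M S A ref)
    (hpos : ∀ θ s a, 0 < pol.dens θ s a) (θ θ₀ : Param M) (x : S × A)
    {F : S × A → ENNReal} (hF : Measurable F) :
    ∫⁻ y, F y ∂(stepKernel mdp pol θ x) = ∫⁻ y, F y *
      ENNReal.ofReal (Real.exp (logDens pol θ y - logDens pol θ₀ y))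
        ∂(stepKernel mdp pol θ₀ x) := by
  rw [stepKernel, Kernel.lintegral_compProd _ _ _ hF, stepKernel,
    Kernel.lintegral_compProd _ _ _ (hF.fun_mul (measurable_expLogDens pol θ θ₀))]
  refine lintegral_congr fun s => ?_
  simp only [Kernel.prodMkLeft_apply]
  exact lintegral_policyKernel pol hpos θ θ₀ s (hF.comp measurable_prodMk_left)

lemma lintegral_initLaw (mdp : MDP S A) (pol : Policy M S A ref)
    (hpos : ∀ θ s a, 0 < pol.dens θ s a) (θ θ₀ : Param M)
    {F : S × A → ENNReal} (hF : Measurable F) :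
    ∫⁻ y, F y ∂(mdp.init ⊗ₘ pol.kernel θ) = ∫⁻ y, F y *
      ENNReal.ofReal (Real.exp (logDens pol θ y - logDens pol θ₀ y))
        ∂(mdp.init ⊗ₘ pol.kernel θ₀) := by
  rw [Measure.lintegral_compProd hF,
    Measure.lintegral_compProd (hF.fun_mul (measurable_expLogDens pol θ θ₀))]
  refine lintegral_congr fun s => ?_
  exact lintegral_policyKernel pol hpos θ θ₀ s (hF.comp measurable_prodMk_left)

lemma finLaw_zero (mdp : MDP S A) (pol : Policy M S A ref) (θ : Param M) :
    finLaw mdp pol 0 θ = (mdp.init ⊗ₘ pol.kernel θ).map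
      (MeasurableEquiv.piUnique (fun _ : Finset.Iic 0 => S × A)).symm := by
  rw [finLaw, trajLaw, Kernel.trajMeasure, Measure.map_comp _ _ (by fun_prop),
    Kernel.traj_map_frestrictLe, Kernel.partialTraj_self]
  exact Measure.id_comp

lemma finLaw_succ (mdp : MDP S A) (pol : Policy M S A ref) (n : ℕ) (θ : Param M) :
    finLaw mdp pol (n + 1) θ =
      (finLaw mdp pol n θ ⊗ₘ histKernel mdp pol θ n).map (snocTraj n) := by
  rw [finLaw, finLaw, trajLaw, Kernel.map_frestrictLe_trajMeasure_compProd_eq_map_trajMeasure,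
    Measure.map_map (measurable_snocTraj n) (by fun_prop)]
  congr 1
  funext x
  exact (snocTraj_frestrictLe n x).symm

/-- Only the actions are reweighted, as the initial law and the transitions do not depend on the
parameter. Each new pair multiplies the weight by its own ratio, so the exponents add up along the
trajectory. -/
lemma lintegral_finLaw (mdp : MDP S A) (pol : Policy M S A ref)
    (hpos : ∀ θ s a, 0 < pol.dens θ s a) (n : ℕ) (θ θ₀ : Param M)
    {F : (Finset.Iic n → S × A) → ENNReal} (hF : Measurable F) :
    ∫⁻ h, F h ∂(finLaw mdp pol n θ) = ∫⁻ h, F h *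
      ENNReal.ofReal (Real.exp (logLik pol n θ h - logLik pol n θ₀ h))
        ∂(finLaw mdp pol n θ₀) := by
  induction n with
  | zero =>
    have hw : Measurable fun h => ENNReal.ofReal
        (Real.exp (logLik pol 0 θ h - logLik pol 0 θ₀ h)) :=
      ((measurable_logLik pol 0 θ).sub (measurable_logLik pol 0 θ₀)).exp.ennreal_ofReal
    rw [finLaw_zero, finLaw_zero, lintegral_map hF (by fun_prop),
      lintegral_map (hF.fun_mul hw) (by fun_prop),
      lintegral_initLaw mdp pol hpos θ θ₀ (hF.fun_comp (MeasurableEquiv.measurable _))]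
    refine lintegral_congr fun y => ?_
    have : ∀ θ, logLik pol 0 θ ((MeasurableEquiv.piUnique
        (fun _ : Finset.Iic 0 => S × A)).symm y) = logDens pol θ y := by
      intro θ
      rw [logLik, Fintype.sum_unique]
      rfl
    simp only [this]
  | succ n ih =>
    have hw : ∀ m, Measurable fun h => ENNReal.ofReal
        (Real.exp (logLik pol m θ h - logLik pol m θ₀ h)) := fun m =>
      ((measurable_logLik pol m θ).sub (measurable_logLik pol m θ₀)).exp.ennreal_ofReal
    have hs := measurable_snocTraj (X := S × A) n
    have hd := measurable_expLogDens pol θ θ₀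
    rw [finLaw_succ, finLaw_succ, lintegral_map hF hs, lintegral_map (hF.fun_mul (hw _)) hs,
      Measure.lintegral_compProd (hF.fun_comp hs),
      Measure.lintegral_compProd ((hF.fun_mul (hw _)).fun_comp hs)]
    have hstep : ∀ h : Finset.Iic n → S × A,
        ∫⁻ y, F (snocTraj n (h, y)) ∂(histKernel mdp pol θ n h) =
        ∫⁻ y, F (snocTraj n (h, y)) *
          ENNReal.ofReal (Real.exp (logDens pol θ y - logDens pol θ₀ y))
          ∂(histKernel mdp pol θ₀ n h) := by
      intro h
      simp only [histKernel, Kernel.comap_apply]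
      exact lintegral_stepKernel mdp pol hpos θ θ₀ _ (hF.comp (hs.comp measurable_prodMk_left))
    simp only [hstep]
    -- The induction hypothesis is applied to the inner integral, already reweighted in its last
    -- pair, as a function of the past.
    rw [ih (Measurable.lintegral_kernel_prod_right'
      (f := fun p : (Finset.Iic n → S × A) × (S × A) => F (snocTraj n p) *
          ENNReal.ofReal (Real.exp (logDens pol θ p.2 - logDens pol θ₀ p.2)))
      ((hF.comp hs).fun_mul (hd.comp measurable_snd)))]
    refine lintegral_congr fun h => ?_
    rw [← lintegral_mul_const]
    · refine lintegral_congr fun y => ?_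
      rw [logLik_snocTraj, logLik_snocTraj, mul_assoc, ← ENNReal.ofReal_mul (Real.exp_pos _).le,
        ← Real.exp_add]
      congr 3
      ring
    · exact (hF.comp (hs.comp measurable_prodMk_left)).fun_mul hd

lemma finLaw_eq_withDensity (mdp : MDP S A) (pol : Policy M S A ref)
    (hpos : ∀ θ s a, 0 < pol.dens θ s a) (n : ℕ) (θ θ₀ : Param M) :
    finLaw mdp pol n θ = (finLaw mdp pol n θ₀).withDensity fun h =>
      ENNReal.ofReal (Real.exp (logLik pol n θ h - logLik pol n θ₀ h)) := by
  ext C hC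
  rw [withDensity_apply _ hC, ← lintegral_indicator_one hC,
    lintegral_finLaw mdp pol hpos n θ θ₀ (measurable_one.indicator hC), ← lintegral_indicator hC]
  refine lintegral_congr fun h => ?_
  by_cases hh : h ∈ C <;> simp [hh]

end ChangeOfMeasure

end BiasedPG

namespace BiasedPG

/-! ### Differentiation of expectations under a family of laws with bounded score. -/

section LikelihoodFamily

variable {M : ℕ} {X : Type*} [MeasurableSpace X]

lemma norm_sub_le_of_hasFDerivAt {E V : Type*} [NormedAddCommGroup E] [NormedSpace ℝ E]
    [NormedAddCommGroup V] [NormedSpace ℝ V] {f : E → V} {f' : E → E →L[ℝ] V} {C : ℝ}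
    (hf : ∀ x, HasFDerivAt f (f' x) x) (hC : ∀ x, ‖f' x‖ ≤ C) (x y : E) :
    ‖f x - f y‖ ≤ C * ‖x - y‖ :=
  convex_univ.norm_image_sub_le_of_norm_hasFDerivWithin_le
    (fun z _ => (hf z).hasFDerivWithinAt) (fun z _ => hC z) (Set.mem_univ y) (Set.mem_univ x)

lemma norm_add₃_le_assoc {V : Type*} [SeminormedAddCommGroup V] (u v w : V) :
    ‖u + (v + w)‖ ≤ ‖u‖ + (‖v‖ + ‖w‖) :=
  (norm_add_le _ _).trans (add_le_add le_rfl (norm_add_le _ _))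

lemma clm_eq_sum_basis {V : Type*} [NormedAddCommGroup V] [NormedSpace ℝ V]
    (T : Param M →L[ℝ] V) :
    T = ∑ i, (EuclideanSpace.proj i : Param M →L[ℝ] ℝ).smulRight
      (T (EuclideanSpace.single i 1)) := by
  ext u
  conv_lhs => rw [← (EuclideanSpace.basisFun (Fin M) ℝ).sum_repr u]
  simp

/-- Derivatives in the parameter are measurable in the remaining variable. -/
lemma stronglyMeasurable_of_hasFDerivAt {V : Type*} [NormedAddCommGroup V] [NormedSpace ℝ V]
    {ψ : Param M → X → V} {ψ' : Param M → X → Param M →L[ℝ] V}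
    (hψ : ∀ θ, StronglyMeasurable (ψ θ))
    (hd : ∀ θ x, HasFDerivAt (fun θ' => ψ θ' x) (ψ' θ x) θ) (θ : Param M) :
    StronglyMeasurable (ψ' θ) := by
  -- Directional derivatives are limits of difference quotients with increments `v / n`; a basis
  -- expansion then recovers the whole derivative.
  have hv : ∀ v, StronglyMeasurable fun x => ψ' θ x v := by
    intro v
    refine stronglyMeasurable_of_tendsto Filter.atTop
      (f := fun (n : ℕ) x => (n : ℝ) • (ψ (θ + (n : ℝ)⁻¹ • v) x - ψ θ x))
      (fun n => ((hψ _).sub (hψ _)).const_smul _) ?_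
    rw [tendsto_pi_nhds]
    intro x
    refine (hd θ x).lim v (c := fun n : ℕ => (n : ℝ)) ?_
    simpa using tendsto_natCast_atTop_atTop (R := ℝ)
  have : ψ' θ = fun x => ∑ i, (EuclideanSpace.proj i : Param M →L[ℝ] ℝ).smulRight
      (ψ' θ x (EuclideanSpace.single i 1)) := by
    funext x
    exact clm_eq_sum_basis _
  rw [this]
  refine Finset.stronglyMeasurable_fun_sum _ fun i _ => ?_
  exact ((ContinuousLinearMap.smulRightL ℝ (Param M) V
    (EuclideanSpace.proj i : Param M →L[ℝ] ℝ)).continuous).comp_stronglyMeasurable (hv _)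

/-- A family of probability measures with log-likelihood `ℓ` whose score is bounded by `a`. -/
structure LikelihoodFamily (m : Param M → Measure X) (ℓ : Param M → X → ℝ)
    (Dl : Param M → X → Param M →L[ℝ] ℝ) (a : ℝ) : Prop where
  prob : ∀ θ, IsProbabilityMeasure (m θ)
  meas : ∀ θ, Measurable (ℓ θ)
  tilt : ∀ θ θ₀, m θ = (m θ₀).withDensity fun x => ENNReal.ofReal (Real.exp (ℓ θ x - ℓ θ₀ x))
  deriv : ∀ θ x, HasFDerivAt (fun θ' => ℓ θ' x) (Dl θ x) θ
  bound : ∀ θ x, ‖Dl θ x‖ ≤ a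

variable {m : Param M → Measure X} {ℓ : Param M → X → ℝ}
  {Dl : Param M → X → Param M →L[ℝ] ℝ} {a : ℝ}

namespace LikelihoodFamily

lemma abs_sub_le (h : LikelihoodFamily m ℓ Dl a) (θ θ₀ : Param M) (x : X) :
    |ℓ θ x - ℓ θ₀ x| ≤ a * ‖θ - θ₀‖ := by
  simpa using norm_sub_le_of_hasFDerivAt (fun θ => h.deriv θ x) (fun θ => h.bound θ x) θ θ₀

lemma integral_tilt {V : Type*} [NormedAddCommGroup V] [NormedSpace ℝ V]
    (h : LikelihoodFamily m ℓ Dl a) (θ θ₀ : Param M) (ψ : X → V) :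
    ∫ x, ψ x ∂(m θ) = ∫ x, Real.exp (ℓ θ x - ℓ θ₀ x) • ψ x ∂(m θ₀) := by
  rw [h.tilt θ θ₀, integral_withDensity_eq_integral_toReal_smul]
  · simp only [ENNReal.toReal_ofReal (Real.exp_pos _).le]
  · exact ((h.meas θ).sub (h.meas θ₀)).exp.ennreal_ofReal
  · exact Filter.Eventually.of_forall fun x => ENNReal.ofReal_lt_top

lemma norm_integral_le {V : Type*} [NormedAddCommGroup V] [NormedSpace ℝ V]
    (h : LikelihoodFamily m ℓ Dl a) (θ : Param M) {ψ : X → V} {p : ℝ} (hp : ∀ x, ‖ψ x‖ ≤ p) :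
    ‖∫ x, ψ x ∂(m θ)‖ ≤ p := by
  have := h.prob θ
  simpa using norm_integral_le_of_norm_le_const (μ := m θ) (Filter.Eventually.of_forall hp)

/-- When `a * ‖θ - θ₀‖ ≤ 1`, the likelihood ratio differs from `1` by at most `2 * a * ‖θ - θ₀‖`.
Otherwise the trivial bound `2 * p` is already smaller than the right-hand side. -/
lemma norm_integral_sub_le {V : Type*} [NormedAddCommGroup V] [NormedSpace ℝ V]
    (h : LikelihoodFamily m ℓ Dl a) {ψ : Param M → X → V} {p q : ℝ} (hp0 : 0 ≤ p) (hq0 : 0 ≤ q)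
    (ha0 : 0 ≤ a) (hψ : ∀ θ, StronglyMeasurable (ψ θ)) (hp : ∀ θ x, ‖ψ θ x‖ ≤ p)
    (hq : ∀ θ₁ θ₂ x, ‖ψ θ₁ x - ψ θ₂ x‖ ≤ q * ‖θ₁ - θ₂‖) (θ θ₀ : Param M) :
    ‖∫ x, ψ θ x ∂(m θ) - ∫ x, ψ θ₀ x ∂(m θ₀)‖ ≤ (2 * a * p + q) * ‖θ - θ₀‖ := by
  have := h.prob θ₀
  by_cases hs : a * ‖θ - θ₀‖ ≤ 1
  · have hw : Measurable fun x => Real.exp (ℓ θ x - ℓ θ₀ x) :=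
      ((h.meas θ).sub (h.meas θ₀)).exp
    have hi1 : Integrable (fun x => Real.exp (ℓ θ x - ℓ θ₀ x) • ψ θ x) (m θ₀) := by
      refine Integrable.of_bound (C := Real.exp 1 * p)
        (hw.stronglyMeasurable.smul (hψ θ)).aestronglyMeasurable
        (Filter.Eventually.of_forall fun x => ?_)
      rw [norm_smul, Real.norm_eq_abs, Real.abs_exp]
      have h1 := (le_abs_self _).trans ((h.abs_sub_le θ θ₀ x).trans hs)
      gcongr
      exact hp θ x
    have hi2 : Integrable (ψ θ₀) (m θ₀) :=
      Integrable.of_bound (hψ θ₀).aestronglyMeasurable p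
        (Filter.Eventually.of_forall fun x => hp θ₀ x)
    rw [h.integral_tilt θ θ₀, ← integral_sub hi1 hi2]
    refine h.norm_integral_le θ₀ fun x => ?_
    have h1 := h.abs_sub_le θ θ₀ x
    have h2 := Real.abs_exp_sub_one_le (h1.trans hs)
    calc ‖Real.exp (ℓ θ x - ℓ θ₀ x) • ψ θ x - ψ θ₀ x‖
        = ‖(Real.exp (ℓ θ x - ℓ θ₀ x) - 1) • ψ θ x + (ψ θ x - ψ θ₀ x)‖ := by
          congr 1; module
      _ ≤ |Real.exp (ℓ θ x - ℓ θ₀ x) - 1| * ‖ψ θ x‖ + ‖ψ θ x - ψ θ₀ x‖ := by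
          refine (norm_add_le _ _).trans ?_
          rw [norm_smul, Real.norm_eq_abs]
      _ ≤ (2 * (a * ‖θ - θ₀‖)) * p + q * ‖θ - θ₀‖ := by
          gcongr
          · linarith
          · exact hp θ x
          · exact hq θ θ₀ x
      _ = (2 * a * p + q) * ‖θ - θ₀‖ := by ring
  · have hs' := (not_le.1 hs).le
    calc ‖∫ x, ψ θ x ∂(m θ) - ∫ x, ψ θ₀ x ∂(m θ₀)‖
        ≤ p + p := (norm_sub_le _ _).trans
          (add_le_add (h.norm_integral_le θ (hp θ)) (h.norm_integral_le θ₀ (hp θ₀)))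
      _ ≤ (2 * a * p + q) * ‖θ - θ₀‖ := by
          have := mul_le_mul_of_nonneg_left hs' hp0
          have := mul_nonneg hq0 (norm_nonneg (θ - θ₀))
          nlinarith

/-- Moving all the dependence on `θ` into the integrand against the fixed measure `m θ₀` allows
dominated differentiation: on the unit ball around `θ₀` the likelihood ratio is at most `exp a`. Its
derivative at `θ₀` is the score, whence the second term. -/
lemma hasFDerivAt_integral {V : Type*} [NormedAddCommGroup V] [NormedSpace ℝ V] [CompleteSpace V]
    (h : LikelihoodFamily m ℓ Dl a) {ψ : Param M → X → V} {ψ' : Param M → X → Param M →L[ℝ] V}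
    {p q : ℝ} (hψ : ∀ θ, StronglyMeasurable (ψ θ)) (hp : ∀ θ x, ‖ψ θ x‖ ≤ p)
    (hd : ∀ θ x, HasFDerivAt (fun θ' => ψ θ' x) (ψ' θ x) θ) (hq : ∀ θ x, ‖ψ' θ x‖ ≤ q)
    (θ₀ : Param M) :
    HasFDerivAt (fun θ => ∫ x, ψ θ x ∂(m θ))
      (∫ x, ψ' θ₀ x + (Dl θ₀ x).smulRight (ψ θ₀ x) ∂(m θ₀)) θ₀ := by
  have := h.prob θ₀
  -- A point of `X` is needed to read off `0 ≤ a` and `0 ≤ p` from the bounds.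
  have hX : Nonempty X := by
    by_contra hX
    rw [not_nonempty_iff] at hX
    exact IsProbabilityMeasure.ne_zero (m θ₀) (Measure.eq_zero_of_isEmpty _)
  obtain ⟨x₀⟩ := hX
  have ha0 : 0 ≤ a := (norm_nonneg _).trans (h.bound θ₀ x₀)
  have hp0 : 0 ≤ p := (norm_nonneg _).trans (hp θ₀ x₀)
  have hw : ∀ θ, Measurable fun x => Real.exp (ℓ θ x - ℓ θ₀ x) :=
    fun θ => ((h.meas θ).sub (h.meas θ₀)).exp
  have hm : ∀ θ, StronglyMeasurable fun x => Real.exp (ℓ θ x - ℓ θ₀ x) • ψ θ x :=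
    fun θ => (hw θ).stronglyMeasurable.smul (hψ θ)
  have hd' : ∀ θ x, HasFDerivAt (fun θ' => Real.exp (ℓ θ' x - ℓ θ₀ x) • ψ θ' x)
      (Real.exp (ℓ θ x - ℓ θ₀ x) • ψ' θ x +
        (Real.exp (ℓ θ x - ℓ θ₀ x) • Dl θ x).smulRight (ψ θ x)) θ := by
    intro θ x
    exact (((h.deriv θ x).sub_const (ℓ θ₀ x)).exp).smul (hd θ x)
  have key := hasFDerivAt_integral_of_dominated_of_fderiv_le (μ := m θ₀)
    (bound := fun _ => Real.exp a * q + Real.exp a * a * p)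
    (Metric.ball_mem_nhds θ₀ one_pos)
    (Filter.Eventually.of_forall fun θ => (hm θ).aestronglyMeasurable)
    (Integrable.of_bound (hm θ₀).aestronglyMeasurable p
      (Filter.Eventually.of_forall fun x => by simpa using hp θ₀ x))
    (stronglyMeasurable_of_hasFDerivAt hm hd' θ₀).aestronglyMeasurable
    (Filter.Eventually.of_forall fun x θ hθ => ?_)
    (integrable_const _)
    (Filter.Eventually.of_forall fun x θ _ => hd' θ x)
  · simp only [sub_self, Real.exp_zero, one_smul] at key
    refine key.congr_of_eventuallyEq (Filter.Eventually.of_forall fun θ => ?_)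
    exact h.integral_tilt θ θ₀ _
  · have h1 : ℓ θ x - ℓ θ₀ x ≤ a := by
      refine (le_abs_self _).trans ((h.abs_sub_le θ θ₀ x).trans ?_)
      rw [Metric.mem_ball, dist_eq_norm] at hθ
      nlinarith
    refine (norm_add_le _ _).trans ?_
    rw [ContinuousLinearMap.norm_smulRight_apply, norm_smul, norm_smul, Real.norm_eq_abs,
      Real.abs_exp]
    gcongr
    · exact hq θ x
    · exact h.bound θ x
    · exact hp θ x

end LikelihoodFamily

/-- The second derivative of the weighted likelihood. -/
noncomputable def secondIntegrand (Dl : Param M → X → Param M →L[ℝ] ℝ)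
    (D2 : Param M → X → Param M →L[ℝ] Param M →L[ℝ] ℝ) (r : X → ℝ) (θ : Param M) (x : X) :
    Param M →L[ℝ] Param M →L[ℝ] ℝ :=
  r x • D2 θ x + (Dl θ x).smulRight (r x • Dl θ x)

variable {D2 : Param M → X → Param M →L[ℝ] Param M →L[ℝ] ℝ} {b c ρ : ℝ} {r : X → ℝ}

namespace LikelihoodFamily

lemma stronglyMeasurable_deriv (h : LikelihoodFamily m ℓ Dl a) (θ : Param M) :
    StronglyMeasurable (Dl θ) :=
  stronglyMeasurable_of_hasFDerivAt (fun θ => (h.meas θ).stronglyMeasurable) h.deriv θ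

lemma hasFDerivAt_integral_const (h : LikelihoodFamily m ℓ Dl a) (hr : Measurable r)
    (hρ : ∀ x, |r x| ≤ ρ) (θ : Param M) :
    HasFDerivAt (fun θ => ∫ x, r x ∂(m θ)) (∫ x, r x • Dl θ x ∂(m θ)) θ := by
  have := h.hasFDerivAt_integral (ψ := fun _ => r) (ψ' := fun _ _ => 0) (p := ρ) (q := 0)
    (fun _ => hr.stronglyMeasurable) (fun _ x => hρ x) (fun θ x => hasFDerivAt_const _ _)
    (by simp) θ
  have e : ∀ x, r x • Dl θ x = 0 + (Dl θ x).smulRight (r x) := fun x => by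
    ext v
    simp [mul_comm]
  simpa only [e] using this

lemma hasFDerivAt_integral_deriv (h : LikelihoodFamily m ℓ Dl a) (hr : Measurable r)
    (hρ : ∀ x, |r x| ≤ ρ) (hD2 : ∀ θ x, HasFDerivAt (fun θ' => Dl θ' x) (D2 θ x) θ)
    (hb : ∀ θ x, ‖D2 θ x‖ ≤ b) (θ : Param M) :
    HasFDerivAt (fun θ => ∫ x, r x • Dl θ x ∂(m θ))
      (∫ x, secondIntegrand Dl D2 r θ x ∂(m θ)) θ := by
  refine h.hasFDerivAt_integral (ψ := fun θ x => r x • Dl θ x) (ψ' := fun θ x => r x • D2 θ x)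
    (p := ρ * a) (q := ρ * b)
    (fun θ => hr.stronglyMeasurable.smul (h.stronglyMeasurable_deriv θ)) (fun θ x => ?_)
    (fun θ x => (hD2 θ x).const_smul (r x)) (fun θ x => ?_) θ
  all_goals
    have h0 := (abs_nonneg _).trans (hρ x)
    rw [norm_smul, Real.norm_eq_abs]
    gcongr
  · exact hρ x
  · exact h.bound θ x
  · exact hρ x
  · exact hb θ x

lemma norm_secondIntegrand_le (h : LikelihoodFamily m ℓ Dl a)
    (hρ : ∀ x, |r x| ≤ ρ) (hb : ∀ θ x, ‖D2 θ x‖ ≤ b) (θ : Param M) (x : X) :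
    ‖secondIntegrand Dl D2 r θ x‖ ≤ ρ * (b + a ^ 2) := by
  have h0 := (abs_nonneg _).trans (hρ x)
  have ha := h.bound θ x
  have ha0 := (norm_nonneg _).trans ha
  have h1 : ‖r x • D2 θ x‖ = |r x| * ‖D2 θ x‖ := norm_smul (r x) (D2 θ x)
  have h2 : ‖r x • Dl θ x‖ = |r x| * ‖Dl θ x‖ := norm_smul _ _
  calc ‖secondIntegrand Dl D2 r θ x‖
      ≤ ‖r x • D2 θ x‖ + ‖(Dl θ x).smulRight (r x • Dl θ x)‖ :=
        norm_add_le (r x • D2 θ x) ((Dl θ x).smulRight (r x • Dl θ x))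
    _ = |r x| * ‖D2 θ x‖ + ‖Dl θ x‖ * (|r x| * ‖Dl θ x‖) := by
        rw [ContinuousLinearMap.norm_smulRight_apply, h1, h2]
    _ ≤ ρ * b + a * (ρ * a) := by
        gcongr
        · exact hρ x
        · exact hb θ x
        · exact hρ x
    _ = ρ * (b + a ^ 2) := by ring

/-- The quadratic term in the score is split by the product rule for differences; the score is
`b`-Lipschitz because its derivative is bounded by `b`. -/
lemma norm_secondIntegrand_sub_le (h : LikelihoodFamily m ℓ Dl a)
    (hρ : ∀ x, |r x| ≤ ρ) (hD2 : ∀ θ x, HasFDerivAt (fun θ' => Dl θ' x) (D2 θ x) θ)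
    (hb : ∀ θ x, ‖D2 θ x‖ ≤ b)
    (hc : ∀ θ₁ θ₂ x, ‖D2 θ₁ x - D2 θ₂ x‖ ≤ c * ‖θ₁ - θ₂‖) (θ₁ θ₂ : Param M) (x : X) :
    ‖secondIntegrand Dl D2 r θ₁ x - secondIntegrand Dl D2 r θ₂ x‖ ≤
      ρ * (c + 2 * a * b) * ‖θ₁ - θ₂‖ := by
  have h0 := (abs_nonneg _).trans (hρ x)
  have ha1 := h.bound θ₁ x
  have ha2 := h.bound θ₂ x
  have ha0 := (norm_nonneg _).trans ha1
  have hl : ‖Dl θ₁ x - Dl θ₂ x‖ ≤ b * ‖θ₁ - θ₂‖ :=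
    norm_sub_le_of_hasFDerivAt (fun θ => hD2 θ x) (fun θ => hb θ x) θ₁ θ₂
  have hb0 := (norm_nonneg (D2 θ₁ x)).trans (hb θ₁ x)
  have hsplit : secondIntegrand Dl D2 r θ₁ x - secondIntegrand Dl D2 r θ₂ x =
      r x • (D2 θ₁ x - D2 θ₂ x) + ((Dl θ₁ x - Dl θ₂ x).smulRight (r x • Dl θ₁ x) +
        (Dl θ₂ x).smulRight (r x • (Dl θ₁ x - Dl θ₂ x))) := by
    ext u v
    simp [secondIntegrand]
    ring
  have h1 : ‖r x • (D2 θ₁ x - D2 θ₂ x)‖ = |r x| * ‖D2 θ₁ x - D2 θ₂ x‖ :=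
    norm_smul (r x) (D2 θ₁ x - D2 θ₂ x)
  have h2 : ‖r x • Dl θ₁ x‖ = |r x| * ‖Dl θ₁ x‖ := norm_smul _ _
  have h3 : ‖r x • (Dl θ₁ x - Dl θ₂ x)‖ = |r x| * ‖Dl θ₁ x - Dl θ₂ x‖ := norm_smul _ _
  rw [hsplit]
  refine (norm_add₃_le_assoc (r x • (D2 θ₁ x - D2 θ₂ x)) ((Dl θ₁ x - Dl θ₂ x).smulRight (r x • Dl θ₁ x))
    ((Dl θ₂ x).smulRight (r x • (Dl θ₁ x - Dl θ₂ x)))).trans ?_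
  rw [ContinuousLinearMap.norm_smulRight_apply, ContinuousLinearMap.norm_smulRight_apply,
    h1, h2, h3]
  calc |r x| * ‖D2 θ₁ x - D2 θ₂ x‖ + (‖Dl θ₁ x - Dl θ₂ x‖ * (|r x| * ‖Dl θ₁ x‖) +
        ‖Dl θ₂ x‖ * (|r x| * ‖Dl θ₁ x - Dl θ₂ x‖))
      ≤ ρ * (c * ‖θ₁ - θ₂‖) + ((b * ‖θ₁ - θ₂‖) * (ρ * a) + a * (ρ * (b * ‖θ₁ - θ₂‖))) := by
        gcongr
        · exact hρ x
        · exact hc θ₁ θ₂ x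
        · exact hρ x
        · exact hρ x
    _ = ρ * (c + 2 * a * b) * ‖θ₁ - θ₂‖ := by ring

lemma stronglyMeasurable_secondIntegrand (h : LikelihoodFamily m ℓ Dl a) (hr : Measurable r)
    (hD2 : ∀ θ x, HasFDerivAt (fun θ' => Dl θ' x) (D2 θ x) θ) (θ : Param M) :
    StronglyMeasurable (secondIntegrand Dl D2 r θ) := by
  have h1 := h.stronglyMeasurable_deriv θ
  have h2 := stronglyMeasurable_of_hasFDerivAt h.stronglyMeasurable_deriv hD2 θ
  have h3 := hr.stronglyMeasurable
  refine (h3.smul h2).add ?_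
  have : Continuous fun p : (Param M →L[ℝ] ℝ) × (Param M →L[ℝ] ℝ) => p.1.smulRight p.2 :=
    (ContinuousLinearMap.smulRightL ℝ (Param M) (Param M →L[ℝ] ℝ)).continuous₂
  exact this.comp_stronglyMeasurable (h1.prodMk (h3.smul h1))

lemma norm_integral_secondIntegrand_sub_le (h : LikelihoodFamily m ℓ Dl a) (ha0 : 0 ≤ a)
    (hb0 : 0 ≤ b) (hc0 : 0 ≤ c) (hρ0 : 0 ≤ ρ) (hr : Measurable r)
    (hρ : ∀ x, |r x| ≤ ρ) (hD2 : ∀ θ x, HasFDerivAt (fun θ' => Dl θ' x) (D2 θ x) θ)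
    (hb : ∀ θ x, ‖D2 θ x‖ ≤ b)
    (hc : ∀ θ₁ θ₂ x, ‖D2 θ₁ x - D2 θ₂ x‖ ≤ c * ‖θ₁ - θ₂‖) (θ₁ θ₂ : Param M) :
    ‖∫ x, secondIntegrand Dl D2 r θ₁ x ∂(m θ₁) - ∫ x, secondIntegrand Dl D2 r θ₂ x ∂(m θ₂)‖ ≤
      (2 * a * (ρ * (b + a ^ 2)) + ρ * (c + 2 * a * b)) * ‖θ₁ - θ₂‖ :=
  h.norm_integral_sub_le (by positivity) (by positivity) ha0
    (h.stronglyMeasurable_secondIntegrand hr hD2) (h.norm_secondIntegrand_le hρ hb)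
    (h.norm_secondIntegrand_sub_le hρ hD2 hb hc) θ₁ θ₂

end LikelihoodFamily

end LikelihoodFamily

end BiasedPG

namespace BiasedPG

/-! ### Riesz identification of gradients with derivatives. -/

section Dual

variable {M : ℕ}

/-- The Riesz isometry between `ℝ^M` and its dual. -/
noncomputable def dualIso (M : ℕ) : Param M ≃ₗᵢ[ℝ] (Param M →L[ℝ] ℝ) where
  toFun v := InnerProductSpace.toDual ℝ (Param M) v
  invFun := (InnerProductSpace.toDual ℝ (Param M)).symm
  left_inv v := by simp
  right_inv T := by simp
  map_add' u v := by simp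
  map_smul' c v := by simp
  norm_map' v := (InnerProductSpace.toDual ℝ (Param M)).norm_map v

lemma dualIso_apply (v : Param M) : dualIso M v = InnerProductSpace.toDual ℝ (Param M) v := rfl

lemma dualIso_apply_apply (v u : Param M) : dualIso M v u = ⟪v, u⟫ := by
  rw [dualIso_apply, InnerProductSpace.toDual_apply_apply]

/-- The Riesz isometry as a continuous linear map. -/
noncomputable def dualMap (M : ℕ) : Param M →L[ℝ] (Param M →L[ℝ] ℝ) :=
  (dualIso M).toContinuousLinearEquiv

/-- The inverse of the Riesz isometry as a continuous linear map. -/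
noncomputable def dualMapSymm (M : ℕ) : (Param M →L[ℝ] ℝ) →L[ℝ] Param M :=
  (dualIso M).symm.toContinuousLinearEquiv

lemma norm_dualMap_comp_le (T : Param M →L[ℝ] Param M) : ‖(dualMap M).comp T‖ ≤ ‖T‖ := by
  refine ContinuousLinearMap.opNorm_le_bound _ (norm_nonneg _) fun x => ?_
  have : ‖(dualMap M).comp T x‖ = ‖T x‖ := (dualIso M).norm_map (T x)
  rw [this]
  exact T.le_opNorm x

lemma norm_dualMapSymm_comp_le (T : Param M →L[ℝ] Param M →L[ℝ] ℝ) :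
    ‖(dualMapSymm M).comp T‖ ≤ ‖T‖ := by
  refine ContinuousLinearMap.opNorm_le_bound _ (norm_nonneg _) fun x => ?_
  have : ‖(dualMapSymm M).comp T x‖ = ‖T x‖ := (dualIso M).symm.norm_map (T x)
  rw [this]
  exact T.le_opNorm x

lemma gradient_eq_dualMapSymm (f : Param M → ℝ) (x : Param M) :
    gradient f x = dualMapSymm M (fderiv ℝ f x) := rfl

end Dual

/-! ### Scores of finite trajectories and the rewards at single times. -/

section Trajectories

variable {M : ℕ} {S A : Type*} [MeasurableSpace S] [MeasurableSpace A]
  {ref : Measure A}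

/-- The derivative of the log-likelihood of a finite trajectory. -/
noncomputable def logLikDeriv (pol : Policy M S A ref) (n : ℕ) (θ : Param M)
    (h : Finset.Iic n → S × A) : Param M →L[ℝ] ℝ :=
  ∑ i, dualMap M (score pol (h i).1 (h i).2 θ)

/-- The second derivative of the log-likelihood of a finite trajectory. -/
noncomputable def logLikDeriv₂ (pol : Policy M S A ref) (n : ℕ) (θ : Param M)
    (h : Finset.Iic n → S × A) : Param M →L[ℝ] Param M →L[ℝ] ℝ :=
  ∑ i, (dualMap M).comp (fderiv ℝ (score pol (h i).1 (h i).2) θ)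

/-- The reward at the last step of a finite trajectory. -/
def lastReward (mdp : MDP S A) (n : ℕ) (h : Finset.Iic n → S × A) : ℝ :=
  mdp.reward (h ⟨n, Finset.mem_Iic.2 le_rfl⟩).1 (h ⟨n, Finset.mem_Iic.2 le_rfl⟩).2

lemma measurable_lastReward (mdp : MDP S A) (n : ℕ) : Measurable (lastReward mdp n) :=
  mdp.measurable_reward.comp (measurable_pi_apply _)

lemma norm_sum_Iic_le {V : Type*} [SeminormedAddCommGroup V] {n : ℕ} {f : Finset.Iic n → V} {C : ℝ}
    (hf : ∀ i, ‖f i‖ ≤ C) : ‖∑ i, f i‖ ≤ ((n : ℝ) + 1) * C := by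
  refine (norm_sum_le_of_le _ fun i _ => hf i).trans (le_of_eq ?_)
  simp

variable {mdp : MDP S A} {pol : Policy M S A ref} {Rmax G B ι : ℝ}

lemma hasFDerivAt_logDens (hs : BoundedSmooth mdp pol Rmax G B ι) (s : S) (a : A) (θ : Param M) :
    HasFDerivAt (fun θ' => logDens pol θ' (s, a)) (dualMap M (score pol s a θ)) θ :=
  (hs.differentiable_log s a θ).hasGradientAt.hasFDerivAt

lemma hasFDerivAt_logLikDeriv (hs : BoundedSmooth mdp pol Rmax G B ι) (n : ℕ) (θ : Param M)
    (h : Finset.Iic n → S × A) :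
    HasFDerivAt (fun θ' => logLikDeriv pol n θ' h) (logLikDeriv₂ pol n θ h) θ :=
  HasFDerivAt.fun_sum fun _ _ =>
    (dualMap M).hasFDerivAt.comp θ (hs.differentiable_score _ _ θ).hasFDerivAt

lemma norm_logLikDeriv₂_le (hs : BoundedSmooth mdp pol Rmax G B ι) (n : ℕ) (θ : Param M)
    (h : Finset.Iic n → S × A) : ‖logLikDeriv₂ pol n θ h‖ ≤ ((n : ℝ) + 1) * B :=
  norm_sum_Iic_le fun _ => (norm_dualMap_comp_le _).trans (hs.norm_jacobian_lt _ _ _).le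

lemma norm_logLikDeriv₂_sub_le (hs : BoundedSmooth mdp pol Rmax G B ι) (n : ℕ) (θ₁ θ₂ : Param M)
    (h : Finset.Iic n → S × A) :
    ‖logLikDeriv₂ pol n θ₁ h - logLikDeriv₂ pol n θ₂ h‖ ≤ ((n : ℝ) + 1) * ι * ‖θ₁ - θ₂‖ := by
  rw [logLikDeriv₂, logLikDeriv₂, ← Finset.sum_sub_distrib, mul_assoc]
  refine norm_sum_Iic_le fun i => ?_
  rw [← ContinuousLinearMap.comp_sub]
  exact (norm_dualMap_comp_le _).trans (hs.jacobian_lipschitz _ _ _ _)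

variable [SFinite ref]

lemma likelihoodFamily_finLaw (hs : BoundedSmooth mdp pol Rmax G B ι) (n : ℕ) :
    LikelihoodFamily (finLaw mdp pol n) (logLik pol n) (logLikDeriv pol n) (((n : ℝ) + 1) * G) where
  prob _ := inferInstance
  meas := measurable_logLik pol n
  tilt := finLaw_eq_withDensity mdp pol hs.dens_pos n
  deriv θ _ := HasFDerivAt.fun_sum fun _ _ => hasFDerivAt_logDens hs _ _ θ
  bound _ _ := norm_sum_Iic_le fun _ =>
    ((dualIso M).norm_map _).trans_le (hs.norm_score_le _ _ _)

/-- The expected reward at time `n`. -/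
noncomputable def stepReward (mdp : MDP S A) (pol : Policy M S A ref) (n : ℕ) (θ : Param M) : ℝ :=
  ∫ h, lastReward mdp n h ∂(finLaw mdp pol n θ)

lemma abs_stepReward_le (hs : BoundedSmooth mdp pol Rmax G B ι) (n : ℕ) (θ : Param M) :
    |stepReward mdp pol n θ| ≤ Rmax :=
  (likelihoodFamily_finLaw hs n).norm_integral_le θ (ψ := lastReward mdp n) fun _ => hs.abs_reward_le _ _

/-- The `L¹` norms of the terms are dominated by `γ ^ n * Rmax`, so sum and expectation may be
exchanged; each term then depends on a finite trajectory only. -/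
lemma J_eq_tsum (hs : BoundedSmooth mdp pol Rmax G B ι) {γ : ℝ} (hγ₀ : 0 < γ) (hγ₁ : γ < 1)
    (θ : Param M) : J mdp pol γ θ = ∑' n, γ ^ n * stepReward mdp pol n θ := by
  have hmeas : ∀ n : ℕ, Measurable fun x : ℕ → S × A => mdp.reward (x n).1 (x n).2 :=
    fun n => mdp.measurable_reward.comp (measurable_pi_apply n)
  have hint : ∀ n : ℕ, Integrable (fun x : ℕ → S × A => γ ^ n * mdp.reward (x n).1 (x n).2)
      (trajLaw mdp pol θ) := fun n =>
    (Integrable.of_bound (hmeas n).aestronglyMeasurable Rmax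
      (Filter.Eventually.of_forall fun x => hs.abs_reward_le _ _)).const_mul _
  have hbd : ∀ n : ℕ, ∫ x : ℕ → S × A, ‖γ ^ n * mdp.reward (x n).1 (x n).2‖ ∂(trajLaw mdp pol θ) ≤
      γ ^ n * Rmax := by
    intro n
    calc _ ≤ ∫ x : ℕ → S × A, γ ^ n * Rmax ∂(trajLaw mdp pol θ) := by
          refine integral_mono (hint n).norm (integrable_const _) fun x => ?_
          simp only [norm_mul, norm_pow, Real.norm_eq_abs, abs_of_pos hγ₀]
          gcongr
          exact hs.abs_reward_le _ _
      _ = γ ^ n * Rmax := by simp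
  have hsum : Summable fun n : ℕ =>
      ∫ x : ℕ → S × A, ‖γ ^ n * mdp.reward (x n).1 (x n).2‖ ∂(trajLaw mdp pol θ) :=
    Summable.of_nonneg_of_le (fun n => integral_nonneg fun _ => norm_nonneg _) hbd
      ((summable_geometric_of_lt_one hγ₀.le hγ₁).mul_right _)
  rw [J, ← integral_tsum_of_summable_integral_norm hint hsum]
  refine tsum_congr fun n => ?_
  rw [integral_const_mul, stepReward, finLaw, integral_map
    (Preorder.measurable_frestrictLe n).aemeasurable
    (measurable_lastReward mdp n).aestronglyMeasurable]
  rfl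

end Trajectories

/-! ### The geometric series behind the constant `L`. -/

section Series

lemma summable_geometric_mul_pow {γ : ℝ} (hγ₀ : 0 < γ) (hγ₁ : γ < 1) (j : ℕ) :
    Summable fun n : ℕ => γ ^ n * ((n : ℝ) + 1) ^ j := by
  have h := summable_pow_mul_geometric_of_norm_lt_one (R := ℝ) j
    (by rwa [Real.norm_eq_abs, abs_of_pos hγ₀] : ‖γ‖ < 1)
  have h' := ((summable_nat_add_iff 1).2 h).mul_left γ⁻¹
  refine h'.congr fun n => ?_
  push_cast
  rw [pow_succ]
  field_simp

lemma tsum_geometric_mul_succ {γ : ℝ} (hγ₀ : 0 < γ) (hγ₁ : γ < 1) :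
    ∑' n : ℕ, γ ^ n * ((n : ℝ) + 1) ^ 1 = 1 / (1 - γ) ^ 2 := by
  have h := tsum_choose_mul_geometric_of_norm_lt_one 1
    (by rwa [Real.norm_eq_abs, abs_of_pos hγ₀] : ‖γ‖ < 1)
  rw [← h]
  refine tsum_congr fun n => ?_
  simp [mul_comm]

lemma tsum_geometric_mul_succ_sq {γ : ℝ} (hγ₀ : 0 < γ) (hγ₁ : γ < 1) :
    ∑' n : ℕ, γ ^ n * ((n : ℝ) + 1) ^ 2 = (1 + γ) / (1 - γ) ^ 3 := by
  have hγ : ‖γ‖ < 1 := by rwa [Real.norm_eq_abs, abs_of_pos hγ₀]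
  -- The identity `(n+1)² = 2 * choose (n+2) 2 - (n+1)` reduces the claim to binomial series.
  have h := (hasSum_choose_mul_geometric_of_norm_lt_one 2 hγ).mul_left 2
  have h1 : HasSum (fun n : ℕ => γ ^ n * ((n : ℝ) + 1) ^ 1) (1 / (1 - γ) ^ 2) := by
    rw [← tsum_geometric_mul_succ hγ₀ hγ₁]
    exact (summable_geometric_mul_pow hγ₀ hγ₁ 1).hasSum
  have h2 := h.sub h1
  have hne : 1 - γ ≠ 0 := by linarith
  convert h2.tsum_eq using 1
  · refine tsum_congr fun n => ?_
    have : (((n + 2).choose 2 : ℕ) : ℝ) = ((n : ℝ) + 2) * (n + 1) / 2 := by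
      rw [Nat.cast_choose_two]
      push_cast
      ring
    rw [this]
    ring
  · field_simp
    ring

end Series

/-- A bounded function with bounded and Lipschitz second derivative. -/
structure SmoothObjective {M : ℕ} (f : Param M → ℝ) (F C L K : ℝ) : Prop where
  abs_le : ∀ x, |f x| ≤ F
  hasGradientAt : ∀ x, HasGradientAt f (gradient f x) x
  norm_gradient_le : ∀ x, ‖gradient f x‖ ≤ C
  hasFDerivAt_gradient : ∀ x, HasFDerivAt (gradient f) (hess f x) x
  norm_hess_le : ∀ x, ‖hess f x‖ ≤ L
  norm_hess_sub_le : ∀ x y, ‖hess f x - hess f y‖ ≤ K * ‖x - y‖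

/-- A Lipschitz constant of the Hessian of the expected discounted reward at time `n`. -/
noncomputable def stepHessLip (Rmax G B ι : ℝ) (n : ℕ) : ℝ :=
  2 * (((n : ℝ) + 1) * G) * (Rmax * (((n : ℝ) + 1) * B + (((n : ℝ) + 1) * G) ^ 2)) +
    Rmax * (((n : ℝ) + 1) * ι + 2 * (((n : ℝ) + 1) * G) * (((n : ℝ) + 1) * B))

/-- A Lipschitz constant of the Hessian of the objective. -/
noncomputable def hessLip (Rmax G B ι γ : ℝ) : ℝ := ∑' n, γ ^ n * stepHessLip Rmax G B ι n

/-! ### Smoothness of the discounted objective. -/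

section Objective

variable {M : ℕ} {S A : Type*} [MeasurableSpace S] [MeasurableSpace A]
  {ref : Measure A} [SFinite ref] {mdp : MDP S A} {pol : Policy M S A ref} {Rmax G B ι γ : ℝ}

lemma summable_stepHessLip (Rmax G B ι : ℝ) (hγ₀ : 0 < γ) (hγ₁ : γ < 1) :
    Summable fun n => γ ^ n * stepHessLip Rmax G B ι n := by
  have h1 := (summable_geometric_mul_pow hγ₀ hγ₁ 1).mul_left (Rmax * ι)
  have h2 := (summable_geometric_mul_pow hγ₀ hγ₁ 2).mul_left (2 * G * Rmax * B + Rmax * 2 * G * B)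
  have h3 := (summable_geometric_mul_pow hγ₀ hγ₁ 3).mul_left (2 * G * Rmax * G ^ 2)
  refine ((h1.add h2).add h3).congr fun n => ?_
  simp only [stepHessLip]
  ring

/-- Score and second derivative at time `n` are bounded by `(n+1)G` and `(n+1)B`, so the Hessian of
the `n`-th term is at most `γ^n Rmax ((n+1)B + (n+1)²G²)`. These bounds sum to exactly
`smoothConst`, and they also justify differentiating the series twice term by term. -/
theorem smoothObjective_J (hs : BoundedSmooth mdp pol Rmax G B ι) (hγ₀ : 0 < γ) (hγ₁ : γ < 1)
    (hR : 0 < Rmax) (hG : 0 < G) (hB : 0 < B) (hι : 0 ≤ ι) :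
    SmoothObjective (J mdp pol γ) (Rmax / (1 - γ)) (Rmax * G * (1 / (1 - γ) ^ 2))
      (smoothConst Rmax G B γ) (hessLip Rmax G B ι γ) := by
  have hgeo := summable_geometric_of_lt_one hγ₀.le hγ₁
  have hpow : ∀ n : ℕ, ‖γ ^ n‖ = γ ^ n := fun n => by
    rw [norm_pow, Real.norm_eq_abs, abs_of_pos hγ₀]
  have hrew : ∀ n h, |lastReward mdp n h| ≤ Rmax := fun n h => hs.abs_reward_le _ _
  let D1 : ℕ → Param M → Param M →L[ℝ] ℝ := fun n θ =>
    γ ^ n • ∫ h, lastReward mdp n h • logLikDeriv pol n θ h ∂(finLaw mdp pol n θ)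
  let D2 : ℕ → Param M → Param M →L[ℝ] Param M →L[ℝ] ℝ := fun n θ =>
    γ ^ n • ∫ h, secondIntegrand (logLikDeriv pol n) (logLikDeriv₂ pol n) (lastReward mdp n) θ h
      ∂(finLaw mdp pol n θ)
  let b1 : ℕ → ℝ := fun n => Rmax * G * (γ ^ n * ((n : ℝ) + 1) ^ 1)
  let b2 : ℕ → ℝ := fun n => Rmax * B * (γ ^ n * ((n : ℝ) + 1) ^ 1) +
    Rmax * G ^ 2 * (γ ^ n * ((n : ℝ) + 1) ^ 2)
  have hs1 : Summable b1 := (summable_geometric_mul_pow hγ₀ hγ₁ 1).mul_left _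
  have hs2 : Summable b2 := ((summable_geometric_mul_pow hγ₀ hγ₁ 1).mul_left _).add
    ((summable_geometric_mul_pow hγ₀ hγ₁ 2).mul_left _)
  have hb1 : ∑' n, b1 n = Rmax * G * (1 / (1 - γ) ^ 2) := by
    rw [tsum_mul_left, tsum_geometric_mul_succ hγ₀ hγ₁]
  have hb2 : ∑' n, b2 n = smoothConst Rmax G B γ := by
    rw [((summable_geometric_mul_pow hγ₀ hγ₁ 1).mul_left _).tsum_add
      ((summable_geometric_mul_pow hγ₀ hγ₁ 2).mul_left _), tsum_mul_left, tsum_mul_left,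
      tsum_geometric_mul_succ hγ₀ hγ₁, tsum_geometric_mul_succ_sq hγ₀ hγ₁, smoothConst]
    ring
  have hD1 : ∀ n θ, HasFDerivAt (fun θ => γ ^ n * stepReward mdp pol n θ) (D1 n θ) θ :=
    fun n θ => ((likelihoodFamily_finLaw hs n).hasFDerivAt_integral_const
      (measurable_lastReward mdp n) (hrew n) θ).const_mul (γ ^ n)
  have hD2 : ∀ n θ, HasFDerivAt (D1 n) (D2 n θ) θ :=
    fun n θ => ((likelihoodFamily_finLaw hs n).hasFDerivAt_integral_deriv
      (measurable_lastReward mdp n) (hrew n) (hasFDerivAt_logLikDeriv hs n)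
      (norm_logLikDeriv₂_le hs n) θ).const_smul (γ ^ n)
  have hn1 : ∀ n θ, ‖D1 n θ‖ ≤ b1 n := by
    intro n θ
    have h1 : ‖∫ h, lastReward mdp n h • logLikDeriv pol n θ h ∂(finLaw mdp pol n θ)‖ ≤
        Rmax * (((n : ℝ) + 1) * G) := by
      refine (likelihoodFamily_finLaw hs n).norm_integral_le θ fun h => ?_
      rw [norm_smul, Real.norm_eq_abs]
      exact mul_le_mul (hrew n h) ((likelihoodFamily_finLaw hs n).bound θ h) (norm_nonneg _) hR.le
    calc ‖D1 n θ‖ = γ ^ n * _ := by rw [norm_smul, hpow]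
      _ ≤ γ ^ n * (Rmax * (((n : ℝ) + 1) * G)) := by gcongr
      _ = b1 n := by simp only [b1]; ring
  have hn2 : ∀ n θ, ‖D2 n θ‖ ≤ b2 n := by
    intro n θ
    have h1 := (likelihoodFamily_finLaw hs n).norm_integral_le θ
      ((likelihoodFamily_finLaw hs n).norm_secondIntegrand_le (hrew n)
        (norm_logLikDeriv₂_le hs n) θ)
    calc ‖D2 n θ‖ = γ ^ n * _ := by rw [norm_smul, hpow]
      _ ≤ γ ^ n * (Rmax * (((n : ℝ) + 1) * B + (((n : ℝ) + 1) * G) ^ 2)) := by gcongr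
      _ = b2 n := by simp only [b2]; ring
  have hn3 : ∀ n θ₁ θ₂, ‖D2 n θ₁ - D2 n θ₂‖ ≤
      γ ^ n * stepHessLip Rmax G B ι n * ‖θ₁ - θ₂‖ := by
    intro n θ₁ θ₂
    have h1 := (likelihoodFamily_finLaw hs n).norm_integral_secondIntegrand_sub_le
      (by positivity) (by positivity) (by positivity) hR.le (measurable_lastReward mdp n)
      (hrew n) (hasFDerivAt_logLikDeriv hs n) (norm_logLikDeriv₂_le hs n)
      (norm_logLikDeriv₂_sub_le hs n) θ₁ θ₂
    rw [← smul_sub, norm_smul, hpow, mul_assoc]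
    gcongr
    exact h1
  have hval : ∀ θ, ‖J mdp pol γ θ‖ ≤ Rmax / (1 - γ) := by
    intro θ
    have hle : ∀ n, ‖γ ^ n * stepReward mdp pol n θ‖ ≤ γ ^ n * Rmax := fun n => by
      rw [norm_mul, hpow]
      exact mul_le_mul_of_nonneg_left (abs_stepReward_le hs n θ) (by positivity)
    rw [J_eq_tsum hs hγ₀ hγ₁]
    refine (tsum_of_norm_bounded (hgeo.mul_right Rmax).hasSum hle).trans (le_of_eq ?_)
    rw [tsum_mul_right, tsum_geometric_of_lt_one hγ₀.le hγ₁]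
    field_simp
  have hder1 : ∀ θ, HasFDerivAt (J mdp pol γ) (∑' n, D1 n θ) θ := by
    intro θ
    have hJ : J mdp pol γ = fun θ => ∑' n, γ ^ n * stepReward mdp pol n θ :=
      funext fun θ => J_eq_tsum hs hγ₀ hγ₁ θ
    rw [hJ]
    refine hasFDerivAt_tsum (x₀ := θ) hs1 hD1 hn1 ?_ θ
    refine Summable.of_norm_bounded (hgeo.mul_right Rmax) fun n => ?_
    rw [norm_mul, hpow]
    exact mul_le_mul_of_nonneg_left (abs_stepReward_le hs n θ) (by positivity)
  have hder2 : ∀ θ, HasFDerivAt (fun θ => ∑' n, D1 n θ) (∑' n, D2 n θ) θ := fun θ =>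
    hasFDerivAt_tsum (x₀ := θ) hs2 hD2 hn2 (Summable.of_norm_bounded hs1 fun n => hn1 n θ) θ
  have hgrad : gradient (J mdp pol γ) = fun θ => dualMapSymm M (∑' n, D1 n θ) := by
    funext θ
    rw [gradient_eq_dualMapSymm, (hder1 θ).fderiv]
  have hgd : ∀ θ, HasFDerivAt (gradient (J mdp pol γ))
      ((dualMapSymm M).comp (∑' n, D2 n θ)) θ := by
    intro θ
    rw [hgrad]
    exact (dualMapSymm M).hasFDerivAt.comp θ (hder2 θ)
  have hhess : ∀ θ, hess (J mdp pol γ) θ = (dualMapSymm M).comp (∑' n, D2 n θ) :=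
    fun θ => (hgd θ).fderiv
  refine ⟨hval, fun θ => (hder1 θ).differentiableAt.hasGradientAt, fun θ => ?_, fun θ => ?_,
    fun θ => ?_, fun θ₁ θ₂ => ?_⟩
  · rw [hgrad]
    refine ((dualIso M).symm.norm_map _).le.trans ?_
    rw [← hb1]
    exact tsum_of_norm_bounded hs1.hasSum fun n => hn1 n θ
  · rw [hhess]
    exact hgd θ
  · rw [hhess]
    refine (norm_dualMapSymm_comp_le _).trans ?_
    rw [← hb2]
    exact tsum_of_norm_bounded hs2.hasSum fun n => hn2 n θ
  · rw [hhess, hhess, ← ContinuousLinearMap.comp_sub]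
    refine (norm_dualMapSymm_comp_le _).trans ?_
    rw [← (Summable.of_norm_bounded hs2 fun n => hn2 n θ₁).tsum_sub
      (Summable.of_norm_bounded hs2 fun n => hn2 n θ₂), hessLip, ← tsum_mul_right]
    exact tsum_of_norm_bounded
      ((summable_stepHessLip Rmax G B ι hγ₀ hγ₁).mul_right _).hasSum fun n => hn3 n θ₁ θ₂

end Objective

end BiasedPG

namespace BiasedPG

/-- A stochastic ascent recursion `θ_{t+1} = θ_t + μ (∇f(θ_t) + d_t + ξ_t)` with bounded steps,
centred noise `ξ` whose covariance is a Hölder function of `θ_t`, and small bias `d`. -/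
structure AscentProcess {M : ℕ} {Ω : Type*} [MeasurableSpace Ω] (P : Measure Ω)
    (f : Param M → ℝ) (μ σ D β ν : ℝ) (θ ξ d : ℕ → Ω → Param M)
    (Rxi : Param M → Param M →L[ℝ] Param M) : Prop where
  measurable_iterate : ∀ t, Measurable (θ t)
  aestronglyMeasurable_noise : ∀ t, AEStronglyMeasurable (ξ t) P
  aestronglyMeasurable_bias : ∀ t, AEStronglyMeasurable (d t) P
  bounded_noise : ∃ c, ∀ t, ∀ᵐ w ∂P, ‖ξ t w‖ ≤ c
  bounded_bias : ∃ c, ∀ t, ∀ᵐ w ∂P, ‖d t w‖ ≤ c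
  update : ∀ t w, θ (t + 1) w = θ t w + μ • (gradient f (θ t w) + d t w + ξ t w)
  norm_step_le : ∀ t, ∀ᵐ w ∂P, ‖gradient f (θ t w) + d t w + ξ t w‖ ≤ σ
  condExp_noise : ∀ t, P[ξ t | history θ t] =ᵐ[P] 0
  bias_fourth : ∀ t A, MeasurableSet[history θ t] A →
    ∫ w in A, ‖d t w‖ ^ 4 ∂P ≤ D ^ 4 * μ ^ 4 * P.real A
  integrable_covariance : ∀ t v, Integrable (fun w => ⟪Rxi (θ t w) v, v⟫) P
  covariance : ∀ t v A, MeasurableSet[history θ t] A →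
    ∫ w in A, ⟪ξ t w, v⟫ ^ 2 ∂P = ∫ w in A, ⟪Rxi (θ t w) v, v⟫ ∂P
  holder : ∀ θ₁ θ₂, ‖Rxi θ₁ - Rxi θ₂‖ ≤ β * ‖θ₁ - θ₂‖ ^ ν

/-! ### The filtration generated by the iterates. -/

section History

variable {M : ℕ} {Ω : Type*}

lemma history_mono (θ : ℕ → Ω → Param M) {s t : ℕ} (hst : s ≤ t) :
    history θ s ≤ history θ t :=
  biSup_mono fun _ h => h.trans hst

lemma measurable_history (θ : ℕ → Ω → Param M) {s t : ℕ} (hst : s ≤ t) :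
    Measurable[history θ t] (θ s) :=
  Measurable.mono (comap_measurable (θ s)) (le_iSup₂_of_le s hst le_rfl) le_rfl

lemma history_le [MeasurableSpace Ω] {θ : ℕ → Ω → Param M} (hθ : ∀ t, Measurable (θ t)) (t : ℕ) :
    history θ t ≤ (inferInstance : MeasurableSpace Ω) :=
  iSup₂_le fun s _ => (hθ s).comap_le

end History

/-! ### From the sampling assumption to centred noise. -/

section Sampling

variable {M : ℕ} {S A Z Ω : Type*} [MeasurableSpace S] [MeasurableSpace A] [MeasurableSpace Z]
  [MeasurableSpace Ω] {ref : Measure A} [SFinite ref] {mdp : MDP S A} {pol : Policy M S A ref}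
  {H : ℕ} {Rmax G B ι γ μ σ D β ν : ℝ} {P : Measure Ω}
  {Ghat : Param M → Z → (Fin H → S × A) → Param M}
  {θ : ℕ → Ω → Param M} {z : ℕ → Ω → Z} {τ : ℕ → Ω → (Fin H → S × A)}
  {Rxi : Param M → Param M →L[ℝ] Param M}

/-- `finLaw` at index `H` carries `H + 1` pairs, one more than needed; this choice covers `H = 0`
without a case distinction. -/
lemma truncTrajLaw_eq_map_finLaw (mdp : MDP S A) (pol : Policy M S A ref) (H : ℕ) (θ : Param M) :
    truncTrajLaw mdp pol H θ = (finLaw mdp pol H θ).map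
      (fun h (i : Fin H) => h ⟨i, Finset.mem_Iic.2 i.2.le⟩) := by
  have hm : Measurable fun (h : Finset.Iic H → S × A) (i : Fin H) =>
      h ⟨i, Finset.mem_Iic.2 i.2.le⟩ := measurable_pi_lambda _ fun i => measurable_pi_apply _
  have hr : Measurable (Preorder.frestrictLe (π := fun _ : ℕ => S × A) H) :=
    Preorder.measurable_frestrictLe H
  exact (Measure.map_map hm hr).symm

instance isProbabilityMeasure_truncTrajLaw (mdp : MDP S A) (pol : Policy M S A ref) (H : ℕ)
    (θ : Param M) : IsProbabilityMeasure (truncTrajLaw mdp pol H θ) :=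
  Measure.isProbabilityMeasure_map
    (measurable_pi_lambda _ fun _ => measurable_pi_apply _).aemeasurable

/-- An indicator is a bounded integrand independent of the parameter, so `norm_integral_sub_le`
makes its expectation Lipschitz. This gives the measurability that turns the trajectory law into a
kernel. -/
lemma continuous_truncTrajLaw_real (hs : BoundedSmooth mdp pol Rmax G B ι) (hG : 0 < G)
    {C : Set (Fin H → S × A)} (hC : MeasurableSet C) :
    Continuous fun θ => (truncTrajLaw mdp pol H θ).real C := by
  let C' : Set (Finset.Iic H → S × A) :=
    (fun h (i : Fin H) => h ⟨i, Finset.mem_Iic.2 i.2.le⟩) ⁻¹' C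
  have hmap : Measurable fun (h : Finset.Iic H → S × A) (i : Fin H) =>
    h ⟨i, Finset.mem_Iic.2 i.2.le⟩ := by fun_prop
  have hC' : MeasurableSet C' := hmap hC
  have hint : ∀ θ, (truncTrajLaw mdp pol H θ).real C =
      ∫ h, C'.indicator (1 : (Finset.Iic H → S × A) → ℝ) h ∂(finLaw mdp pol H θ) := by
    intro θ
    rw [integral_indicator_one hC', truncTrajLaw_eq_map_finLaw, map_measureReal_apply hmap hC]
  have hlip := (likelihoodFamily_finLaw hs H).norm_integral_sub_le
    (ψ := fun _ => C'.indicator (1 : (Finset.Iic H → S × A) → ℝ)) (p := 1) (q := 0) zero_le_one le_rfl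
    (by positivity) (fun _ => (stronglyMeasurable_one.indicator hC'))
    (fun _ h => by by_cases hh : h ∈ C' <;> simp [hh]) (fun _ _ h => by simp)
  simp only [← hint] at hlip
  refine (LipschitzWith.of_dist_le_mul
    (K := Real.toNNReal (2 * (((H : ℝ) + 1) * G) * 1 + 0)) fun θ₁ θ₂ => ?_).continuous
  rw [dist_eq_norm, dist_eq_norm, Real.coe_toNNReal _ (by positivity)]
  exact hlip θ₁ θ₂

/-- The law of a truncated trajectory as a kernel of the policy parameter. -/
noncomputable def truncTrajKernel (hs : BoundedSmooth mdp pol Rmax G B ι) (hG : 0 < G) (H : ℕ) :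
    Kernel (Param M) (Fin H → S × A) where
  toFun := truncTrajLaw mdp pol H
  measurable' := by
    refine Measure.measurable_of_measurable_coe _ fun C hC => ?_
    have : (fun θ => truncTrajLaw mdp pol H θ C) =
        fun θ => ENNReal.ofReal ((truncTrajLaw mdp pol H θ).real C) := by
      funext θ
      rw [ofReal_measureReal]
    rw [this]
    exact (continuous_truncTrajLaw_real hs hG hC).measurable.ennreal_ofReal

lemma truncTrajKernel_apply (hs : BoundedSmooth mdp pol Rmax G B ι) (hG : 0 < G) (θ : Param M) :
    truncTrajKernel hs hG H θ = truncTrajLaw mdp pol H θ := rfl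

instance isMarkovKernel_truncTrajKernel (hs : BoundedSmooth mdp pol Rmax G B ι) (hG : 0 < G) :
    IsMarkovKernel (truncTrajKernel hs hG H) :=
  ⟨fun θ => by rw [truncTrajKernel_apply]; infer_instance⟩

/-- The data `θ_t`, `z_t`, `τ_t` on an event of the past have the law prescribed by sampling. -/
lemma map_sample_eq_compProd [IsProbabilityMeasure P]
    (hs : BoundedSmooth mdp pol Rmax G B ι) (hG : 0 < G)
    (hrun : IsRun mdp pol P μ Ghat θ z τ) (t : ℕ) {E : Set Ω}
    (hE : MeasurableSet[history θ t ⊔ MeasurableSpace.comap (z t) inferInstance] E) :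
    (P.restrict E).map (fun w => ((θ t w, z t w), τ t w)) =
      ((P.restrict E).map fun w => (θ t w, z t w)) ⊗ₘ
        (truncTrajKernel hs hG H).comap Prod.fst measurable_fst := by
  have hθ := hrun.measurable_iterate t
  have hz := hrun.measurable_aux t
  have hτ := hrun.measurable_traj t
  have hle : history θ t ⊔ MeasurableSpace.comap (z t) inferInstance ≤
      (inferInstance : MeasurableSpace Ω) :=
    sup_le (history_le hrun.measurable_iterate t) hz.comap_le
  have hY : Measurable[history θ t ⊔ MeasurableSpace.comap (z t) inferInstance]
      fun w => (θ t w, z t w) :=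
    Measurable.prodMk (Measurable.mono (measurable_history θ le_rfl) le_sup_left le_rfl)
      (Measurable.mono (comap_measurable (z t)) le_sup_right le_rfl)
  have hY' : Measurable fun w => (θ t w, z t w) := hθ.prodMk hz
  -- Rectangles determine the joint law, and on them the claim is the defining property of the
  -- conditional probability, integrated over `E` intersected with an event of `(θ_t, z_t)`.
  refine Measure.ext_prod fun {V C} hV hC => ?_
  have hEV := hE.inter (hY hV)
  have hcont := (continuous_truncTrajLaw_real (mdp := mdp) (pol := pol) hs hG hC).measurable
  rw [Measure.compProd_apply_prod hV hC, Measure.map_apply (hY'.prodMk hτ) (hV.prod hC),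
    setLIntegral_map hV (((truncTrajKernel hs hG H).comap Prod.fst measurable_fst).measurable_coe hC)
      hY', Measure.restrict_restrict (hY' hV),
    Measure.restrict_apply ((hY'.prodMk hτ) (hV.prod hC))]
  simp only [Kernel.comap_apply, truncTrajKernel_apply]
  have h1 := setIntegral_condExp hle
    (Integrable.indicator (integrable_const (1 : ℝ)) (hτ hC) : Integrable
      ((τ t ⁻¹' C).indicator fun _ => (1 : ℝ)) P) hEV
  rw [setIntegral_congr_ae (hle _ hEV) ((hrun.sample t C hC).mono fun w hw _ => hw)] at h1
  have h2 : ∫ w in E ∩ (fun w => (θ t w, z t w)) ⁻¹' V,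
      (τ t ⁻¹' C).indicator (fun _ => (1 : ℝ)) w ∂P =
      P.real ((fun w => ((θ t w, z t w), τ t w)) ⁻¹' V ×ˢ C ∩ E) := by
    rw [integral_indicator (hτ hC), setIntegral_const, smul_eq_mul, mul_one, measureReal_def,
      Measure.restrict_apply (hτ hC), ← measureReal_def]
    congr 1
    ext w
    simp only [Set.mem_inter_iff, Set.mem_preimage, Set.mem_prod]
    tauto
  rw [h2] at h1
  rw [← ofReal_measureReal (μ := P), ← h1, Set.inter_comm, ofReal_integral_eq_lintegral_ofReal]
  · exact lintegral_congr fun w => by rw [ofReal_measureReal]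
  · exact Integrable.of_bound (hcont.comp hθ).aestronglyMeasurable 1
      (Filter.Eventually.of_forall fun w => by
        rw [Real.norm_eq_abs, abs_of_nonneg measureReal_nonneg]; exact measureReal_le_one)
  · exact Filter.Eventually.of_forall fun w => measureReal_nonneg

lemma stronglyMeasurable_meanEstimator (hs : BoundedSmooth mdp pol Rmax G B ι) (hG : 0 < G)
    (hrun : IsRun mdp pol P μ Ghat θ z τ) :
    StronglyMeasurable fun y : Param M × Z => meanEstimator mdp pol Ghat y.1 y.2 := by
  have h : Measurable fun p : (Param M × Z) × (Fin H → S × A) => Ghat p.1.1 p.1.2 p.2 :=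
    hrun.measurable_estimator.comp (by fun_prop :
      Measurable fun p : (Param M × Z) × (Fin H → S × A) => (p.1.1, p.1.2, p.2))
  exact StronglyMeasurable.integral_kernel_prod_right'
    (κ := (truncTrajKernel hs hG H).comap Prod.fst measurable_fst) h.stronglyMeasurable

lemma measurable_estimator_comp (hrun : IsRun mdp pol P μ Ghat θ z τ) (t : ℕ) :
    Measurable fun w => Ghat (θ t w) (z t w) (τ t w) :=
  hrun.measurable_estimator.comp ((hrun.measurable_iterate t).prodMk
    ((hrun.measurable_aux t).prodMk (hrun.measurable_traj t)))

/-- The assumption speaks of events of `τ_t` alone, whereas the estimator also depends on `θ_t` and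
`z_t`; disintegrating their joint law bridges the gap. -/
lemma setIntegral_estimator_eq [IsProbabilityMeasure P]
    (hs : BoundedSmooth mdp pol Rmax G B ι) (hG : 0 < G)
    (hrun : IsRun mdp pol P μ Ghat θ z τ) (t : ℕ)
    (hbd : ∀ᵐ w ∂P, ‖Ghat (θ t w) (z t w) (τ t w)‖ ≤ σ) {E : Set Ω}
    (hE : MeasurableSet[history θ t ⊔ MeasurableSpace.comap (z t) inferInstance] E) :
    ∫ w in E, Ghat (θ t w) (z t w) (τ t w) ∂P =
      ∫ w in E, meanEstimator mdp pol Ghat (θ t w) (z t w) ∂P := by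
  have hY : Measurable fun w => (θ t w, z t w) :=
    (hrun.measurable_iterate t).prodMk (hrun.measurable_aux t)
  have hYτ : Measurable fun w => ((θ t w, z t w), τ t w) := hY.prodMk (hrun.measurable_traj t)
  have h : Measurable fun p : (Param M × Z) × (Fin H → S × A) => Ghat p.1.1 p.1.2 p.2 :=
    hrun.measurable_estimator.comp (by fun_prop :
      Measurable fun p : (Param M × Z) × (Fin H → S × A) => (p.1.1, p.1.2, p.2))
  have hint : Integrable (fun w => Ghat (θ t w) (z t w) (τ t w)) (P.restrict E) :=
    Integrable.of_bound (measurable_estimator_comp hrun t).aestronglyMeasurable σ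
      (ae_restrict_of_ae hbd)
  have hlaw := map_sample_eq_compProd hs hG hrun t hE
  have hint' : Integrable (fun p : (Param M × Z) × (Fin H → S × A) => Ghat p.1.1 p.1.2 p.2)
      (((P.restrict E).map fun w => (θ t w, z t w)) ⊗ₘ
        (truncTrajKernel hs hG H).comap Prod.fst measurable_fst) := by
    rw [← hlaw, integrable_map_measure h.aestronglyMeasurable hYτ.aemeasurable]
    exact hint
  calc ∫ w in E, Ghat (θ t w) (z t w) (τ t w) ∂P
      = ∫ p, Ghat p.1.1 p.1.2 p.2 ∂((P.restrict E).map fun w => ((θ t w, z t w), τ t w)) :=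
        (integral_map hYτ.aemeasurable h.aestronglyMeasurable).symm
    _ = ∫ y, meanEstimator mdp pol Ghat y.1 y.2 ∂((P.restrict E).map fun w => (θ t w, z t w)) := by
        rw [hlaw, Measure.integral_compProd hint']
        rfl
    _ = ∫ w in E, meanEstimator mdp pol Ghat (θ t w) (z t w) ∂P :=
        integral_map hY.aemeasurable
          (stronglyMeasurable_meanEstimator hs hG hrun).aestronglyMeasurable

/-- The estimator is bounded only almost surely along the run. Under the joint law this becomes a
bound for almost every `(θ_t, z_t)` and almost every fresh trajectory, which survives averaging. -/
lemma norm_meanEstimator_le [IsProbabilityMeasure P]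
    (hs : BoundedSmooth mdp pol Rmax G B ι) (hG : 0 < G)
    (hrun : IsRun mdp pol P μ Ghat θ z τ) (t : ℕ)
    (hbd : ∀ᵐ w ∂P, ‖Ghat (θ t w) (z t w) (τ t w)‖ ≤ σ) :
    ∀ᵐ w ∂P, ‖meanEstimator mdp pol Ghat (θ t w) (z t w)‖ ≤ σ := by
  have hY : Measurable fun w => (θ t w, z t w) :=
    (hrun.measurable_iterate t).prodMk (hrun.measurable_aux t)
  have hYτ : Measurable fun w => ((θ t w, z t w), τ t w) := hY.prodMk (hrun.measurable_traj t)
  have h : Measurable fun p : (Param M × Z) × (Fin H → S × A) => Ghat p.1.1 p.1.2 p.2 :=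
    hrun.measurable_estimator.comp (by fun_prop :
      Measurable fun p : (Param M × Z) × (Fin H → S × A) => (p.1.1, p.1.2, p.2))
  have hlaw := map_sample_eq_compProd hs hG hrun t (MeasurableSet.univ)
  rw [Measure.restrict_univ] at hlaw
  have h1 : ∀ᵐ p ∂(P.map fun w => ((θ t w, z t w), τ t w)), ‖Ghat p.1.1 p.1.2 p.2‖ ≤ σ :=
    (ae_map_iff hYτ.aemeasurable (measurableSet_le h.norm measurable_const)).2 hbd
  rw [hlaw] at h1
  have h2 := ae_of_ae_map hY.aemeasurable (Measure.ae_ae_of_ae_compProd h1)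
  filter_upwards [h2] with w hw
  rw [Kernel.comap_apply, truncTrajKernel_apply] at hw
  simpa [meanEstimator] using norm_integral_le_of_norm_le_const hw

/-- Biased policy gradient is a stochastic ascent process for the objective. -/
theorem ascentProcess_of_isRun [IsProbabilityMeasure P]
    (hs : BoundedSmooth mdp pol Rmax G B ι) (hG : 0 < G) {F C L K : ℝ}
    (hJ : SmoothObjective (J mdp pol γ) F C L K)
    (hrun : IsRun mdp pol P μ Ghat θ z τ)
    (hcov : HolderCovariance mdp pol P β ν Ghat θ z τ Rxi)
    (hmom : MomentBounds mdp pol γ P μ σ D Ghat θ z τ) :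
    AscentProcess P (J mdp pol γ) μ σ D β ν θ (noise mdp pol Ghat θ z τ)
      (bias mdp pol γ Ghat θ z) Rxi := by
  have hgc : Continuous (gradient (J mdp pol γ)) :=
    continuous_iff_continuousAt.2 fun x => (hJ.hasFDerivAt_gradient x).continuousAt
  have hmean : ∀ t, StronglyMeasurable fun w => meanEstimator mdp pol Ghat (θ t w) (z t w) :=
    fun t => (stronglyMeasurable_meanEstimator hs hG hrun).comp_measurable
      (g := fun w => (θ t w, z t w)) ((hrun.measurable_iterate t).prodMk (hrun.measurable_aux t))
  have hest : ∀ t, StronglyMeasurable fun w => Ghat (θ t w) (z t w) (τ t w) :=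
    fun t => (measurable_estimator_comp hrun t).stronglyMeasurable
  have hgrad : ∀ t, StronglyMeasurable fun w => gradient (J mdp pol γ) (θ t w) :=
    fun t => (hgc.measurable.comp (hrun.measurable_iterate t)).stronglyMeasurable
  have hmb := fun t => norm_meanEstimator_le hs hG hrun t (hmom.norm_estimator_le t)
  have hnm : ∀ t, StronglyMeasurable (noise mdp pol Ghat θ z τ t) :=
    fun t => (hest t).sub (hmean t)
  have hdm : ∀ t, StronglyMeasurable (bias mdp pol γ Ghat θ z t) :=
    fun t => (hmean t).sub (hgrad t)
  have hnb : ∀ t, ∀ᵐ w ∂P, ‖noise mdp pol Ghat θ z τ t w‖ ≤ σ + σ := by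
    intro t
    filter_upwards [hmb t, hmom.norm_estimator_le t] with w h1 h2
    exact (norm_sub_le _ _).trans (add_le_add h2 h1)
  have hdb : ∀ t, ∀ᵐ w ∂P, ‖bias mdp pol γ Ghat θ z t w‖ ≤ σ + C := by
    intro t
    filter_upwards [hmb t] with w h1
    exact (norm_sub_le _ _).trans (add_le_add h1 (hJ.norm_gradient_le _))
  have hsplit : ∀ t w, gradient (J mdp pol γ) (θ t w) + bias mdp pol γ Ghat θ z t w +
      noise mdp pol Ghat θ z τ t w = Ghat (θ t w) (z t w) (τ t w) := by
    intro t w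
    simp only [bias, noise]
    abel
  have hle := history_le (θ := θ) hrun.measurable_iterate
  have hnint : ∀ t, Integrable (noise mdp pol Ghat θ z τ t) P := fun t =>
    Integrable.of_bound (hnm t).aestronglyMeasurable _ (hnb t)
  have hsq : ∀ t v, Integrable (fun w => ⟪noise mdp pol Ghat θ z τ t w, v⟫ *
      ⟪noise mdp pol Ghat θ z τ t w, v⟫) P := by
    intro t v
    have h1 : StronglyMeasurable fun w => ⟪noise mdp pol Ghat θ z τ t w, v⟫ :=
      (hnm t).inner stronglyMeasurable_const
    refine Integrable.of_bound (h1.mul h1).aestronglyMeasurable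
      (((σ + σ) * ‖v‖) * ((σ + σ) * ‖v‖)) ?_
    filter_upwards [hnb t] with w hw
    have h2 : ‖⟪noise mdp pol Ghat θ z τ t w, v⟫‖ ≤ (σ + σ) * ‖v‖ :=
      (norm_inner_le_norm _ _).trans (by gcongr)
    rw [norm_mul]
    exact mul_le_mul h2 h2 (norm_nonneg _) ((norm_nonneg _).trans h2)
  refine
    { measurable_iterate := hrun.measurable_iterate
      aestronglyMeasurable_noise := fun t => (hnm t).aestronglyMeasurable
      aestronglyMeasurable_bias := fun t => (hdm t).aestronglyMeasurable
      bounded_noise := ⟨_, hnb⟩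
      bounded_bias := ⟨_, hdb⟩
      update := fun t w => by rw [hsplit, hrun.update]
      norm_step_le := fun t => by simpa only [hsplit] using hmom.norm_estimator_le t
      condExp_noise := fun t => ?_
      bias_fourth := fun t E hE => ?_
      integrable_covariance := fun t v => integrable_condExp.congr (hcov.covariance t v v)
      covariance := fun t v E hE => ?_
      holder := hcov.holder }
  -- The noise has zero integral over every past event, which characterises a vanishing conditional
  -- expectation.
  · refine (ae_eq_condExp_of_forall_setIntegral_eq (hle t) (hnint t)
      (fun E _ _ => integrableOn_zero) (fun E hE _ => ?_) aestronglyMeasurable_zero).symm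
    have h1 := setIntegral_estimator_eq hs hG hrun t (hmom.norm_estimator_le t)
      ((le_sup_left : history θ t ≤ _ ⊔ MeasurableSpace.comap (z t) inferInstance) E hE)
    have h2 : ∫ w in E, noise mdp pol Ghat θ z τ t w ∂P =
        ∫ w in E, Ghat (θ t w) (z t w) (τ t w) ∂P -
          ∫ w in E, meanEstimator mdp pol Ghat (θ t w) (z t w) ∂P :=
      integral_sub
        (Integrable.of_bound (hest t).aestronglyMeasurable σ
          (ae_restrict_of_ae (hmom.norm_estimator_le t)))
        (Integrable.of_bound (hmean t).aestronglyMeasurable σ (ae_restrict_of_ae (hmb t)))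
    rw [h2, h1, sub_self]
    simp
  · have hi : Integrable (fun w => ‖bias mdp pol γ Ghat θ z t w‖ ^ 4) P := by
      refine Integrable.of_bound ((hdm t).norm.pow 4).aestronglyMeasurable ((σ + C) ^ 4) ?_
      filter_upwards [hdb t] with w hw
      rw [norm_pow, norm_norm]
      gcongr
    rw [← setIntegral_condExp (hle t) hi hE]
    calc _ ≤ ∫ w in E, D ^ 4 * μ ^ 4 ∂P :=
          setIntegral_mono_ae integrable_condExp.integrableOn (integrable_const _).integrableOn
            (hmom.bias_fourth t)
      _ = D ^ 4 * μ ^ 4 * P.real E := by rw [setIntegral_const, smul_eq_mul, mul_comm]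
  · simp only [pow_two]
    rw [← setIntegral_condExp (hle t) (hsq t v) hE]
    exact setIntegral_congr_ae (hle t _ hE) ((hcov.covariance t v v).mono fun w hw _ => hw)

end Sampling

end BiasedPG

namespace BiasedPG

/-! ### Taylor estimates for the objective and an interpolation inequality. -/

section Calculus

variable {M : ℕ} {f : Param M → ℝ} {F C L K : ℝ}

namespace SmoothObjective

lemma continuous (hf : SmoothObjective f F C L K) : Continuous f :=
  continuous_iff_continuousAt.2 fun x => (hf.hasGradientAt x).hasFDerivAt.continuousAt

lemma continuous_gradient (hf : SmoothObjective f F C L K) : Continuous (gradient f) :=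
  continuous_iff_continuousAt.2 fun x => (hf.hasFDerivAt_gradient x).continuousAt

lemma norm_gradient_sub_le (hf : SmoothObjective f F C L K) (x y : Param M) :
    ‖gradient f x - gradient f y‖ ≤ L * ‖x - y‖ :=
  norm_sub_le_of_hasFDerivAt hf.hasFDerivAt_gradient hf.norm_hess_le x y

/-- Mean value inequality on the segment, where the Hessian differs from its value at `x` by at most
`K * ‖y - x‖`; the sharper factor `1/2` is not needed. -/
lemma norm_gradient_taylor_le (hf : SmoothObjective f F C L K) (hK : 0 ≤ K) (x y : Param M) :
    ‖gradient f y - gradient f x - hess f x (y - x)‖ ≤ K * ‖y - x‖ ^ 2 := by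
  have h := (convex_segment x y).norm_image_sub_le_of_norm_hasFDerivWithin_le'
    (f := gradient f) (f' := hess f) (φ := hess f x) (C := K * ‖y - x‖)
    (fun z _ => (hf.hasFDerivAt_gradient z).hasFDerivWithinAt) (fun z hz => ?_)
    (left_mem_segment ℝ x y) (right_mem_segment ℝ x y)
  · rwa [mul_assoc, ← pow_two] at h
  · refine (hf.norm_hess_sub_le z x).trans ?_
    gcongr
    exact norm_sub_le_of_mem_segment hz

lemma inner_hess_symm (hf : SmoothObjective f F C L K) (x u v : Param M) :
    ⟪hess f x u, v⟫ = ⟪hess f x v, u⟫ := by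
  have h1 : ∀ y, HasFDerivAt f (dualMap M (gradient f y)) y := fun y =>
    (hf.hasGradientAt y).hasFDerivAt
  have h2 : HasFDerivAt (fun y => dualMap M (gradient f y)) ((dualMap M).comp (hess f x)) x :=
    (dualMap M).hasFDerivAt.comp x (hf.hasFDerivAt_gradient x)
  have h := second_derivative_symmetric h1 h2 u v
  have h3 : ∀ a b, (dualMap M).comp (hess f x) a b = ⟪hess f x a, b⟫ :=
    fun a b => dualIso_apply_apply _ _
  rwa [h3, h3] at h

/-- Along the segment, the defect plus `L/2 s²‖v‖²` has nonnegative derivative, because the gradient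
is `L`-Lipschitz. -/
lemma le_of_step (hf : SmoothObjective f F C L K) (x v : Param M) :
    f x + ⟪gradient f x, v⟫ - L / 2 * ‖v‖ ^ 2 ≤ f (x + v) := by
  let φ : ℝ → ℝ := fun s => f (x + s • v) - s * ⟪gradient f x, v⟫ + L / 2 * s ^ 2 * ‖v‖ ^ 2
  have hφ : ∀ s, HasDerivAt φ
      (⟪gradient f (x + s • v), v⟫ - ⟪gradient f x, v⟫ + L * s * ‖v‖ ^ 2) s := by
    intro s
    have h1 : HasDerivAt (fun s : ℝ => x + s • v) v s := by
      simpa using ((hasDerivAt_id s).smul_const v).const_add x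
    have h2 : HasDerivAt (fun s : ℝ => f (x + s • v)) ⟪gradient f (x + s • v), v⟫ s := by
      have := (hf.hasGradientAt (x + s • v)).hasFDerivAt.comp_hasDerivAt s h1
      simpa [Function.comp_def] using this
    have h3 := (h2.sub ((hasDerivAt_id s).mul_const ⟪gradient f x, v⟫)).add
      ((((hasDerivAt_id s).pow 2).const_mul (L / 2)).mul_const (‖v‖ ^ 2))
    have h4 : HasDerivAt φ _ s := h3
    refine h4.congr_deriv ?_
    simp only [id, Nat.cast_ofNat, Nat.add_one_sub_one, pow_one]
    ring
  have hmono : MonotoneOn φ (Set.Icc 0 1) := by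
    refine monotoneOn_of_deriv_nonneg (convex_Icc 0 1)
      (fun s _ => (hφ s).continuousAt.continuousWithinAt)
      (fun s _ => (hφ s).differentiableAt.differentiableWithinAt) fun s hs => ?_
    rw [interior_Icc] at hs
    rw [(hφ s).deriv, ← inner_sub_left]
    have h1 := hf.norm_gradient_sub_le (x + s • v) x
    rw [add_sub_cancel_left, norm_smul, Real.norm_eq_abs, abs_of_pos hs.1] at h1
    have h2 := (_root_.abs_le.1 ((abs_real_inner_le_norm (gradient f (x + s • v) - gradient f x) v).trans
      (mul_le_mul_of_nonneg_right h1 (norm_nonneg v)))).1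
    nlinarith
  have := hmono (Set.left_mem_Icc.2 zero_le_one) (Set.right_mem_Icc.2 zero_le_one) zero_le_one
  simp only [φ, zero_smul, add_zero, one_smul] at this
  linarith

end SmoothObjective

/-- Below the threshold `(ε/β)^(1/ν)` the left side is at most `ε`; above it, `ν ≤ 4` bounds `x^ν`
by a multiple of `x⁴`. This lets the fourth moment of the displacement control the Hölder modulus of
the noise covariance. -/
lemma rpow_le_add_pow_four {ν : ℝ} (hν₀ : 0 < ν) (hν₄ : ν ≤ 4) {β ε : ℝ} (hβ : 0 < β)
    (hε : 0 < ε) : ∃ c, 0 ≤ c ∧ ∀ x : ℝ, 0 ≤ x → β * x ^ ν ≤ ε + c * x ^ 4 := by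
  have hq : 0 < ε / β := by positivity
  have hx₀ : 0 < (ε / β) ^ (1 / ν) := Real.rpow_pos_of_pos hq _
  refine ⟨β * ((ε / β) ^ (1 / ν)) ^ (ν - 4), by positivity, fun x hx => ?_⟩
  rcases le_total x ((ε / β) ^ (1 / ν)) with h | h
  · have h1 : x ^ ν ≤ ε / β := by
      calc x ^ ν ≤ ((ε / β) ^ (1 / ν)) ^ ν := Real.rpow_le_rpow hx h hν₀.le
        _ = ε / β := by rw [← Real.rpow_mul hq.le, one_div_mul_cancel hν₀.ne', Real.rpow_one]
    have h2 : β * x ^ ν ≤ ε := by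
      calc β * x ^ ν ≤ β * (ε / β) := by gcongr
        _ = ε := by field_simp
    have : 0 ≤ β * ((ε / β) ^ (1 / ν)) ^ (ν - 4) * x ^ 4 := by positivity
    linarith
  · have hx' : 0 < x := hx₀.trans_le h
    have h1 : x ^ ν = x ^ (ν - 4) * x ^ 4 := by
      rw [← Real.rpow_natCast x 4, ← Real.rpow_add hx']
      norm_num
    have h2 : x ^ (ν - 4) ≤ ((ε / β) ^ (1 / ν)) ^ (ν - 4) :=
      Real.rpow_le_rpow_of_nonpos hx₀ h (by linarith)
    calc β * x ^ ν = β * x ^ (ν - 4) * x ^ 4 := by rw [h1]; ring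
      _ ≤ β * ((ε / β) ^ (1 / ν)) ^ (ν - 4) * x ^ 4 := by gcongr
      _ ≤ _ := by linarith

end Calculus

/-! ### Integrability along the run and expected one-step ascent. -/

section Iterates

variable {M : ℕ} {Ω : Type*} [MeasurableSpace Ω] {P : Measure Ω}
  {f : Param M → ℝ} {F C L K : ℝ} {μ σ D β ν : ℝ} {θ ξ d : ℕ → Ω → Param M}
  {Rxi : Param M → Param M →L[ℝ] Param M} {E : Set Ω} {p : Param M}

namespace AscentProcess

lemma measurableSet_of_history (h : AscentProcess P f μ σ D β ν θ ξ d Rxi) {t : ℕ}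
    (hE : MeasurableSet[history θ t] E) : MeasurableSet E :=
  history_le h.measurable_iterate t E hE

/-- On an event of bounded iterates the following iterates are bounded too. -/
lemma ae_norm_sub_le (h : AscentProcess P f μ σ D β ν θ ξ d Rxi) (hμ : 0 ≤ μ) {t : ℕ} {ε : ℝ}
    (hε : ∀ w ∈ E, ‖θ t w - p‖ ≤ ε) (s : ℕ) :
    ∀ᵐ w ∂P, w ∈ E → ‖θ (t + s) w - p‖ ≤ ε + s * (μ * σ) := by
  induction s with
  | zero => exact Filter.Eventually.of_forall fun w hw => by simpa using hε w hw
  | succ s ih =>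
    filter_upwards [ih, h.norm_step_le (t + s)] with w h1 h2 hw
    rw [← add_assoc, h.update, add_sub_right_comm]
    refine (norm_add_le _ _).trans ?_
    rw [norm_smul, Real.norm_eq_abs, abs_of_nonneg hμ]
    have := mul_le_mul_of_nonneg_left h2 hμ
    push_cast
    linarith [h1 hw]

lemma exists_bound_comp {V : Type*} [SeminormedAddCommGroup V] {t : ℕ} {ρ : ℝ}
    (hb : ∀ᵐ w ∂P, w ∈ E → ‖θ t w - p‖ ≤ ρ) {φ : Param M → V} (hφ : Continuous φ) :
    ∃ c, ∀ᵐ w ∂P, w ∈ E → ‖φ (θ t w)‖ ≤ c := by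
  obtain ⟨c, hc⟩ := (isCompact_closedBall p ρ).exists_bound_of_continuousOn hφ.continuousOn
  refine ⟨c, ?_⟩
  filter_upwards [hb] with w hw hwE
  exact hc _ (by rw [Metric.mem_closedBall, dist_eq_norm]; exact hw hwE)

variable [IsProbabilityMeasure P]

lemma integrableOn_comp (h : AscentProcess P f μ σ D β ν θ ξ d Rxi) {t : ℕ} {ρ : ℝ}
    (hE : MeasurableSet E) (hb : ∀ᵐ w ∂P, w ∈ E → ‖θ t w - p‖ ≤ ρ)
    {φ : Param M → ℝ} (hφ : Continuous φ) : IntegrableOn (fun w => φ (θ t w)) E P := by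
  obtain ⟨c, hc⟩ := exists_bound_comp hb hφ
  exact Integrable.of_bound
    (hφ.measurable.comp (h.measurable_iterate t)).aestronglyMeasurable c
    ((ae_restrict_iff' hE).2 hc)

lemma integrable_bias_fourth (h : AscentProcess P f μ σ D β ν θ ξ d Rxi) (t : ℕ) :
    Integrable (fun w => ‖d t w‖ ^ 4) P := by
  obtain ⟨c, hc⟩ := h.bounded_bias
  refine Integrable.of_bound ((h.aestronglyMeasurable_bias t).norm.pow 4) (c ^ 4) ?_
  filter_upwards [hc t] with w hw
  rw [norm_pow, norm_norm]
  gcongr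

lemma integrable_noise (h : AscentProcess P f μ σ D β ν θ ξ d Rxi) (t : ℕ) :
    Integrable (ξ t) P := by
  obtain ⟨c, hc⟩ := h.bounded_noise
  exact Integrable.of_bound (h.aestronglyMeasurable_noise t) c (hc t)

lemma integrable_noise_sq (h : AscentProcess P f μ σ D β ν θ ξ d Rxi) (t : ℕ) (v : Param M) :
    Integrable (fun w => ⟪ξ t w, v⟫ ^ 2) P := by
  obtain ⟨c, hc⟩ := h.bounded_noise
  refine Integrable.of_bound
    (((h.aestronglyMeasurable_noise t).inner aestronglyMeasurable_const).pow 2)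
    ((c * ‖v‖) ^ 2) ?_
  filter_upwards [hc t] with w hw
  rw [norm_pow]
  gcongr
  exact (norm_inner_le_norm _ _).trans (by gcongr)

/-- The noise is orthogonal to continuous functions of the current iterate, on past events. -/
lemma noise_orthogonal (h : AscentProcess P f μ σ D β ν θ ξ d Rxi) {t : ℕ} {ρ : ℝ}
    (hE : MeasurableSet[history θ t] E) (hb : ∀ᵐ w ∂P, w ∈ E → ‖θ t w - p‖ ≤ ρ)
    {φ : Param M → Param M} (hφ : Continuous φ) :
    IntegrableOn (fun w => ⟪φ (θ t w), ξ t w⟫) E P ∧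
      ∫ w in E, ⟪φ (θ t w), ξ t w⟫ ∂P = 0 := by
  obtain ⟨c, hc⟩ := exists_bound_comp hb hφ
  obtain ⟨c', hc'⟩ := h.bounded_noise
  have hE' := h.measurableSet_of_history hE
  have hmeas : Measurable[history θ t] fun w => φ (θ t w) :=
    hφ.measurable.comp (measurable_history θ le_rfl)
  have hW : StronglyMeasurable[history θ t] (E.indicator fun w => φ (θ t w)) :=
    (Measurable.stronglyMeasurable hmeas).indicator hE
  have hind : (fun w => dualMap M (E.indicator (fun w => φ (θ t w)) w) (ξ t w)) =
      E.indicator fun w => ⟪φ (θ t w), ξ t w⟫ := by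
    funext w
    by_cases hw : w ∈ E
    · simp only [Set.indicator_of_mem hw]
      exact dualIso_apply_apply _ _
    · simp [Set.indicator_of_notMem hw]
  have hint : IntegrableOn (fun w => ⟪φ (θ t w), ξ t w⟫) E P := by
    refine Integrable.of_bound (C := c * c')
      ((hφ.measurable.comp (h.measurable_iterate t)).aestronglyMeasurable.inner
        (h.aestronglyMeasurable_noise t)).restrict ?_
    rw [ae_restrict_iff' hE']
    filter_upwards [hc, hc' t] with w h1 h2 hw
    exact (norm_inner_le_norm _ _).trans
      (mul_le_mul (h1 hw) h2 (norm_nonneg _) ((norm_nonneg _).trans (h1 hw)))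
  refine ⟨hint, ?_⟩
  -- The factor known at time `t` is pulled out of the conditional expectation of the pairing,
  -- leaving the conditional mean of the noise.
  have key := condExp_bilin_of_stronglyMeasurable_left (dualMap M) hW
    (by rw [hind]; exact hint.integrable_indicator hE') (h.integrable_noise t)
  rw [hind] at key
  rw [← integral_indicator hE', ← integral_condExp (history_le h.measurable_iterate t),
    integral_congr_ae key]
  refine integral_eq_zero_of_ae ?_
  filter_upwards [h.condExp_noise t] with w hw
  simp [hw]

/-- Expected one-step ascent. -/
lemma ascent_step (h : AscentProcess P f μ σ D β ν θ ξ d Rxi) (hf : SmoothObjective f F C L K)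
    (hμ : 0 < μ) (hD : 0 < D) (hL : 0 ≤ L) {t : ℕ} {ρ ρ' : ℝ}
    (hE : MeasurableSet[history θ t] E) (hb : ∀ᵐ w ∂P, w ∈ E → ‖θ t w - p‖ ≤ ρ)
    (hb' : ∀ᵐ w ∂P, w ∈ E → ‖θ (t + 1) w - p‖ ≤ ρ') :
    ∫ w in E, f (θ t w) ∂P + μ / 2 * ∫ w in E, ‖gradient f (θ t w)‖ ^ 2 ∂P -
      μ ^ 2 / 2 * (L * σ ^ 2 + D ^ 2 * μ) * P.real E ≤ ∫ w in E, f (θ (t + 1) w) ∂P := by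
  have hE' := h.measurableSet_of_history hE
  have hg := hf.continuous_gradient
  obtain ⟨hi3, ho⟩ := h.noise_orthogonal hE hb hg
  have hi0 := h.integrableOn_comp hE' hb hf.continuous
  have hi1 : IntegrableOn (fun w => ‖gradient f (θ t w)‖ ^ 2) E P :=
    h.integrableOn_comp hE' hb (hg.norm.pow 2)
  have hi2 := (h.integrable_bias_fourth t).integrableOn (s := E)
  have hi' := h.integrableOn_comp hE' hb' hf.continuous
  have hic : IntegrableOn (fun _ => μ ^ 2 / 2 * (L * σ ^ 2) + D ^ 2 * μ ^ 3 / 4) E P :=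
    (integrable_const _).integrableOn
  have hpt : ∀ᵐ w ∂P, f (θ t w) + μ / 2 * ‖gradient f (θ t w)‖ ^ 2 +
      μ * ⟪gradient f (θ t w), ξ t w⟫ - 1 / (4 * D ^ 2 * μ) * ‖d t w‖ ^ 4 -
      (μ ^ 2 / 2 * (L * σ ^ 2) + D ^ 2 * μ ^ 3 / 4) ≤ f (θ (t + 1) w) := by
    filter_upwards [h.norm_step_le t] with w hw
    have h1 := hf.le_of_step (θ t w) (μ • (gradient f (θ t w) + d t w + ξ t w))
    rw [← h.update, norm_smul, Real.norm_eq_abs, abs_of_pos hμ, inner_smul_right,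
      inner_add_right, inner_add_right, real_inner_self_eq_norm_sq] at h1
    set g := gradient f (θ t w)
    -- The bound on the full step handles the whole second-order term, with no separate treatment of
    -- noise and bias.
    have h2 : (μ * ‖g + d t w + ξ t w‖) ^ 2 ≤ (μ * σ) ^ 2 := by gcongr
    have h3 : -(‖g‖ ^ 2 / 2 + ‖d t w‖ ^ 2 / 2) ≤ ⟪g, d t w⟫ := by
      have := (abs_le.1 (abs_real_inner_le_norm g (d t w))).1
      nlinarith [sq_nonneg (‖g‖ - ‖d t w‖)]
    -- The weight `D²μ²` balances the two sides: the fourth moment bound turns each into `D²μ³/4`,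
    -- in total `μ²/2 * D²μ`.
    have h4 : μ * ‖d t w‖ ^ 2 / 2 ≤
        1 / (4 * D ^ 2 * μ) * ‖d t w‖ ^ 4 + D ^ 2 * μ ^ 3 / 4 := by
      have : 1 / (4 * D ^ 2 * μ) * ‖d t w‖ ^ 4 + D ^ 2 * μ ^ 3 / 4 - μ * ‖d t w‖ ^ 2 / 2 =
          1 / (4 * D ^ 2 * μ) * (‖d t w‖ ^ 2 - D ^ 2 * μ ^ 2) ^ 2 := by
        field_simp
        ring
      have : 0 ≤ 1 / (4 * D ^ 2 * μ) * (‖d t w‖ ^ 2 - D ^ 2 * μ ^ 2) ^ 2 := by positivity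
      linarith
    have h5 := mul_le_mul_of_nonneg_left h3 hμ.le
    have h6 := mul_le_mul_of_nonneg_left h2 (by positivity : 0 ≤ L / 2)
    nlinarith
  have hmono := setIntegral_mono_ae
    ((((hi0.add (hi1.const_mul (μ / 2))).add (hi3.const_mul μ)).sub
      (hi2.const_mul (1 / (4 * D ^ 2 * μ)))).sub hic) hi' hpt
  rw [integral_sub' (((hi0.add (hi1.const_mul (μ / 2))).add (hi3.const_mul μ)).sub
      (hi2.const_mul (1 / (4 * D ^ 2 * μ)))) hic,
    integral_sub' ((hi0.add (hi1.const_mul (μ / 2))).add (hi3.const_mul μ))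
      (hi2.const_mul (1 / (4 * D ^ 2 * μ))),
    integral_add' (hi0.add (hi1.const_mul (μ / 2))) (hi3.const_mul μ),
    integral_add' hi0 (hi1.const_mul (μ / 2)), integral_const_mul, integral_const_mul,
    integral_const_mul, ho, setIntegral_const, smul_eq_mul] at hmono
  have hd := mul_le_mul_of_nonneg_left (h.bias_fourth t E hE)
    (by positivity : 0 ≤ 1 / (4 * D ^ 2 * μ))
  have he : 1 / (4 * D ^ 2 * μ) * (D ^ 4 * μ ^ 4 * P.real E) = D ^ 2 * μ ^ 3 / 4 * P.real E := by
    field_simp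
  rw [he] at hd
  linarith

end AscentProcess

end Iterates

end BiasedPG

namespace BiasedPG

/-! ### Moments of the displacement near a strict saddle point. -/

section Iterates

variable {M : ℕ} {Ω : Type*} [MeasurableSpace Ω] {P : Measure Ω} [IsProbabilityMeasure P]
  {f : Param M → ℝ} {F C L K : ℝ} {μ σ D β ν : ℝ} {θ ξ d : ℕ → Ω → Param M}
  {Rxi : Param M → Param M →L[ℝ] Param M} {E : Set Ω} {p v : Param M} {lam Γ : ℝ}

/-- A point with small gradient and a unit eigenvector of the Hessian with eigenvalue `lam`. -/
structure SaddleDirection {M : ℕ} (f : Param M → ℝ) (μ Γ : ℝ) (p v : Param M) (lam : ℝ) : Prop where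
  norm_gradient_sq_le : ‖gradient f p‖ ^ 2 ≤ μ * Γ
  norm_eq_one : ‖v‖ = 1
  hess_apply : hess f p v = lam • v

/-- Growth rate of the fourth moment of the displacement. -/
noncomputable def fourthRate (L σ Γ : ℝ) : ℝ := 5 + Γ + 4 * L + 4 * σ ^ 2

/-- Source term of the fourth moment of the displacement. -/
noncomputable def fourthSource (σ D Γ : ℝ) : ℝ := Γ + 4 * σ ^ 2 + 3 * σ ^ 4 + D ^ 4

/-- Bound of the fourth moment of the displacement over a time horizon `T / μ`. -/
noncomputable def fourthConst (L σ D Γ T : ℝ) : ℝ :=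
  Real.exp (fourthRate L σ Γ * T) * (1 + fourthSource σ D Γ * T)

/-- The first-order term is kept exactly, since its noise part will average to zero. The remaining
terms of the expanded square are absorbed by Cauchy-Schwarz, `2aμ ≤ a² + μ²` with `a = ‖u‖²`, and `μ
≤ 1`. -/
lemma norm_add_smul_pow_four_le {V : Type*} [NormedAddCommGroup V] [InnerProductSpace ℝ V]
    (u g : V) {μ σ : ℝ} (hμ₀ : 0 ≤ μ) (hμ₁ : μ ≤ 1) (hg : ‖g‖ ≤ σ) :
    ‖u + μ • g‖ ^ 4 ≤ ‖u‖ ^ 4 + 4 * μ * ‖u‖ ^ 2 * ⟪u, g⟫ + 4 * σ ^ 2 * (μ * ‖u‖ ^ 4 + μ ^ 3) +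
      3 * σ ^ 4 * μ ^ 3 := by
  have hc : ‖g‖ ^ 2 ≤ σ ^ 2 := by gcongr
  have hb : ⟪u, g⟫ ^ 2 ≤ ‖u‖ ^ 2 * ‖g‖ ^ 2 := by
    rw [← mul_pow]
    exact sq_le_sq' (_root_.abs_le.1 (abs_real_inner_le_norm u g)).1
      (_root_.abs_le.1 (abs_real_inner_le_norm u g)).2
  have h1 : ‖u + μ • g‖ ^ 2 = ‖u‖ ^ 2 + 2 * μ * ⟪u, g⟫ + μ ^ 2 * ‖g‖ ^ 2 := by
    rw [norm_add_sq_real, inner_smul_right, norm_smul, Real.norm_eq_abs, mul_pow, sq_abs]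
    ring
  have h2 : ‖u + μ • g‖ ^ 4 = (‖u‖ ^ 2 + 2 * μ * ⟪u, g⟫ + μ ^ 2 * ‖g‖ ^ 2) ^ 2 := by
    rw [← h1]; ring
  have h3 : ‖u‖ ^ 4 = (‖u‖ ^ 2) ^ 2 := by ring
  have h4 : σ ^ 4 = (σ ^ 2) ^ 2 := by ring
  rw [h2, h3, h4]
  have ha : 0 ≤ ‖u‖ ^ 2 := by positivity
  have hc0 : 0 ≤ ‖g‖ ^ 2 := by positivity
  have hs0 : 0 ≤ σ ^ 2 := by positivity
  generalize ‖u‖ ^ 2 = a at *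
  generalize ‖g‖ ^ 2 = c at *
  generalize ⟪u, g⟫ = b at *
  generalize σ ^ 2 = s at *
  have hac : a * c ≤ a * s := by gcongr
  have hcc : c ^ 2 ≤ s ^ 2 := by gcongr
  have e1 : μ ^ 2 * b ^ 2 ≤ μ ^ 2 * (a * s) := by gcongr; exact hb.trans hac
  have e2 : μ ^ 2 * (a * c) ≤ μ ^ 2 * (a * s) := by gcongr
  have e3 : 2 * (μ ^ 3 * (b * c)) ≤ μ ^ 2 * b ^ 2 + μ ^ 4 * c ^ 2 := by
    nlinarith [sq_nonneg (μ * b - μ ^ 2 * c)]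
  have e4 : μ ^ 4 * c ^ 2 ≤ μ ^ 3 * s ^ 2 := by
    have : μ ^ 4 ≤ μ ^ 3 := pow_le_pow_of_le_one hμ₀ hμ₁ (by norm_num)
    gcongr
  have e5 : 2 * (μ ^ 2 * (a * s)) ≤ s * (μ * a ^ 2 + μ ^ 3) := by
    have : 0 ≤ s * μ * (a - μ) ^ 2 := by positivity
    nlinarith
  nlinarith

namespace AscentProcess

/-- One-step growth of the fourth moment of the displacement from `p`. -/
lemma fourth_moment_step (h : AscentProcess P f μ σ D β ν θ ξ d Rxi)
    (hf : SmoothObjective f F C L K) (hμ : 0 < μ) (hμ₁ : μ ≤ 1) (hΓ : 0 ≤ Γ)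
    (hp : ‖gradient f p‖ ^ 2 ≤ μ * Γ) {t : ℕ} {ρ ρ' : ℝ}
    (hE : MeasurableSet[history θ t] E) (hb : ∀ᵐ w ∂P, w ∈ E → ‖θ t w - p‖ ≤ ρ)
    (hb' : ∀ᵐ w ∂P, w ∈ E → ‖θ (t + 1) w - p‖ ≤ ρ') :
    ∫ w in E, ‖θ (t + 1) w - p‖ ^ 4 ∂P ≤
      (1 + fourthRate L σ Γ * μ) * ∫ w in E, ‖θ t w - p‖ ^ 4 ∂P +
        fourthSource σ D Γ * μ ^ 3 * P.real E := by
  have hE' := h.measurableSet_of_history hE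
  have hφ : Continuous fun x : Param M => ‖x - p‖ ^ 2 • (x - p) := by fun_prop
  have hφ4 : Continuous fun x : Param M => ‖x - p‖ ^ 4 := by fun_prop
  obtain ⟨hi1, ho⟩ := h.noise_orthogonal hE hb hφ
  have hi0 : IntegrableOn (fun w => ‖θ t w - p‖ ^ 4) E P := h.integrableOn_comp hE' hb hφ4
  have hi' : IntegrableOn (fun w => ‖θ (t + 1) w - p‖ ^ 4) E P := h.integrableOn_comp hE' hb' hφ4
  have hi2 := (h.integrable_bias_fourth t).integrableOn (s := E)
  have hic : IntegrableOn (fun _ => (Γ + 4 * σ ^ 2 + 3 * σ ^ 4) * μ ^ 3) E P :=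
    (integrable_const _).integrableOn
  have hpt : ∀ᵐ w ∂P, ‖θ (t + 1) w - p‖ ^ 4 ≤ (1 + fourthRate L σ Γ * μ) * ‖θ t w - p‖ ^ 4 +
      4 * μ * ⟪‖θ t w - p‖ ^ 2 • (θ t w - p), ξ t w⟫ + μ * ‖d t w‖ ^ 4 +
      (Γ + 4 * σ ^ 2 + 3 * σ ^ 4) * μ ^ 3 := by
    filter_upwards [h.norm_step_le t] with w hw
    have h1 := norm_add_smul_pow_four_le (θ t w - p) _ hμ.le hμ₁ hw
    rw [sub_add_eq_add_sub, ← h.update, inner_add_right, inner_add_right] at h1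
    rw [real_inner_smul_left]
    have hg := hf.norm_gradient_sub_le (θ t w) p
    set u := θ t w - p
    set g := gradient f (θ t w)
    have h2 : ⟪u, g⟫ ≤ (‖u‖ ^ 2 + μ * Γ) / 2 + L * ‖u‖ ^ 2 := by
      have e1 : ⟪u, g⟫ = ⟪u, gradient f p⟫ + ⟪u, g - gradient f p⟫ := by
        rw [← inner_add_right, add_sub_cancel]
      have e2 := real_inner_le_norm u (gradient f p)
      have e3 := (real_inner_le_norm u (g - gradient f p)).trans
        (mul_le_mul_of_nonneg_left hg (norm_nonneg u))
      nlinarith [sq_nonneg (‖u‖ - ‖gradient f p‖)]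
    have h3 : ⟪u, d t w⟫ ≤ (‖u‖ ^ 2 + ‖d t w‖ ^ 2) / 2 := by
      nlinarith [real_inner_le_norm u (d t w), sq_nonneg (‖u‖ - ‖d t w‖)]
    have h4 : 2 * (‖u‖ ^ 2 * ‖d t w‖ ^ 2) ≤ ‖u‖ ^ 4 + ‖d t w‖ ^ 4 := by
      nlinarith [sq_nonneg (‖u‖ ^ 2 - ‖d t w‖ ^ 2)]
    -- This split is where `‖∇f(p)‖² ≤ μΓ` matters: the gradient at `p` contributes a source of
    -- order `μ³`.
    have h5 : 2 * (μ * ‖u‖ ^ 2) ≤ ‖u‖ ^ 4 + μ ^ 2 := by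
      nlinarith [sq_nonneg (‖u‖ ^ 2 - μ)]
    have hw4 : 0 ≤ 4 * μ * ‖u‖ ^ 2 := by positivity
    have k2 := mul_le_mul_of_nonneg_left h2 hw4
    have k3 := mul_le_mul_of_nonneg_left h3 hw4
    have k4 := mul_le_mul_of_nonneg_left h4 hμ.le
    have k5 := mul_le_mul_of_nonneg_left h5 (mul_nonneg hμ.le hΓ)
    simp only [fourthRate]
    nlinarith
  have hmono := setIntegral_mono_ae hi'
    ((((hi0.const_mul (1 + fourthRate L σ Γ * μ)).add (hi1.const_mul (4 * μ))).add
      (hi2.const_mul μ)).add hic) hpt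
  rw [integral_add' (((hi0.const_mul (1 + fourthRate L σ Γ * μ)).add (hi1.const_mul (4 * μ))).add
      (hi2.const_mul μ)) hic,
    integral_add' ((hi0.const_mul (1 + fourthRate L σ Γ * μ)).add (hi1.const_mul (4 * μ)))
      (hi2.const_mul μ),
    integral_add' (hi0.const_mul (1 + fourthRate L σ Γ * μ)) (hi1.const_mul (4 * μ)),
    integral_const_mul, integral_const_mul, integral_const_mul, ho, setIntegral_const,
    smul_eq_mul] at hmono
  have hd := mul_le_mul_of_nonneg_left (h.bias_fourth t E hE) hμ.le
  have h0 : (0 : ℝ) ≤ P.real E := measureReal_nonneg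
  have hd' : μ * (D ^ 4 * μ ^ 4 * P.real E) ≤ D ^ 4 * μ ^ 3 * P.real E := by
    have : μ ^ 5 ≤ μ ^ 3 := pow_le_pow_of_le_one hμ.le hμ₁ (by norm_num)
    calc μ * (D ^ 4 * μ ^ 4 * P.real E) = D ^ 4 * μ ^ 5 * P.real E := by ring
      _ ≤ D ^ 4 * μ ^ 3 * P.real E := by gcongr
  simp only [fourthSource]
  nlinarith

/-- Over a time horizon of order `1 / μ` the fourth moment of the displacement is `O(μ²)`. -/
lemma fourth_moment_le (h : AscentProcess P f μ σ D β ν θ ξ d Rxi)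
    (hf : SmoothObjective f F C L K) (hμ : 0 < μ) (hμ₁ : μ ≤ 1) (hL : 0 ≤ L) (hΓ : 0 ≤ Γ)
    (hp : ‖gradient f p‖ ^ 2 ≤ μ * Γ) {t : ℕ}
    (hE : MeasurableSet[history θ t] E) (hb : ∀ w ∈ E, ‖θ t w - p‖ ≤ μ) {s : ℕ} {T : ℝ}
    (hs : s * μ ≤ T) :
    ∫ w in E, ‖θ (t + s) w - p‖ ^ 4 ∂P ≤ fourthConst L σ D Γ T * μ ^ 2 * P.real E := by
  have h0 : (0 : ℝ) ≤ P.real E := measureReal_nonneg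
  have hr : 0 ≤ fourthRate L σ Γ := by unfold fourthRate; positivity
  have hc : 0 ≤ fourthSource σ D Γ := by unfold fourthSource; positivity
  -- Discrete Grönwall: `s` sources of order `μ³` with `s ≤ T/μ` add up to order `μ²`, and the
  -- exponential stays bounded.
  have key : ∀ s : ℕ, ∫ w in E, ‖θ (t + s) w - p‖ ^ 4 ∂P ≤
      Real.exp (fourthRate L σ Γ * (s * μ)) * (μ ^ 2 + fourthSource σ D Γ * μ ^ 3 * s) *
        P.real E := by
    intro s
    induction s with
    | zero =>
      have hE' := h.measurableSet_of_history hE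
      have hφ4 : Continuous fun x : Param M => ‖x - p‖ ^ 4 := by fun_prop
      have hi : IntegrableOn (fun w => ‖θ t w - p‖ ^ 4) E P :=
        h.integrableOn_comp hE' (Filter.Eventually.of_forall hb) hφ4
      have : ∫ w in E, ‖θ t w - p‖ ^ 4 ∂P ≤ ∫ w in E, μ ^ 2 ∂P := by
        refine setIntegral_mono_on hi (integrable_const _).integrableOn hE' fun w hw => ?_
        calc ‖θ t w - p‖ ^ 4 ≤ μ ^ 4 := by gcongr; exact hb w hw
          _ ≤ μ ^ 2 := pow_le_pow_of_le_one hμ.le hμ₁ (by norm_num)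
      rw [setIntegral_const, smul_eq_mul] at this
      simpa [mul_comm] using this
    | succ s ih =>
      have h1 := h.fourth_moment_step hf hμ hμ₁ hΓ hp
        (history_mono θ (Nat.le_add_right t s) E hE) (h.ae_norm_sub_le hμ.le hb s)
        (h.ae_norm_sub_le hμ.le hb (s + 1))
      have h2 : 1 + fourthRate L σ Γ * μ ≤ Real.exp (fourthRate L σ Γ * μ) := by
        linarith [Real.add_one_le_exp (fourthRate L σ Γ * μ)]
      have h3 : Real.exp (fourthRate L σ Γ * ((s + 1 : ℕ) * μ)) =
          Real.exp (fourthRate L σ Γ * μ) * Real.exp (fourthRate L σ Γ * (s * μ)) := by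
        rw [← Real.exp_add]; congr 1; push_cast; ring
      have h4 : 1 ≤ Real.exp (fourthRate L σ Γ * ((s + 1 : ℕ) * μ)) :=
        Real.one_le_exp (by positivity)
      calc ∫ w in E, ‖θ (t + (s + 1)) w - p‖ ^ 4 ∂P
          ≤ (1 + fourthRate L σ Γ * μ) * ∫ w in E, ‖θ (t + s) w - p‖ ^ 4 ∂P +
            fourthSource σ D Γ * μ ^ 3 * P.real E := h1
        _ ≤ Real.exp (fourthRate L σ Γ * μ) * (Real.exp (fourthRate L σ Γ * (s * μ)) *
              (μ ^ 2 + fourthSource σ D Γ * μ ^ 3 * s) * P.real E) +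
            Real.exp (fourthRate L σ Γ * ((s + 1 : ℕ) * μ)) *
              (fourthSource σ D Γ * μ ^ 3 * P.real E) := by
            refine add_le_add (mul_le_mul h2 ih (integral_nonneg fun _ => by positivity)
              (Real.exp_pos _).le) ?_
            exact le_mul_of_one_le_left (by positivity) h4
        _ = _ := by rw [h3]; push_cast; ring
  refine (key s).trans ?_
  have h5 : Real.exp (fourthRate L σ Γ * (s * μ)) ≤ Real.exp (fourthRate L σ Γ * T) :=
    Real.exp_le_exp.2 (by gcongr)
  have h6 : μ ^ 2 + fourthSource σ D Γ * μ ^ 3 * s ≤ μ ^ 2 * (1 + fourthSource σ D Γ * T) := by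
    have : fourthSource σ D Γ * μ ^ 2 * (s * μ) ≤ fourthSource σ D Γ * μ ^ 2 * T := by gcongr
    nlinarith
  have h7 : 0 ≤ μ ^ 2 + fourthSource σ D Γ * μ ^ 3 * s := by positivity
  calc _ ≤ Real.exp (fourthRate L σ Γ * T) * (μ ^ 2 * (1 + fourthSource σ D Γ * T)) * P.real E := by
        gcongr
    _ = _ := by rw [fourthConst]; ring

/-- The error of the linear model of the gradient along an eigenvector of the Hessian. -/
lemma abs_inner_gradient_sub_le (hf : SmoothObjective f F C L K) (hK : 0 ≤ K)
    (hp : SaddleDirection f μ Γ p v lam) (x : Param M) :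
    |⟪v, gradient f x⟫ - (⟪v, gradient f p⟫ + lam * ⟪v, x - p⟫)| ≤ K * ‖x - p‖ ^ 2 := by
  have h1 : ⟪v, gradient f x⟫ - (⟪v, gradient f p⟫ + lam * ⟪v, x - p⟫) =
      ⟪v, gradient f x - gradient f p - hess f p (x - p)⟫ := by
    have h2 : ⟪v, hess f p (x - p)⟫ = lam * ⟪v, x - p⟫ := by
      rw [real_inner_comm, hf.inner_hess_symm, hp.hess_apply, real_inner_smul_left]
    rw [inner_sub_right v _ (hess f p (x - p)), h2, inner_sub_right v (gradient f x)]
    ring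
  rw [h1]
  refine (abs_real_inner_le_norm _ _).trans ?_
  rw [hp.norm_eq_one, one_mul]
  exact hf.norm_gradient_taylor_le hK p x

/-- One-step growth of the second moment of the linear model along the eigenvector. -/
lemma second_moment_step (h : AscentProcess P f μ σ D β ν θ ξ d Rxi)
    (hf : SmoothObjective f F C L K) (hμ : 0 < μ) (hK : 0 ≤ K) (hD : 0 < D)
    (hp : SaddleDirection f μ Γ p v lam) (hlam : 0 < lam) (hlamμ : μ * lam ≤ 1 / 4)
    {t : ℕ} {ρ ρ' : ℝ}
    (hE : MeasurableSet[history θ t] E) (hb : ∀ᵐ w ∂P, w ∈ E → ‖θ t w - p‖ ≤ ρ)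
    (hb' : ∀ᵐ w ∂P, w ∈ E → ‖θ (t + 1) w - p‖ ≤ ρ') :
    ∫ w in E, (⟪v, gradient f p⟫ + lam * ⟪v, θ t w - p⟫) ^ 2 ∂P +
      1 / 2 * (μ * lam) ^ 2 * ∫ w in E, ⟪Rxi (θ t w) v, v⟫ ∂P -
      3 * (μ * lam) * K ^ 2 * ∫ w in E, ‖θ t w - p‖ ^ 4 ∂P -
      3 * (μ * lam) * (D ^ 2 * μ ^ 2) * P.real E ≤
    ∫ w in E, (⟪v, gradient f p⟫ + lam * ⟪v, θ (t + 1) w - p⟫) ^ 2 ∂P := by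
  have hE' := h.measurableSet_of_history hE
  have hφ : Continuous fun x : Param M => (⟪v, gradient f p⟫ + lam * ⟪v, x - p⟫) • v := by
    fun_prop
  have hφ2 : Continuous fun x : Param M => (⟪v, gradient f p⟫ + lam * ⟪v, x - p⟫) ^ 2 := by
    fun_prop
  have hφ4 : Continuous fun x : Param M => ‖x - p‖ ^ 4 := by fun_prop
  obtain ⟨hi1, ho⟩ := h.noise_orthogonal hE hb hφ
  have hi0 : IntegrableOn (fun w => (⟪v, gradient f p⟫ + lam * ⟪v, θ t w - p⟫) ^ 2) E P :=
    h.integrableOn_comp hE' hb hφ2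
  have hi' : IntegrableOn (fun w => (⟪v, gradient f p⟫ + lam * ⟪v, θ (t + 1) w - p⟫) ^ 2) E P :=
    h.integrableOn_comp hE' hb' hφ2
  have hi2 : IntegrableOn (fun w => ‖θ t w - p‖ ^ 4) E P := h.integrableOn_comp hE' hb hφ4
  have hi3 := (h.integrable_bias_fourth t).integrableOn (s := E)
  have hi4 := (h.integrable_noise_sq t v).integrableOn (s := E)
  have hic : IntegrableOn (fun _ => 3 / 2 * (μ * lam) * (D ^ 2 * μ ^ 2)) E P :=
    (integrable_const _).integrableOn
  have hpt : ∀ᵐ w ∂P, (⟪v, gradient f p⟫ + lam * ⟪v, θ t w - p⟫) ^ 2 +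
      2 * (μ * lam) * ⟪(⟪v, gradient f p⟫ + lam * ⟪v, θ t w - p⟫) • v, ξ t w⟫ +
      1 / 2 * (μ * lam) ^ 2 * ⟪ξ t w, v⟫ ^ 2 - 3 * (μ * lam) * K ^ 2 * ‖θ t w - p‖ ^ 4 -
      3 / 2 * (μ * lam) * (1 / (D ^ 2 * μ ^ 2)) * ‖d t w‖ ^ 4 -
      3 / 2 * (μ * lam) * (D ^ 2 * μ ^ 2) ≤
      (⟪v, gradient f p⟫ + lam * ⟪v, θ (t + 1) w - p⟫) ^ 2 := by
    refine Filter.Eventually.of_forall fun w => ?_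
    have hr := abs_inner_gradient_sub_le hf hK hp (θ t w)
    have hd1 : ⟪v, d t w⟫ ^ 2 ≤ ‖d t w‖ ^ 2 := by
      have := abs_real_inner_le_norm v (d t w)
      rw [hp.norm_eq_one, one_mul] at this
      exact sq_le_sq' (_root_.abs_le.1 this).1 (_root_.abs_le.1 this).2
    have hd2 : 2 * ‖d t w‖ ^ 2 ≤ 1 / (D ^ 2 * μ ^ 2) * ‖d t w‖ ^ 4 + D ^ 2 * μ ^ 2 := by
      have e : 1 / (D ^ 2 * μ ^ 2) * ‖d t w‖ ^ 4 + D ^ 2 * μ ^ 2 - 2 * ‖d t w‖ ^ 2 =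
          1 / (D ^ 2 * μ ^ 2) * (‖d t w‖ ^ 2 - D ^ 2 * μ ^ 2) ^ 2 := by
        field_simp
        ring
      have : 0 ≤ 1 / (D ^ 2 * μ ^ 2) * (‖d t w‖ ^ 2 - D ^ 2 * μ ^ 2) ^ 2 := by positivity
      linarith
    rw [real_inner_smul_left, real_inner_comm v (ξ t w), h.update,
      add_sub_right_comm (θ t w) _ p, inner_add_right v (θ t w - p), inner_smul_right, inner_add_right, inner_add_right]
    set y := ⟪v, gradient f p⟫ + lam * ⟪v, θ t w - p⟫
    have hr2 : (⟪v, gradient f (θ t w)⟫ - y) ^ 2 ≤ K ^ 2 * ‖θ t w - p‖ ^ 4 := by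
      have := sq_le_sq' (_root_.abs_le.1 hr).1 (_root_.abs_le.1 hr).2
      nlinarith
    -- With `m = μ * lam` the model obeys `y ↦ y + m (y + e + n)`, where `e` collects Taylor error
    -- and bias, and `n` is the noise along `v`.
    have hnext : ⟪v, gradient f p⟫ + lam * (⟪v, θ t w - p⟫ +
        μ * (⟪v, gradient f (θ t w)⟫ + ⟪v, d t w⟫ + ⟪v, ξ t w⟫)) =
        y + μ * lam * (y + (⟪v, gradient f (θ t w)⟫ - y + ⟪v, d t w⟫) + ⟪v, ξ t w⟫) := by
      simp only [y]; ring
    rw [hnext]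
    have hm0 : 0 < μ * lam := mul_pos hμ hlam
    generalize ⟪v, gradient f (θ t w)⟫ - y = r at *
    generalize ⟪v, d t w⟫ = b at *
    generalize ⟪v, ξ t w⟫ = n at *
    generalize ‖θ t w - p‖ ^ 4 = U at *
    generalize 1 / (D ^ 2 * μ ^ 2) = q at *
    generalize ‖d t w‖ ^ 4 = d4 at *
    generalize D ^ 2 * μ ^ 2 = q' at *
    generalize ‖d t w‖ ^ 2 = d2 at *
    generalize μ * lam = m at *
    have e1 : (r + b) ^ 2 ≤ 2 * (K ^ 2 * U) + (q * d4 + q') := by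
      nlinarith [sq_nonneg (r - b)]
    -- Half of the noise energy is sacrificed to decouple it from `y` and the errors; `m ≤ 1/4` lets
    -- the first-order drift pay for the `y²` lost here.
    have e2 : n ^ 2 / 2 - 2 * y ^ 2 - 2 * (r + b) ^ 2 ≤ (y + (r + b) + n) ^ 2 := by
      nlinarith [sq_nonneg (2 * (y + (r + b)) + n), sq_nonneg (y - (r + b))]
    have e3 : m ^ 2 * (2 * y ^ 2 + 2 * (r + b) ^ 2) ≤ m * (y ^ 2 + (r + b) ^ 2) / 2 := by
      have : m ^ 2 ≤ m / 4 := by nlinarith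
      nlinarith [mul_le_mul_of_nonneg_right this
        (by positivity : 0 ≤ 2 * y ^ 2 + 2 * (r + b) ^ 2)]
    have e4 : m * (y ^ 2 - (r + b) ^ 2) ≤ m * (2 * y ^ 2 + 2 * y * (r + b)) := by
      gcongr
      nlinarith [sq_nonneg (y + (r + b))]
    have e5 := mul_le_mul_of_nonneg_left e1 (by positivity : 0 ≤ 3 / 2 * m)
    have e6 := mul_le_mul_of_nonneg_left e2 (by positivity : 0 ≤ m ^ 2)
    -- The remaining self-amplification of `y` is discarded: the noise alone gives enough growth.
    have e7 : 0 ≤ m * y ^ 2 := by positivity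
    linarith
  have a1 := hi0.add (hi1.const_mul (2 * (μ * lam)))
  have a2 := a1.add (hi4.const_mul (1 / 2 * (μ * lam) ^ 2))
  have a3 := a2.sub (hi2.const_mul (3 * (μ * lam) * K ^ 2))
  have a4 := a3.sub (hi3.const_mul (3 / 2 * (μ * lam) * (1 / (D ^ 2 * μ ^ 2))))
  have hmono := setIntegral_mono_ae (a4.sub hic) hi' hpt
  rw [integral_sub' a4 hic, integral_sub' a3 (hi3.const_mul _), integral_sub' a2 (hi2.const_mul _),
    integral_add' a1 (hi4.const_mul _), integral_add' hi0 (hi1.const_mul _), integral_const_mul,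
    integral_const_mul, integral_const_mul, integral_const_mul, ho, setIntegral_const,
    smul_eq_mul, h.covariance t v E hE] at hmono
  have hd := mul_le_mul_of_nonneg_left (h.bias_fourth t E hE)
    (by positivity : 0 ≤ 3 / 2 * (μ * lam) * (1 / (D ^ 2 * μ ^ 2)))
  have he : 3 / 2 * (μ * lam) * (1 / (D ^ 2 * μ ^ 2)) * (D ^ 4 * μ ^ 4 * P.real E) =
      3 / 2 * (μ * lam) * (D ^ 2 * μ ^ 2) * P.real E := by
    field_simp
  rw [he] at hd
  linarith

/-- The noise keeps its strength near a point where it is strong. -/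
lemma le_setIntegral_covariance (h : AscentProcess P f μ σ D β ν θ ξ d Rxi)
    (hv : ‖v‖ = 1) {σl c : ℝ} (hc : ∀ x : ℝ, 0 ≤ x → β * x ^ ν ≤ σl ^ 2 / 4 + c * x ^ 4)
    (hR : σl ^ 2 ≤ ⟪Rxi p v, v⟫) {t : ℕ} {ρ : ℝ}
    (hE : MeasurableSet E) (hb : ∀ᵐ w ∂P, w ∈ E → ‖θ t w - p‖ ≤ ρ) :
    3 / 4 * σl ^ 2 * P.real E - c * ∫ w in E, ‖θ t w - p‖ ^ 4 ∂P ≤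
      ∫ w in E, ⟪Rxi (θ t w) v, v⟫ ∂P := by
  have hφ4 : Continuous fun x : Param M => ‖x - p‖ ^ 4 := by fun_prop
  have hi : IntegrableOn (fun w => ‖θ t w - p‖ ^ 4) E P := h.integrableOn_comp hE hb hφ4
  have hic : IntegrableOn (fun _ => 3 / 4 * σl ^ 2) E P := (integrable_const _).integrableOn
  have hmono := setIntegral_mono (hic.sub (hi.const_mul c))
    (h.integrable_covariance t v).integrableOn fun w => ?_
  · rw [integral_sub' hic (hi.const_mul c), integral_const_mul c, setIntegral_const,
      smul_eq_mul] at hmono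
    linarith
  · simp only [Pi.sub_apply]
    have h1 := hc _ (norm_nonneg (θ t w - p))
    have h2 : |⟪(Rxi (θ t w) - Rxi p) v, v⟫| ≤ β * ‖θ t w - p‖ ^ ν := by
      refine (abs_real_inner_le_norm _ _).trans ?_
      rw [hv, mul_one]
      refine ((Rxi (θ t w) - Rxi p).le_opNorm v).trans ?_
      rw [hv, mul_one]
      exact h.holder _ _
    rw [sub_apply, inner_sub_left] at h2
    linarith [(_root_.abs_le.1 h2).1]

/-- Near a strict saddle point the expected objective increases over `s` steps. -/
lemma saddle_ascent (h : AscentProcess P f μ σ D β ν θ ξ d Rxi)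
    (hf : SmoothObjective f F C L K) (hμ : 0 < μ) (hμ₁ : μ ≤ 1) (hL : 0 ≤ L) (hK : 0 ≤ K)
    (hD : 0 < D) (hΓ : 0 ≤ Γ) (hp : SaddleDirection f μ Γ p v lam) {ω σl c T : ℝ}
    (hω : 0 < ω) (hlam : ω ≤ lam) (hlamL : lam ≤ L) (hμL : μ * L ≤ 1 / 4)
    (hc0 : 0 ≤ c) (hc : ∀ x : ℝ, 0 ≤ x → β * x ^ ν ≤ σl ^ 2 / 4 + c * x ^ 4)
    (hR : σl ^ 2 ≤ ⟪Rxi p v, v⟫)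
    (hμ₂ : c * (fourthConst L σ D Γ T * μ ^ 2) ≤ σl ^ 2 / 8)
    (hμ₃ : 48 * μ * (K ^ 2 * fourthConst L σ D Γ T + D ^ 2) ≤ ω * σl ^ 2) {t : ℕ}
    (hE : MeasurableSet[history θ t] E) (hb : ∀ w ∈ E, ‖θ t w - p‖ ≤ μ) {s : ℕ}
    (hs : s * μ ≤ T) :
    ∫ w in E, f (θ t w) ∂P + (μ ^ 3 * ω ^ 2 * σl ^ 2 * (s * (s - 1)) / 32 -
      s * (μ ^ 3 * K ^ 2 * fourthConst L σ D Γ T / 2 +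
        μ ^ 2 / 2 * (L * σ ^ 2 + D ^ 2 * μ))) * P.real E ≤
      ∫ w in E, f (θ (t + s) w) ∂P := by
  have h0 : (0 : ℝ) ≤ P.real E := measureReal_nonneg
  have hE' := h.measurableSet_of_history hE
  have hEs : ∀ s, MeasurableSet[history θ (t + s)] E := fun s =>
    history_mono θ (Nat.le_add_right t s) E hE
  have hbs := h.ae_norm_sub_le hμ.le hb
  have hlam0 : 0 < lam := hω.trans_le hlam
  have hU : ∀ s : ℕ, s * μ ≤ T → ∫ w in E, ‖θ (t + s) w - p‖ ^ 4 ∂P ≤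
      fourthConst L σ D Γ T * μ ^ 2 * P.real E := fun s hs =>
    h.fourth_moment_le hf hμ hμ₁ hL hΓ hp.norm_gradient_sq_le hE hb hs
  -- The noise adds a fixed amount of energy to the model at every step of the block.
  have hY : ∀ s : ℕ, s * μ ≤ T → s * (μ ^ 2 * ω ^ 2 * σl ^ 2 / 4) * P.real E ≤
      ∫ w in E, (⟪v, gradient f p⟫ + lam * ⟪v, θ (t + s) w - p⟫) ^ 2 ∂P := by
    intro s
    induction s with
    | zero =>
      intro _
      simp only [Nat.cast_zero, zero_mul]
      exact integral_nonneg fun w => sq_nonneg _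
    | succ s ih =>
      intro hs
      have hs' : s * μ ≤ T := by push_cast at hs; linarith
      have h1 := h.second_moment_step hf hμ hK hD hp hlam0
        ((mul_le_mul_of_nonneg_left hlamL hμ.le).trans hμL) (hEs s) (hbs s) (hbs (s + 1))
      have h2 := h.le_setIntegral_covariance hp.norm_eq_one hc hR hE' (hbs s)
      have h3 := hU s hs'
      have h4 := ih hs'
      rw [← add_assoc]
      refine le_trans ?_ h1
      -- By `hμ₂` the displacement costs at most `1/8` of the `3/4` left. The gain is then `5/16 (μ
      -- lam σl)²`; by `hμ₃` Taylor error and bias take at most `1/16` of it, leaving `1/4`.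
      have h5 : 5 / 8 * σl ^ 2 * P.real E ≤ ∫ w in E, ⟪Rxi (θ (t + s) w) v, v⟫ ∂P := by
        have := mul_le_mul_of_nonneg_left h3 hc0
        have := mul_le_mul_of_nonneg_right hμ₂ h0
        linarith
      have h6 := mul_le_mul_of_nonneg_left h5 (by positivity : 0 ≤ 1 / 2 * (μ * lam) ^ 2)
      have h7 := mul_le_mul_of_nonneg_left h3 (by positivity : 0 ≤ 3 * (μ * lam) * K ^ 2)
      have h8 : 48 * μ * (K ^ 2 * fourthConst L σ D Γ T + D ^ 2) ≤ lam * σl ^ 2 :=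
        hμ₃.trans (by gcongr)
      have h9 := mul_le_mul_of_nonneg_right
        (mul_le_mul_of_nonneg_left h8 (by positivity : 0 ≤ μ ^ 2 * lam / 16)) h0
      have h10 : μ ^ 2 * ω ^ 2 * σl ^ 2 * P.real E ≤ μ ^ 2 * lam ^ 2 * σl ^ 2 * P.real E := by
        gcongr
      push_cast
      linarith
  induction s with
  | zero => simp
  | succ s ih =>
    have hs' : s * μ ≤ T := by push_cast at hs; linarith
    have h1 := h.ascent_step hf hμ hD hL (hEs s) (hbs s) (hbs (s + 1))
    have h2 := hU s hs'
    have h3 := hY s hs'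
    have h4 := ih hs'
    have hi0 : IntegrableOn (fun w => ‖gradient f (θ (t + s) w)‖ ^ 2) E P :=
      h.integrableOn_comp hE' (hbs s) (hf.continuous_gradient.norm.pow 2)
    have hφ4 : Continuous fun x : Param M => ‖x - p‖ ^ 4 := by fun_prop
    have hi1 : IntegrableOn (fun w => ‖θ (t + s) w - p‖ ^ 4) E P :=
      h.integrableOn_comp hE' (hbs s) hφ4
    have hφ2 : Continuous fun x : Param M => (⟪v, gradient f p⟫ + lam * ⟪v, x - p⟫) ^ 2 := by
      fun_prop
    have hi2 : IntegrableOn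
        (fun w => (⟪v, gradient f p⟫ + lam * ⟪v, θ (t + s) w - p⟫) ^ 2) E P :=
      h.integrableOn_comp hE' (hbs s) hφ2
    -- Pointwise `‖∇f‖² ≥ y²/2 - K²‖θ - p‖⁴`. Together with `hY`, step `s` contributes `μ³ω²σl²
    -- s/16`, and summation yields `s(s-1)/32`.
    have hmono := setIntegral_mono ((hi2.const_mul (1 / 2)).sub (hi1.const_mul (K ^ 2))) hi0
      fun w => ?_
    · rw [integral_sub' (hi2.const_mul (1 / 2)) (hi1.const_mul (K ^ 2)), integral_const_mul,
        integral_const_mul] at hmono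
      have h5 := mul_le_mul_of_nonneg_left h2 (by positivity : 0 ≤ K ^ 2)
      have h6 := mul_le_mul_of_nonneg_left hmono (by positivity : 0 ≤ μ / 2)
      have h7 := mul_le_mul_of_nonneg_left h3 (by positivity : 0 ≤ μ / 4)
      have h8 := mul_le_mul_of_nonneg_left h5 (by positivity : 0 ≤ μ / 2)
      rw [← add_assoc]
      refine le_trans ?_ h1
      push_cast
      linarith
    · simp only [Pi.sub_apply]
      have hr := abs_inner_gradient_sub_le hf hK hp (θ (t + s) w)
      have hn := abs_real_inner_le_norm v (gradient f (θ (t + s) w))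
      rw [hp.norm_eq_one, one_mul] at hn
      have hn2 := sq_le_sq' (_root_.abs_le.1 hn).1 (_root_.abs_le.1 hn).2
      have hr2 := sq_le_sq' (_root_.abs_le.1 hr).1 (_root_.abs_le.1 hr).2
      set y := ⟪v, gradient f p⟫ + lam * ⟪v, θ (t + s) w - p⟫
      linarith [sq_nonneg (2 * (⟪v, gradient f (θ (t + s) w)⟫ - y) + y)]

end AscentProcess

end Iterates

end BiasedPG

namespace BiasedPG

/-! ### Largest eigenvalues and measurability of the regions. -/

section Spectrum

variable {M : ℕ}

lemma bddAbove_eigenvalues (T : Param M →L[ℝ] Param M) :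
    BddAbove {l : ℝ | Module.End.HasEigenvalue (T : Module.End ℝ (Param M)) l} :=
  (Module.End.finite_hasEigenvalue _).bddAbove

lemma le_lamMax {T : Param M →L[ℝ] Param M} {v : Param M} {l : ℝ} (hv : ‖v‖ = 1)
    (h : T v = l • v) : l ≤ lamMax T := by
  refine le_csSup (bddAbove_eigenvalues T) ?_
  refine Module.End.hasEigenvalue_of_hasEigenvector (x := v) ⟨?_, ?_⟩
  · exact Module.End.mem_eigenspace_iff.2 h
  · rintro rfl
    simp at hv

lemma exists_eigenvector_of_le_lamMax {T : Param M →L[ℝ] Param M} {ω : ℝ} (hω : 0 < ω)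
    (h : ω ≤ lamMax T) : ∃ l v, ω ≤ l ∧ ‖v‖ = 1 ∧ T v = l • v := by
  have hne : {l : ℝ | Module.End.HasEigenvalue (T : Module.End ℝ (Param M)) l}.Nonempty := by
    by_contra h0
    rw [Set.not_nonempty_iff_eq_empty] at h0
    -- An empty spectrum would give `lamMax` the default value `0`, excluded by `0 < ω`.
    rw [lamMax, h0, Real.sSup_empty] at h
    linarith
  have hmem := hne.csSup_mem (Module.End.finite_hasEigenvalue _)
  obtain ⟨v, hv⟩ := Module.End.HasEigenvalue.exists_hasEigenvector hmem
  have h1 : T v = lamMax T • v := hv.apply_eq_smul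
  refine ⟨lamMax T, ‖v‖⁻¹ • v, h, norm_smul_inv_norm hv.2, ?_⟩
  rw [map_smul, h1, smul_comm]

lemma mem_posEigenspace {T : Param M →L[ℝ] Param M} {v : Param M} {l : ℝ} (hl : 0 < l)
    (h : T v = l • v) : v ∈ posEigenspace T :=
  le_iSup₂ (f := fun (l : ℝ) (_ : 0 < l) =>
    Module.End.eigenspace (T : Module.End ℝ (Param M)) l) l hl (Module.End.mem_eigenspace_iff.2 h)

lemma eigenvalue_le_norm {T : Param M →L[ℝ] Param M} {v : Param M} {l : ℝ} (hv : ‖v‖ = 1)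
    (h : T v = l • v) : l ≤ ‖T‖ := by
  have := T.le_opNorm v
  rw [h, norm_smul, hv, mul_one, mul_one] at this
  exact (le_abs_self l).trans this

variable {f : Param M → ℝ} {F C L K μ ℓ δ ω : ℝ}

namespace SmoothObjective

lemma continuous_hess (hf : SmoothObjective f F C L K) : Continuous (hess f) := by
  refine continuous_iff_continuousAt.2 fun x => ?_
  refine tendsto_iff_norm_sub_tendsto_zero.2 (squeeze_zero (fun _ => norm_nonneg _)
    (fun y => hf.norm_hess_sub_le y x) ?_)
  have : Continuous fun y : Param M => K * ‖y - x‖ := by fun_prop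
  simpa using this.tendsto x

lemma measurableSet_largeGrad (hf : SmoothObjective f F C L K) :
    MeasurableSet (largeGrad f μ ℓ δ) :=
  (isClosed_le continuous_const (hf.continuous_gradient.norm.pow 2)).measurableSet

/-- The set is the projection of the closed set of triples (unit vector, eigenvalue in `[ω, L]`,
point) along a compact factor; continuity of eigenvalues is not needed. -/
lemma isClosed_le_lamMax (hf : SmoothObjective f F C L K) (hω : 0 < ω) :
    IsClosed {x | ω ≤ lamMax (hess f x)} := by
  let W : Set ((Metric.sphere (0 : Param M) 1 × Set.Icc ω L) × Param M) := {q | hess f q.2 q.1.1 = (q.1.2 : ℝ) • (q.1.1 : Param M)}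
  have hW : IsClosed W := by
    refine isClosed_eq ?_ (by fun_prop)
    exact (hf.continuous_hess.comp continuous_snd).clm_apply (by fun_prop)
  have : {x | ω ≤ lamMax (hess f x)} = Prod.snd '' W := by
    ext x
    constructor
    · intro hx
      obtain ⟨l, v, hl, hv, h⟩ := exists_eigenvector_of_le_lamMax hω hx
      exact ⟨⟨⟨⟨v, by simpa using hv⟩, ⟨l, hl, (eigenvalue_le_norm hv h).trans
        (hf.norm_hess_le x)⟩⟩, x⟩, h, rfl⟩
    · rintro ⟨⟨⟨⟨v, hv⟩, ⟨l, hl⟩⟩, x⟩, h, rfl⟩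
      exact hl.1.trans (le_lamMax (by simpa using hv) h)
  rw [this]
  exact isClosedMap_snd_of_compactSpace W hW

lemma measurableSet_strictSaddle (hf : SmoothObjective f F C L K) (hω : 0 < ω) :
    MeasurableSet (strictSaddle f μ ℓ δ ω) :=
  hf.measurableSet_largeGrad.compl.inter (hf.isClosed_le_lamMax hω).measurableSet

end SmoothObjective

end Spectrum

/-! ### Events of not yet having left a region. -/

section Stay

/-- The iterates at the times `t, …, t + m - 1` all lie in `U`. -/
def stayEvent {M : ℕ} {Ω : Type*} (θ : ℕ → Ω → Param M) (U : Set (Param M)) (t m : ℕ) : Set Ω :=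
  {w | ∀ s, t ≤ s → s < t + m → θ s w ∈ U}

lemma stayEvent_subset {M : ℕ} {Ω : Type*} (θ : ℕ → Ω → Param M) (U : Set (Param M)) {t m t' m' : ℕ} (ht : t ≤ t')
    (hm : t' + m' ≤ t + m) : stayEvent θ U t m ⊆ stayEvent θ U t' m' :=
  fun _ hw s hs hs' => hw s (ht.trans hs) (hs'.trans_le hm)

end Stay

/-! ### Localisation to small pieces and the bound on exit times. -/

section Iterates

variable {M : ℕ} {Ω : Type*} [MeasurableSpace Ω] {P : Measure Ω}
  {f : Param M → ℝ} {F C L K : ℝ} {μ σ D β ν : ℝ} {θ ξ d : ℕ → Ω → Param M}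
  {Rxi : Param M → Param M →L[ℝ] Param M} {E : Set Ω}

/-- A set integral is nonnegative if it is so on all small pieces. -/
lemma setIntegral_nonneg_of_pieces {t : ℕ} {ε : ℝ} (hε : 0 < ε)
    (hθ : ∀ t, Measurable (θ t)) {g : Ω → ℝ} (hg : Integrable g P)
    (hE : MeasurableSet[history θ t] E)
    (hpiece : ∀ E' ⊆ E, MeasurableSet[history θ t] E' →
      (∀ w ∈ E', ∀ w' ∈ E', ‖θ t w' - θ t w‖ ≤ ε) → 0 ≤ ∫ w in E', g w ∂P) :
    0 ≤ ∫ w in E, g w ∂P := by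
  -- Balls of radius `ε/2` around a dense sequence, made disjoint, partition the space into
  -- countably many sets of diameter at most `ε`; their preimages belong to the past.
  let V : ℕ → Set (Param M) := disjointed fun k =>
    Metric.ball (TopologicalSpace.denseSeq (Param M) k) (ε / 2)
  have hV : ∀ k, MeasurableSet (V k) := fun k =>
    MeasurableSet.disjointed (fun _ => measurableSet_ball) k
  have hU : ⋃ k, V k = Set.univ := by
    rw [iUnion_disjointed, Set.eq_univ_iff_forall]
    intro x
    obtain ⟨k, hk⟩ := (TopologicalSpace.denseRange_denseSeq (Param M)).exists_dist_lt x
      (half_pos hε)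
    exact Set.mem_iUnion.2 ⟨k, hk⟩
  have hEk : ∀ k, MeasurableSet[history θ t] (E ∩ θ t ⁻¹' V k) := fun k =>
    hE.inter (measurable_history θ le_rfl (hV k))
  have hEU : E = ⋃ k, E ∩ θ t ⁻¹' V k := by
    rw [← Set.inter_iUnion, ← Set.preimage_iUnion, hU, Set.preimage_univ, Set.inter_univ]
  rw [hEU]
  refine (hasSum_integral_iUnion (fun k => history_le hθ t _ (hEk k)) ?_
    hg.integrableOn).nonneg fun k => hpiece _ Set.inter_subset_left (hEk k) ?_
  · intro i j hij
    exact ((disjoint_disjointed _ hij).preimage (θ t)).mono Set.inter_subset_right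
      Set.inter_subset_right
  · rintro w ⟨_, hw⟩ w' ⟨_, hw'⟩
    have h1 := disjointed_subset (fun k =>
      Metric.ball (TopologicalSpace.denseSeq (Param M) k) (ε / 2)) k hw
    have h2 := disjointed_subset (fun k =>
      Metric.ball (TopologicalSpace.denseSeq (Param M) k) (ε / 2)) k hw'
    rw [← dist_eq_norm]
    have := dist_triangle_right (θ t w') (θ t w) (TopologicalSpace.denseSeq (Param M) k)
    rw [Metric.mem_ball] at h1 h2
    linarith

namespace AscentProcess

variable [IsProbabilityMeasure P]

lemma integrable_objective (h : AscentProcess P f μ σ D β ν θ ξ d Rxi)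
    (hf : SmoothObjective f F C L K) (t : ℕ) : Integrable (fun w => f (θ t w)) P :=
  Integrable.of_bound (hf.continuous.measurable.comp (h.measurable_iterate t)).aestronglyMeasurable
    F (Filter.Eventually.of_forall fun _ => hf.abs_le _)

/-- An ascent estimate on small pieces of a past event holds on the whole event. -/
lemma ascent_of_pieces (h : AscentProcess P f μ σ D β ν θ ξ d Rxi)
    (hf : SmoothObjective f F C L K) {ε b : ℝ} (hε : 0 < ε) {t s : ℕ}
    (hE : MeasurableSet[history θ t] E)
    (hpiece : ∀ E' ⊆ E, MeasurableSet[history θ t] E' →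
      (∀ w ∈ E', ∀ w' ∈ E', ‖θ t w' - θ t w‖ ≤ ε) →
      ∫ w in E', f (θ t w) ∂P + b * P.real E' ≤ ∫ w in E', f (θ (t + s) w) ∂P) :
    ∫ w in E, f (θ t w) ∂P + b * P.real E ≤ ∫ w in E, f (θ (t + s) w) ∂P := by
  have hi := h.integrable_objective hf t
  have hi' := h.integrable_objective hf (t + s)
  have key : ∀ E' : Set Ω, ∫ w in E', (f (θ (t + s) w) - f (θ t w) - b) ∂P =
      ∫ w in E', f (θ (t + s) w) ∂P - ∫ w in E', f (θ t w) ∂P - b * P.real E' := by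
    intro E'
    have hs : IntegrableOn (fun w => f (θ (t + s) w) - f (θ t w)) E' P :=
      (hi'.sub hi).integrableOn
    rw [integral_sub hs (integrable_const _), integral_sub hi'.integrableOn hi.integrableOn, setIntegral_const, smul_eq_mul,
      mul_comm b]
  have := setIntegral_nonneg_of_pieces hε h.measurable_iterate
    ((hi'.sub hi).sub (integrable_const b)) hE fun E' hE' hm hp => by
      have h1 := hpiece E' hE' hm hp
      have h2 := key E'
      simp only [Pi.sub_apply] at h2 ⊢
      rw [h2]
      linarith
  have h2 := key E
  simp only [Pi.sub_apply] at this
  linarith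

/-- Expected ascent in one step from points of large gradient. -/
lemma large_gradient_ascent (h : AscentProcess P f μ σ D β ν θ ξ d Rxi)
    (hf : SmoothObjective f F C L K) (hμ : 0 < μ) (hD : 0 < D) (hL : 0 ≤ L) {t : ℕ} {g : ℝ}
    (hE : MeasurableSet[history θ t] E) (hg : ∀ w ∈ E, g ≤ ‖gradient f (θ t w)‖ ^ 2) :
    ∫ w in E, f (θ t w) ∂P +
      (μ / 2 * g - μ ^ 2 / 2 * (L * σ ^ 2 + D ^ 2 * μ)) * P.real E ≤
      ∫ w in E, f (θ (t + 1) w) ∂P := by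
  -- The pieces serve here only to provide the bounded iterates that `ascent_step` asks for.
  refine h.ascent_of_pieces hf hμ hE fun E' hE' hm hp => ?_
  rcases E'.eq_empty_or_nonempty with rfl | ⟨w₀, hw₀⟩
  · simp
  have hb := hp w₀ hw₀
  have hb₀ : ∀ᵐ w ∂P, w ∈ E' → ‖θ t w - θ t w₀‖ ≤ μ := Filter.Eventually.of_forall hb
  have h1 := h.ascent_step hf hμ hD hL hm hb₀ (h.ae_norm_sub_le hμ.le hb 1)
  have hm' := h.measurableSet_of_history hm
  have h2 : g * P.real E' ≤ ∫ w in E', ‖gradient f (θ t w)‖ ^ 2 ∂P := by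
    have := setIntegral_mono_on (μ := P) (s := E') (f := fun _ => g) (integrable_const _)
      (h.integrableOn_comp hm' hb₀ (hf.continuous_gradient.norm.pow 2)) hm'
      fun w hw => hg w (hE' hw)
    rwa [setIntegral_const, smul_eq_mul, mul_comm] at this
  have := mul_le_mul_of_nonneg_left h2 (half_pos hμ).le
  linarith

/-- The expected number of steps before the iterates leave `U` is controlled by an ascent in
blocks of steps. -/
lemma stayEvent_le_of_block (h : AscentProcess P f μ σ D β ν θ ξ d Rxi)
    (hf : SmoothObjective f F C L K) {U : Set (Param M)} {c : ℝ}
    (hc : 0 ≤ c) {m n t : ℕ} (hn : 1 ≤ n) (hE : MeasurableSet[history θ t] E)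
    (ih : ∀ k < m, ∀ t E, MeasurableSet[history θ t] E →
      c * k * P.real (E ∩ stayEvent θ U t k) ≤ ∫ w in E, (F - f (θ t w)) ∂P)
    (hgain : ∫ w in E, f (θ t w) ∂P + c * n * P.real E ≤ ∫ w in E, f (θ (t + n) w) ∂P) :
    c * m * P.real (E ∩ stayEvent θ U t m) ≤ ∫ w in E, (F - f (θ t w)) ∂P := by
  have hi := h.integrable_objective hf
  have hsub : ∀ t, ∫ w in E, (F - f (θ t w)) ∂P = F * P.real E - ∫ w in E, f (θ t w) ∂P := by
    intro t
    rw [integral_sub (integrable_const _) (hi t).integrableOn, setIntegral_const, smul_eq_mul,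
      mul_comm]
  have hgain' : c * n * P.real E + ∫ w in E, (F - f (θ (t + n) w)) ∂P ≤
      ∫ w in E, (F - f (θ t w)) ∂P := by
    rw [hsub, hsub]
    linarith
  refine le_trans ?_ hgain'
  have hle : P.real (E ∩ stayEvent θ U t m) ≤ P.real E := measureReal_mono Set.inter_subset_left
  -- Either one block covers all `m` steps, or the induction hypothesis handles the remaining `m -
  -- n` steps from time `t + n`, where `E` still is a past event.
  rcases le_total m n with hmn | hmn
  · have h0 : 0 ≤ ∫ w in E, (F - f (θ (t + n) w)) ∂P :=
      integral_nonneg fun w => sub_nonneg.2 (le_of_abs_le (hf.abs_le _))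
    have : c * m * P.real (E ∩ stayEvent θ U t m) ≤ c * n * P.real E := by gcongr
    linarith
  · have h1 := ih (m - n) (by omega) (t + n) E (history_mono θ (Nat.le_add_right t n) E hE)
    have h2 : P.real (E ∩ stayEvent θ U t m) ≤ P.real (E ∩ stayEvent θ U (t + n) (m - n)) :=
      measureReal_mono (Set.inter_subset_inter_right _
        (stayEvent_subset θ U (by omega) (by omega)))
    rw [Nat.cast_sub hmn] at h1
    have hmn' : (0 : ℝ) ≤ m - n := sub_nonneg.2 (by exact_mod_cast hmn)
    have h3 : c * (m - n : ℝ) * P.real (E ∩ stayEvent θ U t m) ≤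
        c * (m - n : ℝ) * P.real (E ∩ stayEvent θ U (t + n) (m - n)) := by gcongr
    have h4 : c * n * P.real (E ∩ stayEvent θ U t m) ≤ c * n * P.real E := by gcongr
    linarith

/-- If the objective increases in expectation by `c` per step, over one step from `A` and over
blocks of `n` steps from `B`, then the iterates leave `A ∪ B` quickly. -/
lemma stayEvent_le (h : AscentProcess P f μ σ D β ν θ ξ d Rxi)
    (hf : SmoothObjective f F C L K) {A B : Set (Param M)} (hA : MeasurableSet A)
    (hB : MeasurableSet B) {c : ℝ} (hc : 0 ≤ c) {n : ℕ} (hn : 1 ≤ n)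
    (hgainA : ∀ t E, MeasurableSet[history θ t] E → (∀ w ∈ E, θ t w ∈ A) →
      ∫ w in E, f (θ t w) ∂P + c * P.real E ≤ ∫ w in E, f (θ (t + 1) w) ∂P)
    (hgainB : ∀ t E, MeasurableSet[history θ t] E → (∀ w ∈ E, θ t w ∈ B) →
      ∫ w in E, f (θ t w) ∂P + c * n * P.real E ≤ ∫ w in E, f (θ (t + n) w) ∂P) (m : ℕ) :
    ∀ t E, MeasurableSet[history θ t] E →
      c * m * P.real (E ∩ stayEvent θ (A ∪ B) t m) ≤ ∫ w in E, (F - f (θ t w)) ∂P := by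
  induction m using Nat.strong_induction_on with
  | _ m ih =>
  intro t E hE
  have h0 : ∀ E : Set Ω, 0 ≤ ∫ w in E, (F - f (θ t w)) ∂P := fun E =>
    integral_nonneg fun w => sub_nonneg.2 (le_of_abs_le (hf.abs_le _))
  rcases Nat.eq_zero_or_pos m with rfl | hm
  · simpa using h0 E
  have hmA := measurable_history θ le_rfl hA (t := t)
  have hmB := measurable_history θ le_rfl hB (t := t)
  have hEA := hE.inter hmA
  have hEB := (hE.diff hmA).inter hmB
  have hEC := (hE.diff hmA).diff hmB
  have h1 := h.stayEvent_le_of_block hf hc le_rfl hEA ih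
    (by simpa using hgainA t _ hEA fun w hw => hw.2)
  have h2 := h.stayEvent_le_of_block hf hc hn hEB ih (hgainB t _ hEB fun w hw => hw.2)
  have hi : Integrable (fun w => F - f (θ t w)) P :=
    (integrable_const F).sub (h.integrable_objective hf t)
  have h3 := integral_inter_add_sdiff (μ := P) (history_le h.measurable_iterate t _ hmA)
    (hi.integrableOn (s := E))
  have h4 := integral_inter_add_sdiff (μ := P) (history_le h.measurable_iterate t _ hmB)
    (hi.integrableOn (s := E \ θ t ⁻¹' A))
  have h5 : P.real (E ∩ stayEvent θ (A ∪ B) t m) ≤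
      P.real (E ∩ θ t ⁻¹' A ∩ stayEvent θ (A ∪ B) t m) +
        P.real ((E \ θ t ⁻¹' A) ∩ θ t ⁻¹' B ∩ stayEvent θ (A ∪ B) t m) := by
    refine (measureReal_mono ?_).trans (measureReal_union_le _ _)
    rintro w ⟨hw, hs⟩
    by_cases hwA : θ t w ∈ A
    · exact Or.inl ⟨⟨hw, hwA⟩, hs⟩
    · exact Or.inr ⟨⟨⟨hw, hwA⟩, (hs t le_rfl (by omega)).resolve_left hwA⟩, hs⟩
  have h6 := mul_le_mul_of_nonneg_left h5 (mul_nonneg hc (Nat.cast_nonneg m))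
  -- The part of `E` outside both regions has already left, so it adds only a nonnegative integral
  -- on the right.
  linarith [h0 ((E \ θ t ⁻¹' A) \ θ t ⁻¹' B)]

end AscentProcess

end Iterates

end BiasedPG

namespace BiasedPG

/-- The average ascent of the objective per step, in units of `μ ^ 2`. -/
noncomputable def ascentGain (L σ δ : ℝ) : ℝ := L * σ ^ 2 / (4 * δ)

/-- The time (number of steps times step size) that suffices to escape a strict saddle point. -/
noncomputable def escapeTime (L σ σl δ ω : ℝ) : ℝ :=
  32 * (L * σ ^ 2 / 2 + ascentGain L σ δ + 1) / (ω ^ 2 * σl ^ 2)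

/-- Bound of the fourth moment of the displacement during the escape from a strict saddle point. -/
noncomputable def escapeConst (L σ D σl δ ω : ℝ) : ℝ :=
  fourthConst L σ D (L * σ ^ 2 * (1 + 1 / δ)) (escapeTime L σ σl δ ω + 1)

/-- The step size is small compared with the constants of the problem. -/
structure SmallStep (L K σ D σl δ ω c μ : ℝ) : Prop where
  pos : 0 < μ
  le_one : μ ≤ 1
  mul_le : μ * L ≤ 1 / 4
  holder_le : c * (escapeConst L σ D σl δ ω * μ ^ 2) ≤ σl ^ 2 / 8
  drift_le : 48 * μ * (K ^ 2 * escapeConst L σ D σl δ ω + D ^ 2) ≤ ω * σl ^ 2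
  escape_le : L * σ ^ 2 / 2 + ascentGain L σ δ ≤
    ω ^ 2 * σl ^ 2 * (escapeTime L σ σl δ ω - μ) / 32 -
      μ * (K ^ 2 * escapeConst L σ D σl δ ω + D ^ 2) / 2
  bias_le : D ^ 2 * μ * (2 + 1 / δ) ≤ L * σ ^ 2 / (2 * δ)

lemma ascentGain_pos {L σ δ : ℝ} (hL : 0 < L) (hσ : 0 < σ) (hδ : 0 < δ) :
    0 < ascentGain L σ δ := by
  unfold ascentGain
  positivity

lemma escapeTime_pos {L σ σl δ ω : ℝ} (hL : 0 < L) (hσ : 0 < σ) (hσl : 0 < σl) (hδ : 0 < δ)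
    (hω : 0 < ω) : 0 < escapeTime L σ σl δ ω := by
  have := ascentGain_pos hL hσ hδ
  unfold escapeTime
  positivity

/-- Every condition is continuous in `μ` and strict at `μ = 0`, so it persists for small positive
steps. -/
lemma eventually_smallStep {L K σ D σl δ ω c : ℝ} (hL : 0 < L) (hσ : 0 < σ) (hσl : 0 < σl)
    (hδ : 0 < δ) (hω : 0 < ω) :
    ∀ᶠ μ in nhdsWithin 0 (Set.Ioi 0), SmallStep L K σ D σl δ ω c μ := by
  -- `escapeTime` is chosen so that the escape gain exceeds noise loss plus target gain by `1`,
  -- which leaves room for the terms of order `μ`.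
  have key : ω ^ 2 * σl ^ 2 * escapeTime L σ σl δ ω / 32 =
      L * σ ^ 2 / 2 + ascentGain L σ δ + 1 := by
    unfold escapeTime
    field_simp
  have h (φ : ℝ → ℝ) (b : ℝ) (hφ : Continuous φ) (h : φ 0 < b) :
      ∀ᶠ μ in nhdsWithin 0 (Set.Ioi 0), φ μ ≤ b :=
    ((hφ.tendsto 0).mono_left nhdsWithin_le_nhds).eventually_le_const h
  filter_upwards [self_mem_nhdsWithin, h (fun μ => μ) 1 (by fun_prop) one_pos,
    h (fun μ => μ * L) (1 / 4) (by fun_prop) (by norm_num),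
    h (fun μ => c * (escapeConst L σ D σl δ ω * μ ^ 2)) (σl ^ 2 / 8) (by fun_prop)
      (by simp only [ne_eq, OfNat.ofNat_ne_zero, not_false_eq_true, zero_pow, mul_zero]; positivity),
    h (fun μ => 48 * μ * (K ^ 2 * escapeConst L σ D σl δ ω + D ^ 2)) (ω * σl ^ 2) (by fun_prop)
      (by simp only [mul_zero, zero_mul]; positivity),
    h (fun μ => L * σ ^ 2 / 2 + ascentGain L σ δ -
      (ω ^ 2 * σl ^ 2 * (escapeTime L σ σl δ ω - μ) / 32 -
      μ * (K ^ 2 * escapeConst L σ D σl δ ω + D ^ 2) / 2)) 0 (by fun_prop)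
      (by simp only [sub_zero, key]; linarith),
    h (fun μ => D ^ 2 * μ * (2 + 1 / δ)) (L * σ ^ 2 / (2 * δ)) (by fun_prop)
      (by simp only [mul_zero, zero_mul]; positivity)]
    with μ h0 h1 h2 h3 h4 h5 h6
  exact ⟨h0, h1, h2, h3, h4, sub_nonpos.1 h5, h6⟩

/-! ### Ascent with explicit constants and the probability of escape. -/

section Iterates

variable {M : ℕ} {Ω : Type*} [MeasurableSpace Ω] {P : Measure Ω} [IsProbabilityMeasure P]
  {f : Param M → ℝ} {F C L K : ℝ} {μ σ D β ν σl δ ω ℓ c : ℝ} {θ ξ d : ℕ → Ω → Param M}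
  {Rxi : Param M → Param M →L[ℝ] Param M} {E : Set Ω}

namespace AscentProcess

/-- Expected ascent from strict saddle points, over a number of steps of order `1 / μ`. -/
lemma strict_saddle_ascent (h : AscentProcess P f μ σ D β ν θ ξ d Rxi)
    (hf : SmoothObjective f F C L K) (hμ : SmallStep L K σ D σl δ ω c μ) (hL : 0 < L)
    (hK : 0 ≤ K) (hσ : 0 < σ) (hD : 0 < D) (hσl : 0 < σl) (hδ : 0 < δ) (hω : 0 < ω)
    (hℓ : ℓ = L * σ ^ 2 - D ^ 2 * μ) (hc0 : 0 ≤ c)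
    (hc : ∀ x, 0 ≤ x → β * x ^ ν ≤ σl ^ 2 / 4 + c * x ^ 4)
    (hcorr : CorrelatedCurvature f P μ ℓ δ ω σl θ Rxi) {t : ℕ} (hE : MeasurableSet[history θ t] E)
    (hsaddle : ∀ w ∈ E, θ t w ∈ strictSaddle f μ ℓ δ ω) :
    ∫ w in E, f (θ t w) ∂P +
      ascentGain L σ δ * μ ^ 2 * ⌈escapeTime L σ σl δ ω / μ⌉₊ * P.real E ≤
      ∫ w in E, f (θ (t + ⌈escapeTime L σ σl δ ω / μ⌉₊) w) ∂P := by
  have hμ₀ := hμ.pos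
  refine h.ascent_of_pieces hf hμ₀ hE fun E' hE' hm hp => ?_
  have hT := escapeTime_pos hL hσ hσl hδ hω
  have hesc := hμ.escape_le
  have hdrift := hμ.drift_le
  have hhold := hμ.holder_le
  set n := ⌈escapeTime L σ σl δ ω / μ⌉₊
  have hn1 : escapeTime L σ σl δ ω ≤ n * μ := (div_le_iff₀ hμ₀).1 (Nat.le_ceil _)
  -- Rounding up the number of steps costs at most `μ ≤ 1`, hence the `+ 1` in the horizon of
  -- `escapeConst`.
  have hn2 : n * μ ≤ escapeTime L σ σl δ ω + 1 := by
    have h1 := (Nat.ceil_lt_add_one (div_nonneg hT.le hμ₀.le)).le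
    have h2 := mul_le_mul_of_nonneg_right h1 hμ₀.le
    rw [add_mul, div_mul_cancel₀ _ hμ₀.ne'] at h2
    linarith [hμ.le_one]
  -- The curvature condition holds only almost surely, so the base point must be one where it is
  -- valid; if the piece contains none, it is a null set.
  by_cases hne : ∃ w₀ ∈ E', ∀ u ∈ posEigenspace (hess f (θ t w₀)),
      σl ^ 2 * ‖u‖ ^ 2 ≤ ⟪Rxi (θ t w₀) u, u⟫
  · obtain ⟨w₀, hw₀, hR⟩ := hne
    obtain ⟨hG, hlam⟩ := hsaddle w₀ (hE' hw₀)
    obtain ⟨l, v, hl, hv, hT⟩ := exists_eigenvector_of_le_lamMax hω hlam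
    have hp' : SaddleDirection f μ (L * σ ^ 2 * (1 + 1 / δ)) (θ t w₀) v l := by
      refine ⟨?_, hv, hT⟩
      have h1 : ‖gradient f (θ t w₀)‖ ^ 2 < μ * ℓ * (1 + 1 / δ) := not_le.1 hG
      -- Replacing `ℓ` by `L * σ ^ 2` makes `Γ`, and with it the moment constants, independent of
      -- `μ`.
      have h2 : μ * ℓ * (1 + 1 / δ) ≤ μ * (L * σ ^ 2) * (1 + 1 / δ) := by
        have : ℓ ≤ L * σ ^ 2 := by rw [hℓ]; linarith [mul_nonneg (sq_nonneg D) hμ₀.le]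
        gcongr
      linarith
    have hRv := hR v (mem_posEigenspace (hω.trans_le hl) hT)
    rw [hv, one_pow, mul_one] at hRv
    refine le_trans ?_ (h.saddle_ascent hf hμ₀ hμ.le_one hL.le hK hD (by positivity) hp' hω hl
      ((eigenvalue_le_norm hv hT).trans (hf.norm_hess_le _)) hμ.mul_le hc0 hc hRv hhold hdrift hm
      (hp w₀ hw₀) hn2)
    gcongr
    -- After dividing by `μ² n`, the quadratic gain `μ³ n(n-1)` becomes `nμ - μ`, which is at least
    -- `escapeTime - μ`.
    have h1 : L * σ ^ 2 / 2 + ascentGain L σ δ ≤ ω ^ 2 * σl ^ 2 * (n * μ - μ) / 32 -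
        μ * (K ^ 2 * escapeConst L σ D σl δ ω + D ^ 2) / 2 := by
      refine hesc.trans ?_
      gcongr
    have h2 := mul_le_mul_of_nonneg_left h1 (by positivity : 0 ≤ μ ^ 2 * (n : ℝ))
    unfold escapeConst at h2
    linarith
  · push Not at hne
    have h0 : P E' = 0 := by
      refine measure_mono_null (fun w hw => ?_) (ae_iff.1 (hcorr t))
      intro hcon
      obtain ⟨u, hu, hlt⟩ := hne w hw
      exact absurd (hcon (hsaddle w (hE' hw)) u hu) (not_le.2 hlt)
    rw [Measure.restrict_eq_zero.2 h0]
    simp [measureReal_def, h0]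

/-- With high probability an approximate second-order stationary point is reached. -/
theorem stayEvent_compl_secondOrder_le (h : AscentProcess P f μ σ D β ν θ ξ d Rxi)
    (hf : SmoothObjective f F C L K) (hμ : SmallStep L K σ D σl δ ω c μ) (hL : 0 < L)
    (hK : 0 ≤ K) (hσ : 0 < σ) (hD : 0 < D) (hσl : 0 < σl) (hδ : 0 < δ) (hω : 0 < ω)
    (hℓ : ℓ = L * σ ^ 2 - D ^ 2 * μ) (hc0 : 0 ≤ c)
    (hc : ∀ x, 0 ≤ x → β * x ^ ν ≤ σl ^ 2 / 4 + c * x ^ 4)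
    (hcorr : CorrelatedCurvature f P μ ℓ δ ω σl θ Rxi) {m : ℕ} (hm : 0 < m)
    (hm' : 8 * F ≤ L * σ ^ 2 * μ ^ 2 * m) :
    P.real (stayEvent θ (secondOrder f μ ℓ δ ω)ᶜ 0 m) ≤ δ := by
  have hμ₀ := hμ.pos
  have hU : (secondOrder f μ ℓ δ ω)ᶜ = largeGrad f μ ℓ δ ∪ strictSaddle f μ ℓ δ ω := by
    ext x
    simp only [secondOrder, strictSaddle, Set.mem_compl_iff, Set.mem_ofPred_eq, Set.mem_union]
    by_cases hx : x ∈ largeGrad f μ ℓ δ <;> simp [hx]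
  have ha := ascentGain_pos hL hσ hδ
  have key := h.stayEvent_le hf (hf.measurableSet_largeGrad (μ := μ) (ℓ := ℓ) (δ := δ))
    (hf.measurableSet_strictSaddle (μ := μ) (ℓ := ℓ) (δ := δ) hω)
    (c := ascentGain L σ δ * μ ^ 2) (by positivity)
    (n := ⌈escapeTime L σ σl δ ω / μ⌉₊)
    (Nat.one_le_ceil_iff.2 (div_pos (escapeTime_pos hL hσ hσl hδ hω) hμ₀))
    (fun t E hE hw => ?_)
    (fun t E hE hw => h.strict_saddle_ascent hf hμ hL hK hσ hD hσl hδ hω hℓ hc0 hc hcorr hE hw)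
    m 0 Set.univ MeasurableSet.univ
  · rw [← hU, Set.univ_inter, setIntegral_univ] at key
    have h2 : ∫ w, (F - f (θ 0 w)) ∂P ≤ 2 * F := by
      have := integral_mono ((integrable_const F).sub (h.integrable_objective hf 0))
        (integrable_const (2 * F)) (μ := P) fun w => by
          have := neg_le_of_abs_le (hf.abs_le (θ 0 w))
          simp only [Pi.sub_apply]
          linarith
      simpa using this
    -- The factor `1/δ` in `ascentGain` cancels `δ`, so the required number of steps does not depend
    -- on `δ`.
    have h3 : 2 * F ≤ ascentGain L σ δ * μ ^ 2 * m * δ := by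
      have : ascentGain L σ δ * δ = L * σ ^ 2 / 4 := by
        unfold ascentGain
        field_simp
      calc 2 * F ≤ L * σ ^ 2 / 4 * μ ^ 2 * m := by linarith
        _ = _ := by rw [← this]; ring
    have hm0 : (0 : ℝ) < m := by exact_mod_cast hm
    exact le_of_mul_le_mul_left ((key.trans h2).trans h3) (by positivity)
  · refine le_trans ?_ (h.large_gradient_ascent hf hμ₀ hD hL.le hE hw)
    gcongr
    have h1 := mul_le_mul_of_nonneg_left hμ.bias_le (by positivity : 0 ≤ μ ^ 2 / 2)
    have h2 : L * σ ^ 2 / (2 * δ) = 2 * ascentGain L σ δ := by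
      unfold ascentGain
      field_simp
      ring
    have h3 : L * σ ^ 2 * (1 / δ) = 4 * ascentGain L σ δ := by
      unfold ascentGain
      field_simp
    have h4 : μ / 2 * (μ * ℓ * (1 + 1 / δ)) - μ ^ 2 / 2 * (L * σ ^ 2 + D ^ 2 * μ) =
        μ ^ 2 / 2 * (L * σ ^ 2 * (1 / δ)) - μ ^ 2 / 2 * (D ^ 2 * μ * (2 + 1 / δ)) := by
      rw [hℓ]
      ring
    rw [h4, h3]
    rw [h2] at h1
    linarith

end AscentProcess

end Iterates

/-- The iteration bound is of order at least `μ⁻³`. -/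
lemma le_mul_iterBound {M : ℕ} {Rmax γ L σ D σl δ ω μ F : ℝ} (hμ : 0 < μ) (hμ₁ : μ ≤ 1)
    (hγ₁ : γ < 1) (hRmax : 0 < Rmax) (hL : 0 < L) (hσ : 0 < σ) (hδ : 0 < δ) (hω : 0 < ω)
    (h : 16 * F * μ * ω * ((1 - γ) * (L * σ ^ 2 + D ^ 2) * δ) ≤
      4 * Rmax * Real.log (2 * M * (σ ^ 2 / σl ^ 2) + 1) * (L * σ ^ 2)) :
    8 * F ≤ L * σ ^ 2 * μ ^ 2 * iterBound M Rmax γ L σ D σl δ ω μ := by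
  have hγ : 0 < 1 - γ := sub_pos.2 hγ₁
  set lg := Real.log (2 * M * (σ ^ 2 / σl ^ 2) + 1) with hlg
  have hlg0 : 0 ≤ lg := Real.log_nonneg (by
    have : 0 ≤ 2 * (M : ℝ) * (σ ^ 2 / σl ^ 2) := by positivity
    linarith)
  have hlog0 : 0 < Real.log (1 + 2 * μ * ω) := Real.log_pos (by
    have : 0 < 2 * μ * ω := by positivity
    linarith)
  -- The logarithm in the denominator is what gives the iteration bound its extra factor `1/μ`.
  have hlog : Real.log (1 + 2 * μ * ω) ≤ 2 * μ * ω := by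
    have := Real.log_le_sub_one_of_pos (x := 1 + 2 * μ * ω) (by positivity)
    linarith
  have h1 : 4 * Rmax / ((1 - γ) * (L * σ ^ 2 + D ^ 2) * δ) * (lg / (2 * μ * ω)) ≤
      μ ^ 2 * iterBound M Rmax γ L σ D σl δ ω μ := by
    have : μ ^ 2 * iterBound M Rmax γ L σ D σl δ ω μ =
        4 * Rmax / ((1 - γ) * (L * σ ^ 2 + D ^ 2 * μ) * δ) *
          (lg / Real.log (1 + 2 * μ * ω)) := by
      unfold iterBound
      rw [← hlg]
      have : 0 < L * σ ^ 2 + D ^ 2 * μ := by positivity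
      field_simp
    rw [this]
    gcongr
    exact mul_le_of_le_one_right (sq_nonneg D) hμ₁
  calc 8 * F ≤ L * σ ^ 2 *
        (4 * Rmax / ((1 - γ) * (L * σ ^ 2 + D ^ 2) * δ) * (lg / (2 * μ * ω))) := by
        have hX : 0 < (1 - γ) * (L * σ ^ 2 + D ^ 2) * δ := by positivity
        rw [div_mul_div_comm, ← mul_div_assoc, le_div_iff₀ (by positivity)]
        linarith
    _ ≤ _ := by
        rw [mul_assoc (L * σ ^ 2) (μ ^ 2)]
        gcongr

end BiasedPG

/-! ### The choice of the step size threshold and the final probability bound. -/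

theorem theorem1
    (M : ℕ) (hM : 1 ≤ M)
    (γ : ℝ) (hγ₀ : 0 < γ) (hγ₁ : γ < 1)
    (Rmax G B ι : ℝ) (hRmax : 0 < Rmax) (hG : 0 < G) (hB : 0 < B) (hι : 0 ≤ ι)
    (β ν : ℝ) (hβ : 0 < β) (hν₀ : 0 < ν) (hν₄ : ν ≤ 4)
    (σ D σl : ℝ) (hσ : 0 < σ) (hD : 0 < D) (hσl : 0 < σl)
    (δ ω : ℝ) (hδ : 0 < δ) (hω : 0 < ω) :
    ∃ μ₀ : ℝ, 0 < μ₀ ∧ ∀ μ : ℝ, 0 < μ → μ < μ₀ →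
      ∀ (S A Z Ω : Type*) [MeasurableSpace S] [MeasurableSpace A] [MeasurableSpace Z]
        [MeasurableSpace Ω] (ref : Measure A) [SigmaFinite ref]
        (mdp : BiasedPG.MDP S A) (pol : BiasedPG.Policy M S A ref)
        (P : Measure Ω) [IsProbabilityMeasure P] (H : ℕ)
        (Ghat : BiasedPG.Param M → Z → (Fin H → S × A) → BiasedPG.Param M)
        (θ : ℕ → Ω → BiasedPG.Param M) (z : ℕ → Ω → Z) (τ : ℕ → Ω → (Fin H → S × A))
        (Rxi : BiasedPG.Param M → BiasedPG.Param M →L[ℝ] BiasedPG.Param M) (L ℓ : ℝ),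
        L = BiasedPG.smoothConst Rmax G B γ →
        ℓ = L * σ ^ 2 - D ^ 2 * μ →
        BiasedPG.IsRun mdp pol P μ Ghat θ z τ →
        BiasedPG.BoundedSmooth mdp pol Rmax G B ι →
        BiasedPG.HolderCovariance mdp pol P β ν Ghat θ z τ Rxi →
        BiasedPG.CorrelatedCurvature (BiasedPG.J mdp pol γ) P μ ℓ δ ω σl θ Rxi →
        BiasedPG.MomentBounds mdp pol γ P μ σ D Ghat θ z τ →
        1 - δ ≤ P.real {w | ∃ T : ℕ,
          (T : ℝ) ≤ BiasedPG.iterBound M Rmax γ L σ D σl δ ω μ ∧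
          θ T w ∈ BiasedPG.secondOrder (BiasedPG.J mdp pol γ) μ ℓ δ ω ∧
          ‖gradient (BiasedPG.J mdp pol γ) (θ T w)‖ ^ 2 ≤ μ * ℓ * (1 + 1 / δ) ∧
          BiasedPG.lamMax (BiasedPG.hess (BiasedPG.J mdp pol γ) (θ T w)) ≤ ω} := by
  have hγ : 0 < 1 - γ := sub_pos.2 hγ₁
  have hL : 0 < BiasedPG.smoothConst Rmax G B γ := by
    unfold BiasedPG.smoothConst
    positivity
  have hK : 0 ≤ BiasedPG.hessLip Rmax G B ι γ := tsum_nonneg fun n => by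
    unfold BiasedPG.stepHessLip
    positivity
  obtain ⟨c, hc0, hc⟩ := BiasedPG.rpow_le_add_pow_four hν₀ hν₄ hβ
    (by positivity : 0 < σl ^ 2 / 4)
  have hlg : 0 < Real.log (2 * M * (σ ^ 2 / σl ^ 2) + 1) := by
    have hM' : (0 : ℝ) < M := by exact_mod_cast hM
    have : 0 < 2 * (M : ℝ) * (σ ^ 2 / σl ^ 2) := by positivity
    exact Real.log_pos (by linarith)
  have hcont : Continuous fun μ : ℝ => 16 * (Rmax / (1 - γ)) * μ * ω *
      ((1 - γ) * (BiasedPG.smoothConst Rmax G B γ * σ ^ 2 + D ^ 2) * δ) := by fun_prop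
  -- The left side vanishes with `μ`, while the right side is positive because `1 ≤ M` makes the
  -- logarithm positive.
  have hbound := ((hcont.tendsto 0).mono_left (nhdsWithin_le_nhds (s := Set.Ioi 0))).eventually_le_const
    (u := 4 * Rmax * Real.log (2 * M * (σ ^ 2 / σl ^ 2) + 1) *
      (BiasedPG.smoothConst Rmax G B γ * σ ^ 2)) (by
      simp only [mul_zero, zero_mul]
      positivity)
  obtain ⟨μ₀, hμ₀, hsmall⟩ := mem_nhdsGT_iff_exists_Ioo_subset.1
    ((BiasedPG.eventually_smallStep (K := BiasedPG.hessLip Rmax G B ι γ) (c := c) (D := D)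
      hL hσ hσl hδ hω).and hbound)
  refine ⟨μ₀, hμ₀, ?_⟩
  intro μ hμ hμ' S A Z Ω _ _ _ _ ref _ mdp pol P _ H Ghat θ z τ Rxi L ℓ hLdef hℓ hrun hs hcov
    hcorr hmom
  obtain ⟨hstep, hiter⟩ := hsmall ⟨hμ, hμ'⟩
  subst hLdef
  have hJ := BiasedPG.smoothObjective_J hs hγ₀ hγ₁ hRmax hG hB hι
  have hproc := BiasedPG.ascentProcess_of_isRun hs hG hJ hrun hcov hmom
  set Nmax := BiasedPG.iterBound M Rmax γ (BiasedPG.smoothConst Rmax G B γ) σ D σl δ ω μ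
  have hN := BiasedPG.le_mul_iterBound hμ hstep.le_one hγ₁ hRmax hL hσ hδ hω hiter
  -- With `⌊Nmax⌋ + 1` steps the event covers the times `0, …, ⌊Nmax⌋`, exactly the integers allowed
  -- by the bound.
  have hstay := hproc.stayEvent_compl_secondOrder_le hJ hstep hL hK hσ hD hσl hδ hω hℓ hc0 hc
    hcorr (Nat.succ_pos ⌊Nmax⌋₊) (hN.trans (by
      gcongr
      exact_mod_cast (Nat.lt_floor_add_one Nmax).le))
  set W := BiasedPG.stayEvent θ
    (BiasedPG.secondOrder (BiasedPG.J mdp pol γ) μ ℓ δ ω)ᶜ 0 (Nat.succ ⌊Nmax⌋₊)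
  -- Subadditivity is enough here, so measurability of `W` is not required.
  have hW : 1 ≤ P.real W + P.real Wᶜ := by
    have := measureReal_union_le (μ := P) W Wᶜ
    rwa [Set.union_compl_self, probReal_univ] at this
  have hNpos : 0 ≤ Nmax := by
    by_contra hneg
    have h1 : 0 < BiasedPG.smoothConst Rmax G B γ * σ ^ 2 * μ ^ 2 := by positivity
    have h2 := mul_neg_of_pos_of_neg h1 (not_le.1 hneg)
    have : 0 < Rmax / (1 - γ) := by positivity
    linarith
  have hsub : P.real Wᶜ ≤ P.real {w | ∃ T : ℕ, (T : ℝ) ≤ Nmax ∧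
      θ T w ∈ BiasedPG.secondOrder (BiasedPG.J mdp pol γ) μ ℓ δ ω ∧
      ‖gradient (BiasedPG.J mdp pol γ) (θ T w)‖ ^ 2 ≤ μ * ℓ * (1 + 1 / δ) ∧
      BiasedPG.lamMax (BiasedPG.hess (BiasedPG.J mdp pol γ) (θ T w)) ≤ ω} := by
    refine measureReal_mono fun w hw => ?_
    simp only [W, BiasedPG.stayEvent, Set.mem_compl_iff, Set.mem_ofPred_eq, not_forall,
      not_not] at hw
    obtain ⟨T, -, hT, hmem⟩ := hw
    refine ⟨T, (Nat.le_floor_iff hNpos).1 (by omega), hmem, ?_, hmem.2.le⟩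
    exact (not_le.1 hmem.1).le
  linarith
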